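/- Let $A$ be a commutative ring with unit. For $n\ge 0$ let $X_n(A^2)$ be the free abelian group on the $(n+1)$-tuples $(\langle v_0\rangle,\dots,\langle v_n\rangle)$, where $\langle v\rangle=vA$, each $v_i\in A^2$ is a unimodular column vector, and $v_i,v_j$ form a basis of $A^2$ whenever $i\ne j$. Let $\partial_n:X_n(A^2)\to X_{n-1}(A^2)$ be the alternating sum of the face maps, let $\epsilon:X_0(A^2)\to\mathbb Z$ be the augmentation, and put $Z_n(A^2)=\ker\partial_n$, $B_n(A^2)=\operatorname{im}\partial_{n+1}$. Let $\mathrm{PSL}_2(A)=\mathrm{SL}_2(A)/\{aI_2:a^2=1\}$, and let $\mathrm{PB}(A)$, $\mathrm{PT}(A)$, $\mathrm{PSM}_2(A)\subseteq\mathrm{PSL}_2(A)$ be the images of the groups of upper triangular, diagonal and monomial matrices in $\mathrm{SL}_2(A)$. Let $\mathcal G_A=A^\times/(A^\times)^2$. Put $\mathcal{RP}(A)=H_0(\mathrm{PSL}_2(A),Z_2(A^2))$, on which $\langle a\rangle\in\mathcal G_A$ acts through any matrix in $\mathrm{GL}_2(A)$ of determinant $a$. Let $\mathcal{RP}_1(A)$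 be the kernel of the map $\lambda:\mathcal{RP}(A)\to H_0(\mathrm{PSL}_2(A),X_2(A^2))$ induced by inclusion. The connecting homomorphism of $0\to Z_2(A^2)\to X_2(A^2)\to B_1(A^2)\to0$ identifies $H_1(\mathrm{PSL}_2(A),B_1(A^2))$ with $\mathcal{RP}_1(A)$. The connecting homomorphism $\delta$ of $0\to Z_1(A^2)\to X_1(A^2)\to B_0(A^2)\to 0$ identifies $H_1(\mathrm{PSL}_2(A),Z_1(A^2))$ with the quotient of $H_2(\mathrm{PSL}_2(A),B_0(A^2))$ by the image of $H_2(\mathrm{PSL}_2(A),X_1(A^2))$, and the map $H_2(\mathrm{PSL}_2(A),B_0(A^2))\to H_2(\mathrm{PSL}_2(A),X_0(A^2))\cong H_2(\mathrm{PB}(A),\mathbb Z)$ induced by inclusion factors through $\delta$, giving $\lambda_1':H_1(\mathrm{PSL}_2(A),Z_1(A^2))\to H_2(\mathrm{PB}(A),\mathbb Z)$. Let $\lambda_1$ be the composite $\mathcal{RP}_1(A)\cong H_1(\mathrm{PSL}_2(A),B_1(A^2))\to H_1(\mathrm{PSL}_2(A),Z_1(A^2))\xrightarrow{\lambda_1'}H_2(\mathrm{PB}(A),\mathbb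 Z)$, and let $\mathcal{RB}(A)=\ker\lambda_1\subseteq\mathcal{RP}_1(A)$ be the refined Bloch group. With $\infty=\langle e_1\rangle$, $0=\langle e_2\rangle$ and $\mathbf a=\langle e_1+ae_2\rangle$ for $a\in A^\times$, let $\psi_1(a)\in\mathcal{RP}(A)$ be the class of $(\infty,0,\mathbf a)+(0,\infty,\mathbf a)-(\infty,0,\mathbf 1)-(0,\infty,\mathbf 1)\in Z_2(A^2)$. **Theorem.** Suppose that $X_\bullet(A^2)\to\mathbb Z$ is exact in dimensions $<2$ (that is, $\epsilon$ induces $H_0(X_\bullet(A^2))\cong\mathbb Z$, and $H_1(X_\bullet(A^2))=0$), that $\{a\in A:a^2=1\}=\{1,-1\}$, and that the inclusion $\mathrm{PT}(A)\subseteq\mathrm{PB}(A)$ induces isomorphisms $H_i(\mathrm{PT}(A),\mathbb Z)\cong H_i(\mathrm{PB}(A),\mathbb Z)$ for $i=2,3$. Then $\mathbb Z[\mathcal G_A]\psi_1(-1)\subseteq\mathcal{RB}(A)$, and the sequence $$H_3(\mathrm{PSM}_2(A),\mathbb Z)\to H_3(\mathrm{PSL}_2(A),\mathbb Z)\to\mathcal{RB}(A)/\mathbb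 Z[\mathcal G_A]\psi_1(-1)\to0$$ is exact. Here the first map is induced by inclusion, and the second one by the composite of connecting homomorphisms $$H_3(\mathrm{PSL}_2(A),\mathbb Z)\to H_2(\mathrm{PSL}_2(A),B_0(A^2))\to H_1(\mathrm{PSL}_2(A),B_1(A^2))\to H_0(\mathrm{PSL}_2(A),Z_2(A^2))=\mathcal{RP}(A)$$ of the short exact sequences $0\to B_0(A^2)\to X_0(A^2)\to\mathbb Z\to0$, $0\to B_1(A^2)\to X_1(A^2)\to B_0(A^2)\to0$ and $0\to Z_2(A^2)\to X_2(A^2)\to B_1(A^2)\to0$, whose image lies in $\mathcal{RB}(A)$. -/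

import Mathlib

open CategoryTheory

universe u

noncomputable section

namespace RefinedBloch

/-! ### Lines in `A²` and the action of `GL₂(A)` and `PSL₂(A)` -/

section Lines

variable (A : Type u) [CommRing A]

/-- Column vectors `A²`. -/
abbrev Vec : Type u := Fin 2 → A

variable {A}

/-- `v` is unimodular: `v₀ A + v₁ A = A`. -/
def IsUnimodular (v : Vec A) : Prop := Ideal.span {v 0, v 1} = ⊤

/-- The two vectors `v, w` form a basis of `A²`. -/
def IsBasisPair (v w : Vec A) : Prop :=
  LinearIndependent A ![v, w] ∧ Submodule.span A (Set.range ![v, w]) = ⊤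

variable (A) in
/-- The generators of `X_n(A²)`: tuples `(⟨v₀⟩, …, ⟨v_n⟩)`, `⟨v⟩ = vA`, of lines spanned by
unimodular vectors any two of which form a basis of `A²`. -/
structure Tuple (n : ℕ) : Type u where
  /-- the lines `⟨v₀⟩, …, ⟨v_n⟩` -/
  line : Fin (n + 1) → Submodule A (Vec A)
  exists_vec : ∃ v : Fin (n + 1) → Vec A, (∀ i, line i = Submodule.span A {v i}) ∧
    (∀ i, IsUnimodular (v i)) ∧ ∀ i j, i ≠ j → IsBasisPair (v i) (v j)

theorem Tuple.ext {n : ℕ} {x y : Tuple A n} (h : ∀ i, x.line i = y.line i) : x = y := by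
  obtain ⟨p, hp⟩ := x
  obtain ⟨q, hq⟩ := y
  obtain rfl : p = q := funext h
  rfl

theorem isBasisPair_iff (v w : Vec A) :
    IsBasisPair v w ↔ IsUnit (v 0 * w 1 - v 1 * w 0) := by
  unfold IsBasisPair
  rw [Module.Basis.is_basis_iff_det (Pi.basisFun A (Fin 2)), Pi.basisFun_det_apply, Matrix.det_fin_two]
  simp [mul_comm]

theorem isUnimodular_iff (v : Vec A) : IsUnimodular v ↔ ∃ a b : A, a * v 0 + b * v 1 = 1 := by
  unfold IsUnimodular
  rw [Ideal.eq_top_iff_one, Ideal.mem_span_pair]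

theorem IsUnimodular.map {v : Vec A} (hv : IsUnimodular v) (g : GL (Fin 2) A) :
    IsUnimodular ((g : Matrix (Fin 2) (Fin 2) A).mulVec v) := by
  rw [isUnimodular_iff] at *
  obtain ⟨a, b, h⟩ := hv
  let w : Vec A := Matrix.vecMul ![a, b] ((g⁻¹ : GL (Fin 2) A) : Matrix (Fin 2) (Fin 2) A)
  refine ⟨w 0, w 1, ?_⟩
  have : w ⬝ᵥ ((g : Matrix (Fin 2) (Fin 2) A).mulVec v) = 1 := by
    rw [Matrix.dotProduct_mulVec, Matrix.vecMul_vecMul, ← Units.val_mul, inv_mul_cancel]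
    simpa [dotProduct, Fin.sum_univ_two] using h
  simpa [dotProduct, Fin.sum_univ_two] using this

theorem IsBasisPair.map {v w : Vec A} (h : IsBasisPair v w) (g : GL (Fin 2) A) :
    IsBasisPair ((g : Matrix (Fin 2) (Fin 2) A).mulVec v)
      ((g : Matrix (Fin 2) (Fin 2) A).mulVec w) := by
  rw [isBasisPair_iff] at *
  have hg : IsUnit (g : Matrix (Fin 2) (Fin 2) A).det :=
    (Matrix.isUnit_iff_isUnit_det _).1 g.isUnit
  convert hg.mul h using 1
  simp [Matrix.mulVec, dotProduct, Fin.sum_univ_two, Matrix.det_fin_two]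
  ring

/-- `GL₂(A)` acts on the generators of `X_n(A²)` by `g ⟨v⟩ = ⟨g v⟩`. -/
instance (n : ℕ) : MulAction (GL (Fin 2) A) (Tuple A n) where
  smul g x := ⟨fun i ↦ (x.line i).map (g : Matrix (Fin 2) (Fin 2) A).mulVecLin, by
    obtain ⟨v, h₁, h₂, h₃⟩ := x.exists_vec
    refine ⟨fun i ↦ (g : Matrix (Fin 2) (Fin 2) A).mulVec (v i), fun i ↦ ?_,
      fun i ↦ (h₂ i).map g, fun i j hij ↦ (h₃ i j hij).map g⟩
    simp only [h₁, Submodule.map_span, Set.image_singleton, Matrix.mulVecLin_apply]⟩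
  one_smul x := by
    refine Tuple.ext fun i ↦ ?_
    change (x.line i).map (Matrix.mulVecLin ((1 : GL (Fin 2) A) : Matrix (Fin 2) (Fin 2) A)) = x.line i
    rw [Units.val_one, Matrix.mulVecLin_one, Submodule.map_id]
  mul_smul g h x := by
    refine Tuple.ext fun i ↦ ?_
    change (x.line i).map (Matrix.mulVecLin ((g * h : GL (Fin 2) A) : Matrix (Fin 2) (Fin 2) A)) =
      ((x.line i).map _).map _
    rw [Units.val_mul, Matrix.mulVecLin_mul, Submodule.map_comp]

theorem Tuple.smul_line {n : ℕ} (g : GL (Fin 2) A) (x : Tuple A n) (i : Fin (n + 1)) :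
    (g • x).line i = (x.line i).map (g : Matrix (Fin 2) (Fin 2) A).mulVecLin := rfl

/-- Scalar matrices act trivially. -/
theorem smul_eq_of_scalar {n : ℕ} (g : GL (Fin 2) A) (r : A)
    (h : (g : Matrix (Fin 2) (Fin 2) A) = Matrix.scalar (Fin 2) r) (x : Tuple A n) : g • x = x := by
  have hr : IsUnit r := by
    have hg : IsUnit (g : Matrix (Fin 2) (Fin 2) A).det :=
      (Matrix.isUnit_iff_isUnit_det _).1 g.isUnit
    rw [h] at hg
    simpa using hg
  refine Tuple.ext fun i ↦ ?_
  rw [Tuple.smul_line, h]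
  obtain ⟨v, h₁, -⟩ := x.exists_vec
  rw [h₁, Submodule.map_span, Set.image_singleton]
  have : (Matrix.scalar (Fin 2) r).mulVecLin (v i) = r • v i := by
    ext j; fin_cases j <;> simp [Matrix.mulVec, dotProduct, Matrix.diagonal]
  rw [this]
  exact Submodule.span_singleton_smul_eq hr _

variable (A) in
/-- `PSL₂(A)`, the quotient of `SL₂(A)` by its centre, i.e. by the matrices `a I₂`, `a² = 1`. -/
abbrev PSL : Type u := Matrix.ProjectiveSpecialLinearGroup (Fin 2) A

theorem center_smul {n : ℕ} (g : Matrix.SpecialLinearGroup (Fin 2) A)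
    (hg : g ∈ Subgroup.center (Matrix.SpecialLinearGroup (Fin 2) A)) (x : Tuple A n) :
    Matrix.SpecialLinearGroup.toGL g • x = x := by
  obtain ⟨r, -, hr⟩ := Matrix.SpecialLinearGroup.mem_center_iff.1 hg
  exact smul_eq_of_scalar _ r (by simpa using hr.symm) x

variable (A) in
/-- The action of `PSL₂(A)` on the generators of `X_n(A²)`, induced by that of `SL₂(A)`. -/
def pslToPerm (n : ℕ) : PSL A →* Equiv.Perm (Tuple A n) :=
  QuotientGroup.lift _
    ((MulAction.toPermHom (GL (Fin 2) A) (Tuple A n)).comp Matrix.SpecialLinearGroup.toGL)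
    (fun g hg ↦ Equiv.ext fun x ↦ center_smul g hg x)

instance (n : ℕ) : MulAction (PSL A) (Tuple A n) := MulAction.compHom _ (pslToPerm A n)

theorem mk_smul {n : ℕ} (g : Matrix.SpecialLinearGroup (Fin 2) A) (x : Tuple A n) :
    (QuotientGroup.mk g : PSL A) • x = Matrix.SpecialLinearGroup.toGL g • x := rfl

/-- The `i`-th face of a tuple: throw away the `i`-th line. -/
def Tuple.face {n : ℕ} (i : Fin (n + 2)) (x : Tuple A (n + 1)) : Tuple A n :=
  ⟨fun j ↦ x.line (i.succAbove j), by
    obtain ⟨v, h₁, h₂, h₃⟩ := x.exists_vec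
    exact ⟨fun j ↦ v (i.succAbove j), fun j ↦ h₁ _, fun j ↦ h₂ _,
      fun j k hjk ↦ h₃ _ _ fun h ↦ hjk (Fin.succAbove_right_injective h)⟩⟩

theorem Tuple.face_smul_GL {n : ℕ} (i : Fin (n + 2)) (g : GL (Fin 2) A) (x : Tuple A (n + 1)) :
    (g • x).face i = g • x.face i := rfl

theorem Tuple.face_smul {n : ℕ} (i : Fin (n + 2)) (g : PSL A) (x : Tuple A (n + 1)) :
    (g • x).face i = g • x.face i := by
  induction g using QuotientGroup.induction_on with
  | H g => rfl

end Lines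

/-! ### The complex `X_•(A²)` -/

/-- The ring of integers, placed in the universe of the ring `A`. A `ZZ`-module is the same as an
abelian group. -/
def ZZ : Type u := ULift.{u} ℤ

instance : CommRing ZZ.{u} := inferInstanceAs (CommRing (ULift.{u} ℤ))

/-- `ZZ` is the ring of integers. -/
def ZZ.equivInt : ZZ.{u} ≃+* ℤ := ULift.ringEquiv

section Complex

variable (A : Type u) [CommRing A]

/-- The free abelian group `X_n(A²)`. -/
abbrev XMod (n : ℕ) : Type u := Tuple A n →₀ ZZ.{u}

/-- `X_n(A²)` as a `PSL₂(A)`-module. -/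
def XRho (n : ℕ) : Representation ZZ.{u} (PSL A) (XMod A n) where
  toFun g := Finsupp.lmapDomain _ _ (g • ·)
  map_one' := by ext; simp
  map_mul' g h := by ext; simp [mul_smul]

/-- The `PSL₂(A)`-module `X_n(A²)`. -/
abbrev X (n : ℕ) : Rep ZZ.{u} (PSL A) := Rep.of (XRho A n)

/-- The differential `∂_{n+1} : X_{n+1}(A²) → X_n(A²)`, the alternating sum of the face maps. -/
def bdLin (n : ℕ) : XMod A (n + 1) →ₗ[ZZ.{u}] XMod A n :=
  ∑ i : Fin (n + 2), (-1 : ℤ) ^ (i : ℕ) • Finsupp.lmapDomain _ _ (Tuple.face i)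

theorem bdLin_single (n : ℕ) (x : Tuple A (n + 1)) (c : ZZ.{u}) :
    bdLin A n (Finsupp.single x c) =
      ∑ i : Fin (n + 2), (-1 : ℤ) ^ (i : ℕ) • Finsupp.single (x.face i) c := by
  simp only [bdLin, LinearMap.sum_apply, LinearMap.smul_apply, Finsupp.lmapDomain_apply,
    Finsupp.mapDomain_single]

theorem bdLin_zero_single (x : Tuple A 1) (c : ZZ.{u}) :
    bdLin A 0 (Finsupp.single x c) = Finsupp.single (x.face 0) c - Finsupp.single (x.face 1) c := by
  refine (bdLin_single A 0 x c).trans ((Fin.sum_univ_two _).trans ?_)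
  simp [sub_eq_add_neg]

theorem bdLin_one_single (x : Tuple A 2) (c : ZZ.{u}) :
    bdLin A 1 (Finsupp.single x c) = Finsupp.single (x.face 0) c - Finsupp.single (x.face 1) c +
      Finsupp.single (x.face 2) c := by
  refine (bdLin_single A 1 x c).trans ((Fin.sum_univ_three _).trans ?_)
  simp [sub_eq_add_neg]

/-- `∂_{n+1} : X_{n+1}(A²) → X_n(A²)` as a map of `PSL₂(A)`-modules. -/
def bd (n : ℕ) : X A (n + 1) ⟶ X A n :=
  Rep.ofHom ⟨bdLin A n, fun g ↦ by
    refine Finsupp.lhom_ext fun x c ↦ ?_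
    simp only [XRho, MonoidHom.coe_mk, OneHom.coe_mk, LinearMap.comp_apply,
      Finsupp.lmapDomain_apply, Finsupp.mapDomain_single, bdLin_single, Tuple.face_smul,
      map_sum, map_zsmul]⟩

/-- The trivial `PSL₂(A)`-module `ℤ`. -/
abbrev triv (G : Type u) [Group G] : Rep ZZ.{u} G := Rep.trivial ZZ.{u} G ZZ.{u}

/-- The augmentation `ε : X_0(A²) → ℤ`. -/
def aug : X A 0 ⟶ triv (PSL A) :=
  Rep.ofHom ⟨Finsupp.lsum ZZ.{u} fun _ ↦ LinearMap.id, fun g ↦ by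
    refine Finsupp.lhom_ext fun x c ↦ ?_
    simp [XRho, Finsupp.mapDomain_single]⟩

/-- `X_•(A²) → ℤ` is exact in dimensions `< 2`: the augmentation induces `H_0(X_•(A²)) ≃ ℤ`, and
`H_1(X_•(A²)) = 0`. -/
structure ExactBelowTwo : Prop where
  surjective_aug : Function.Surjective (aug A).hom
  exact_zero : Function.Exact (bd A 0).hom (aug A).hom
  exact_one : Function.Exact (bd A 1).hom (bd A 0).hom

end Complex

/-! ### Kernels and images of maps of modules over a group, short exact sequences -/

section Exact

variable {G : Type u} [Group G] {M N P : Rep.{u} ZZ.{u} G}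

/-- The kernel of a map of `G`-modules, as a `G`-module. -/
abbrev kerRep (f : M ⟶ N) : Rep.{u} ZZ.{u} G :=
  Rep.subrepresentation M (LinearMap.ker f.hom.toLinearMap) fun g x hx ↦ by
    have : f.hom x = 0 := hx
    change f.hom (M.ρ g x) = 0
    rw [Rep.hom_comm_apply, this, map_zero]

/-- The image of a map of `G`-modules, as a `G`-module. -/
abbrev imRep (f : M ⟶ N) : Rep.{u} ZZ.{u} G :=
  Rep.subrepresentation N (LinearMap.range f.hom.toLinearMap) fun g x hx ↦ by
    obtain ⟨y, rfl⟩ := hx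
    exact ⟨M.ρ g y, Rep.hom_comm_apply f g y⟩

/-- The inclusion of the kernel. -/
def kerIncl (f : M ⟶ N) : kerRep f ⟶ M :=
  Rep.ofHom ⟨(LinearMap.ker f.hom.toLinearMap).subtype, fun _ ↦ rfl⟩

/-- The inclusion of the image. -/
def imIncl (f : M ⟶ N) : imRep f ⟶ N :=
  Rep.ofHom ⟨(LinearMap.range f.hom.toLinearMap).subtype, fun _ ↦ rfl⟩

/-- A map of `G`-modules as a map onto its image. -/
def toIm (f : M ⟶ N) : M ⟶ imRep f :=
  Rep.ofHom ⟨f.hom.toLinearMap.rangeRestrict, fun g ↦ by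
    ext x
    exact congrArg Subtype.val (Subtype.ext (Rep.hom_comm_apply f g x) :
      (⟨f.hom (M.ρ g x), ⟨_, rfl⟩⟩ : LinearMap.range f.hom.toLinearMap) =
        ⟨N.ρ g (f.hom x), ⟨M.ρ g x, Rep.hom_comm_apply f g x⟩⟩)⟩

/-- The inclusion of the image of `f` into the kernel of `g`, when `g ∘ f = 0`. -/
def imToKer (f : M ⟶ N) (g : N ⟶ P) (h : f ≫ g = 0) : imRep f ⟶ kerRep g :=
  Rep.ofHom ⟨Submodule.inclusion (by
    rintro _ ⟨y, rfl⟩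
    have := congrArg (fun φ : M ⟶ P ↦ φ.hom y) h
    exact this), fun _ ↦ rfl⟩

theorem shortExact_of (S : ShortComplex (Rep.{u} ZZ.{u} G)) (hf : Function.Injective S.f.hom)
    (hg : Function.Surjective S.g.hom) (h : Function.Exact S.f.hom S.g.hom) : S.ShortExact where
  exact := by
    rw [← ShortComplex.exact_map_iff_of_faithful S (forget₂ (Rep.{u} ZZ.{u} G) (ModuleCat ZZ.{u})),
      ShortComplex.ShortExact.moduleCat_exact_iff_function_exact]
    exact h
  mono_f := (Rep.mono_iff_injective _).2 hf
  epi_g := (Rep.epi_iff_surjective _).2 hg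

/-- `0 → ker f → M → im f → 0`. -/
abbrev kerSeq (f : M ⟶ N) : ShortComplex (Rep.{u} ZZ.{u} G) :=
  ShortComplex.mk (kerIncl f) (toIm f) (by
    refine Rep.hom_ext (Representation.IntertwiningMap.ext (LinearMap.ext fun x ↦ ?_))
    exact Subtype.ext x.2)

theorem kerSeq_shortExact (f : M ⟶ N) : (kerSeq f).ShortExact :=
  shortExact_of _ Subtype.val_injective (LinearMap.surjective_rangeRestrict _) fun y ↦
    ⟨fun hy ↦ ⟨⟨y, congrArg Subtype.val hy⟩, rfl⟩, by
      rintro ⟨x, rfl⟩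
      exact Subtype.ext x.2⟩

/-- `0 → im f → N → im g → 0`, for `M → N → P` exact. -/
abbrev imSeq (f : M ⟶ N) (g : N ⟶ P) (h : Function.Exact f.hom g.hom) :
    ShortComplex (Rep.{u} ZZ.{u} G) :=
  ShortComplex.mk (imIncl f) (toIm g) (by
    refine Rep.hom_ext (Representation.IntertwiningMap.ext (LinearMap.ext fun x ↦ ?_))
    exact Subtype.ext ((h _).2 x.2))

theorem imSeq_shortExact (f : M ⟶ N) (g : N ⟶ P) (h : Function.Exact f.hom g.hom) :
    (imSeq f g h).ShortExact :=
  shortExact_of _ Subtype.val_injective (LinearMap.surjective_rangeRestrict _) fun y ↦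
    ⟨fun hy ↦ ⟨⟨y, (h y).1 (congrArg Subtype.val hy)⟩, rfl⟩, by
      rintro ⟨x, rfl⟩
      exact Subtype.ext ((h _).2 x.2)⟩

/-- `0 → im f → N → P → 0`, for `M → N → P → 0` exact. -/
abbrev cokerSeq (f : M ⟶ N) (g : N ⟶ P) (h : Function.Exact f.hom g.hom) :
    ShortComplex (Rep.{u} ZZ.{u} G) :=
  ShortComplex.mk (imIncl f) g (by
    refine Rep.hom_ext (Representation.IntertwiningMap.ext (LinearMap.ext fun x ↦ ?_))
    exact (h _).2 x.2)

theorem cokerSeq_shortExact (f : M ⟶ N) (g : N ⟶ P) (h : Function.Exact f.hom g.hom)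
    (hg : Function.Surjective g.hom) : (cokerSeq f g h).ShortExact :=
  shortExact_of _ Subtype.val_injective hg fun y ↦
    ⟨fun hy ↦ ⟨⟨y, (h y).1 hy⟩, rfl⟩, by
      rintro ⟨x, rfl⟩
      exact (h _).2 x.2⟩

/-- The group homology `H_n(G, M)`. -/
abbrev H (n : ℕ) (M : Rep.{u} ZZ.{u} G) : Type u := groupHomology M n

/-- The map `H_n(G, M) → H_n(G, N)` induced by a map of `G`-modules. -/
abbrev Hmap (n : ℕ) (f : M ⟶ N) : H n M →ₗ[ZZ.{u}] H n N :=
  (groupHomology.map (MonoidHom.id G) f n).hom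

/-- The connecting homomorphism `H_{n+1}(G, M₃) → H_n(G, M₁)` of a short exact sequence
`0 → M₁ → M₂ → M₃ → 0` of `G`-modules. -/
abbrev Hδ (n : ℕ) {S : ShortComplex (Rep.{u} ZZ.{u} G)} (hS : S.ShortExact) :
    H (n + 1) S.X₃ →ₗ[ZZ.{u}] H n S.X₁ :=
  (groupHomology.δ hS (n + 1) n rfl).hom

end Exact

/-! ### The subgroups `PB(A)`, `PT(A)`, `PSM₂(A)` of `PSL₂(A)` -/

section Subgroups

variable (A : Type u) [CommRing A]

/-- The upper triangular matrices in `SL₂(A)`. -/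
def B : Subgroup (Matrix.SpecialLinearGroup (Fin 2) A) where
  carrier := {g | g 1 0 = 0}
  one_mem' := by simp
  mul_mem' {g h} hg hh := by
    simp only [Set.mem_ofPred_eq] at *
    simp [Matrix.mul_apply, Fin.sum_univ_two, hg, hh]
  inv_mem' {g} hg := by
    simp only [Set.mem_ofPred_eq] at *
    simp [Matrix.SpecialLinearGroup.coe_inv, Matrix.adjugate_fin_two, hg]

/-- The diagonal matrices in `SL₂(A)`. -/
def T : Subgroup (Matrix.SpecialLinearGroup (Fin 2) A) where
  carrier := {g | g 0 1 = 0 ∧ g 1 0 = 0}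
  one_mem' := by simp
  mul_mem' {g h} hg hh := by
    simp only [Set.mem_ofPred_eq] at *
    simp [Matrix.mul_apply, Fin.sum_univ_two, hg, hh]
  inv_mem' {g} hg := by
    simp only [Set.mem_ofPred_eq] at *
    simp [Matrix.SpecialLinearGroup.coe_inv, Matrix.adjugate_fin_two, hg]

/-- The monomial matrices in `SL₂(A)`: the matrices `!![a, 0; 0, a⁻¹]` and `!![0, a; -a⁻¹, 0]`
with `a` a unit. -/
def SM : Subgroup (Matrix.SpecialLinearGroup (Fin 2) A) where
  carrier := {g | (g 0 1 = 0 ∧ g 1 0 = 0) ∨ (g 0 0 = 0 ∧ g 1 1 = 0)}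
  one_mem' := by simp
  mul_mem' {g h} hg hh := by
    simp only [Set.mem_ofPred_eq] at *
    rcases hg with hg | hg <;> rcases hh with hh | hh <;>
      simp [Matrix.mul_apply, Fin.sum_univ_two, hg, hh]
  inv_mem' {g} hg := by
    simp only [Set.mem_ofPred_eq] at *
    rcases hg with hg | hg <;>
      simp [Matrix.SpecialLinearGroup.coe_inv, Matrix.adjugate_fin_two, hg]

/-- `PB(A)`, the image of the upper triangular matrices in `PSL₂(A)`. -/
def PB : Subgroup (PSL A) := (B A).map (QuotientGroup.mk' _)

/-- `PT(A)`, the image of the diagonal matrices in `PSL₂(A)`. -/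
def PT : Subgroup (PSL A) := (T A).map (QuotientGroup.mk' _)

/-- `PSM₂(A)`, the image of the monomial matrices in `PSL₂(A)`. -/
def PSM : Subgroup (PSL A) := (SM A).map (QuotientGroup.mk' _)

theorem PT_le_PB : PT A ≤ PB A := Subgroup.map_mono fun _ h ↦ h.2

/-- The map `H_n(G, ℤ) → H_n(G', ℤ)` induced by a group homomorphism `G → G'`. -/
def HmapZ {G G' : Type u} [Group G] [Group G'] (φ : G →* G') (n : ℕ) :
    H n (triv G) →ₗ[ZZ.{u}] H n (triv G') :=
  (groupHomology.map φ (Rep.ofHom ⟨LinearMap.id, fun _ ↦ rfl⟩ :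
    triv G ⟶ Rep.res φ (triv G')) n).hom

end Subgroups

/-! ### The refined scissors congruence group and the refined Bloch group -/

section Bloch

variable (A : Type u) [CommRing A]

/-- `Z_{n+1}(A²) = ker ∂_{n+1} ⊆ X_{n+1}(A²)`, as a `PSL₂(A)`-module. -/
abbrev Zsucc (n : ℕ) : Rep.{u} ZZ.{u} (PSL A) := kerRep (bd A n)

/-- `B_n(A²) = im ∂_{n+1} ⊆ X_n(A²)`, as a `PSL₂(A)`-module. -/
abbrev Bd (n : ℕ) : Rep.{u} ZZ.{u} (PSL A) := imRep (bd A n)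

/-- `RP(A) = H_0(PSL₂(A), Z_2(A²))`. -/
abbrev RP : Type u := H 0 (Zsucc A 1)

/-- `λ : RP(A) → H_0(PSL₂(A), X_2(A²))`, induced by the inclusion `Z_2(A²) ⊆ X_2(A²)`; the target
is the group `ℤ[G_A]`. -/
def lam : RP A →ₗ[ZZ.{u}] H 0 (X A 2) := Hmap 0 (kerIncl (bd A 1))

/-- The refined scissors congruence group `RP_1(A) = ker λ`. -/
def RP1 : Submodule ZZ.{u} (RP A) := LinearMap.ker (lam A)

theorem bd_comp_bd_single (x : Tuple A 2) (c : ZZ.{u}) :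
    bdLin A 0 (bdLin A 1 (Finsupp.single x c)) = 0 := by
  have h₁ : (x.face 0).face 0 = (x.face 1).face 0 := by
    refine Tuple.ext fun i ↦ ?_
    fin_cases i; rfl
  have h₂ : (x.face 0).face 1 = (x.face 2).face 0 := by
    refine Tuple.ext fun i ↦ ?_
    fin_cases i; rfl
  have h₃ : (x.face 1).face 1 = (x.face 2).face 1 := by
    refine Tuple.ext fun i ↦ ?_
    fin_cases i; rfl
  simp only [bdLin_one_single, bdLin_zero_single, map_add, map_sub, h₁, h₂, h₃]
  abel

theorem bd_comp_bd : bd A 1 ≫ bd A 0 = 0 := by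
  refine Rep.hom_ext (Representation.IntertwiningMap.ext (Finsupp.lhom_ext fun x c ↦ ?_))
  exact bd_comp_bd_single A x c

/-- The connecting homomorphism `H_1(PSL₂(A), B_1(A²)) → RP(A)` of
`0 → Z_2(A²) → X_2(A²) → B_1(A²) → 0`. It is an isomorphism onto `RP_1(A)`. -/
def delta2 : H 1 (Bd A 1) →ₗ[ZZ.{u}] RP A := Hδ 0 (kerSeq_shortExact (bd A 1))

/-- The map `H_1(PSL₂(A), B_1(A²)) → H_1(PSL₂(A), Z_1(A²)) = RP'_1(A)` induced by the inclusion. -/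
def incB1Z1 : H 1 (Bd A 1) →ₗ[ZZ.{u}] H 1 (Zsucc A 0) :=
  Hmap 1 (imToKer (bd A 1) (bd A 0) (bd_comp_bd A))

/-- The connecting homomorphism `H_2(PSL₂(A), B_0(A²)) → H_1(PSL₂(A), Z_1(A²)) = RP'_1(A)` of
`0 → Z_1(A²) → X_1(A²) → B_0(A²) → 0`. It is onto, with kernel the image of
`H_2(PSL₂(A), X_1(A²)) = H_2(PT(A), ℤ)`. -/
def delta1 : H 2 (Bd A 0) →ₗ[ZZ.{u}] H 1 (Zsucc A 0) := Hδ 1 (kerSeq_shortExact (bd A 0))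

/-- The map `H_2(PSL₂(A), B_0(A²)) → H_2(PSL₂(A), X_0(A²))` induced by the inclusion; the target is
`H_2(PB(A), ℤ)` by Shapiro's lemma. -/
def incB0X0 : H 2 (Bd A 0) →ₗ[ZZ.{u}] H 2 (X A 0) := Hmap 2 (imIncl (bd A 0))

/-- (The graph of) the map `λ'_1 : RP'_1(A) → H_2(PSL₂(A), X_0(A²)) = H_2(PB(A), ℤ)`. Identify
`RP'_1(A) = H_1(PSL₂(A), Z_1(A²))` via the connecting homomorphism `delta1` with a quotient of
`H_2(PSL₂(A), B_0(A²))`; then `λ'_1` is induced by the inclusion `B_0(A²) ⊆ X_0(A²)`, that is,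
`λ'_1 (delta1 y) = incB0X0 y`. -/
def lam1' : Submodule ZZ.{u} (H 1 (Zsucc A 0) × H 2 (X A 0)) :=
  LinearMap.range ((delta1 A).prod (incB0X0 A))

/-- (The graph of) the map `λ_1 : RP_1(A) → H_2(PB(A), ℤ)`, the composite
`RP_1(A) = H_1(PSL₂(A), B_1(A²)) → H_1(PSL₂(A), Z_1(A²)) = RP'_1(A) → H_2(PB(A), ℤ)`, where the first
identification is the connecting homomorphism `delta2` and the last map is `λ'_1`. -/
def lam1 : Submodule ZZ.{u} (RP A × H 2 (X A 0)) :=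
  ((lam1' A).comap ((incB1Z1 A).prodMap LinearMap.id)).map ((delta2 A).prodMap LinearMap.id)

theorem mem_lam1 (x : RP A) (c : H 2 (X A 0)) :
    (x, c) ∈ lam1 A ↔ ∃ (z : H 1 (Bd A 1)) (y : H 2 (Bd A 0)),
      delta2 A z = x ∧ delta1 A y = incB1Z1 A z ∧ incB0X0 A y = c := by
  constructor
  · rintro ⟨⟨z, c'⟩, ⟨y, hy⟩, h⟩
    exact ⟨z, y, congrArg Prod.fst h, congrArg Prod.fst hy,
      (congrArg Prod.snd hy).trans (congrArg Prod.snd h)⟩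
  · rintro ⟨z, y, rfl, h, rfl⟩
    exact ⟨⟨z, incB0X0 A y⟩, ⟨y, Prod.ext h rfl⟩, rfl⟩

/-- The refined Bloch group `RB(A) = ker λ_1`, as a subgroup of `RP(A)`. -/
def RB : Submodule ZZ.{u} (RP A) := (lam1 A).comap (LinearMap.inl _ _ _)

theorem RB_le_RP1 : RB A ≤ RP1 A := by
  intro x hx
  obtain ⟨z, -, rfl, -⟩ := (mem_lam1 A x 0).1 hx
  exact congrArg (fun f ↦ f.hom z) (groupHomology.mapShortComplex₁
    (kerSeq_shortExact (bd A 1)) (i := 1) (j := 0) rfl).zero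

/-! ### The action of `G_A = Aˣ/(Aˣ)²` on `RP(A)` -/

/-- `G_A = Aˣ/(Aˣ)²`. -/
abbrev SqClass : Type u := Aˣ ⧸ (powMonoidHom 2 : Aˣ →* Aˣ).range

variable {A}

/-- Conjugation by `g ∈ GL₂(A)` on `SL₂(A)`. -/
def conjSL (g : GL (Fin 2) A) :
    Matrix.SpecialLinearGroup (Fin 2) A →* Matrix.SpecialLinearGroup (Fin 2) A where
  toFun h := ⟨(g : Matrix (Fin 2) (Fin 2) A) * (h : Matrix (Fin 2) (Fin 2) A) *
    ((g⁻¹ : GL (Fin 2) A) : Matrix (Fin 2) (Fin 2) A), by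
    rw [Matrix.det_mul_right_comm, ← Units.val_mul, mul_inv_cancel]
    simp⟩
  map_one' := Subtype.ext (by simp)
  map_mul' h k := Subtype.ext (by
    change _ = ((g : Matrix (Fin 2) (Fin 2) A) * (h : Matrix (Fin 2) (Fin 2) A) * _) *
      ((g : Matrix (Fin 2) (Fin 2) A) * (k : Matrix (Fin 2) (Fin 2) A) * _)
    simp [mul_assoc])

theorem toGL_conjSL (g : GL (Fin 2) A) (h : Matrix.SpecialLinearGroup (Fin 2) A) :
    Matrix.SpecialLinearGroup.toGL (conjSL g h) =
      g * Matrix.SpecialLinearGroup.toGL h * g⁻¹ := by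
  refine Units.ext ?_
  rw [Units.val_mul, Units.val_mul]
  rfl

/-- Conjugation by `g ∈ GL₂(A)` on `PSL₂(A)`. -/
def conjPSL (g : GL (Fin 2) A) : PSL A →* PSL A :=
  QuotientGroup.map _ _ (conjSL g) fun h hh ↦ by
    obtain ⟨r, hr, hr'⟩ := Matrix.SpecialLinearGroup.mem_center_iff.1 hh
    refine Matrix.SpecialLinearGroup.mem_center_iff.2 ⟨r, hr, ?_⟩
    change _ = (g : Matrix (Fin 2) (Fin 2) A) * (h : Matrix (Fin 2) (Fin 2) A) *
    ((g⁻¹ : GL (Fin 2) A) : Matrix (Fin 2) (Fin 2) A)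
    rw [← hr', ← (Matrix.scalar_commute r (Commute.all r) _).eq, mul_assoc, ← Units.val_mul,
      mul_inv_cancel, Units.val_one, mul_one]

theorem conjPSL_smul {n : ℕ} (g : GL (Fin 2) A) (p : PSL A) (x : Tuple A n) :
    conjPSL g p • g • x = g • p • x := by
  induction p using QuotientGroup.induction_on with
  | H h =>
    change Matrix.SpecialLinearGroup.toGL (conjSL g h) • g • x =
      g • Matrix.SpecialLinearGroup.toGL h • x
    rw [toGL_conjSL, smul_smul, smul_smul, inv_mul_cancel_right]

variable (A) in
/-- The action of `GL₂(A)` on `X_n(A²)`. -/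
def XRhoGL (n : ℕ) : Representation ZZ.{u} (GL (Fin 2) A) (XMod A n) where
  toFun g := Finsupp.lmapDomain _ _ (g • ·)
  map_one' := by ext; simp
  map_mul' g h := by ext; simp [mul_smul]

theorem bdLin_XRhoGL (n : ℕ) (g : GL (Fin 2) A) (x : XMod A (n + 1)) :
    bdLin A n (XRhoGL A (n + 1) g x) = XRhoGL A n g (bdLin A n x) := by
  refine LinearMap.congr_fun (f := bdLin A n ∘ₗ XRhoGL A (n + 1) g)
    (g := XRhoGL A n g ∘ₗ bdLin A n) (Finsupp.lhom_ext fun x c ↦ ?_) x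
  simp only [XRhoGL, MonoidHom.coe_mk, OneHom.coe_mk, LinearMap.comp_apply,
      Finsupp.lmapDomain_apply, Finsupp.mapDomain_single, bdLin_single, Tuple.face_smul_GL,
      map_sum, map_zsmul]

variable (A) in
/-- The action of `GL₂(A)` on `Z_{n+1}(A²)`. -/
def ZRhoGL (n : ℕ) : Representation ZZ.{u} (GL (Fin 2) A) (Zsucc A n) :=
  (XRhoGL A (n + 1)).subrepresentation (LinearMap.ker (bdLin A n)) fun g x hx ↦ by
    have hx' : bdLin A n x = 0 := hx
    change bdLin A n (XRhoGL A (n + 1) g x) = 0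
    rw [bdLin_XRhoGL, hx', map_zero]

theorem ZRhoGL_conj (n : ℕ) (g : GL (Fin 2) A) (p : PSL A) (x : Zsucc A n) :
    ZRhoGL A n g ((Zsucc A n).ρ p x) = (Zsucc A n).ρ (conjPSL g p) (ZRhoGL A n g x) := by
  refine Subtype.ext ?_
  refine LinearMap.congr_fun (f := XRhoGL A (n + 1) g ∘ₗ XRho A (n + 1) p)
    (g := XRho A (n + 1) (conjPSL g p) ∘ₗ XRhoGL A (n + 1) g)
    (Finsupp.lhom_ext fun x c ↦ ?_) x.1
  simp only [XRhoGL, XRho, MonoidHom.coe_mk, OneHom.coe_mk, LinearMap.comp_apply,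
      Finsupp.lmapDomain_apply, Finsupp.mapDomain_single, conjPSL_smul]

/-- The action of `g ∈ GL₂(A)` on `RP(A) = H_0(PSL₂(A), Z_2(A²))`, induced by conjugation on
`PSL₂(A)` and the action on `Z_2(A²)`. -/
def glRP (g : GL (Fin 2) A) : RP A →ₗ[ZZ.{u}] RP A :=
  (groupHomology.map (conjPSL g) (Rep.ofHom ⟨ZRhoGL A 1 g, fun p ↦ LinearMap.ext fun x ↦
    ZRhoGL_conj 1 g p x⟩ : Zsucc A 1 ⟶ Rep.res (conjPSL g) (Zsucc A 1)) 0).hom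

variable (A) in
/-- The class in `RP(A)` of an element of `Z_2(A²)`. -/
def RPmk : Zsucc A 1 →ₗ[ZZ.{u}] RP A := (groupHomology.H0π (Zsucc A 1)).hom

theorem RPmk_surjective : Function.Surjective (RPmk A) :=
  (ModuleCat.epi_iff_surjective (groupHomology.H0π (Zsucc A 1))).1 inferInstance

theorem RPmk_smul (p : PSL A) (x : Zsucc A 1) : RPmk A ((Zsucc A 1).ρ p x) = RPmk A x := by
  have h : ∀ y, (groupHomology.H0Iso (Zsucc A 1)).inv.hom
      (Representation.Coinvariants.mk (Zsucc A 1).ρ y) = RPmk A y := fun y ↦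
    congrArg (fun f ↦ f.hom y) (groupHomology.coinvariantsMk_comp_H0Iso_inv (Zsucc A 1))
  rw [← h, ← h, Representation.Coinvariants.mk_self_apply]

theorem glRP_mk (g : GL (Fin 2) A) (x : Zsucc A 1) :
    glRP g (RPmk A x) = RPmk A (ZRhoGL A 1 g x) :=
  congrArg (fun f ↦ f.hom x) (groupHomology.H0π_comp_map (conjPSL g)
    (Rep.ofHom ⟨ZRhoGL A 1 g, fun p ↦ LinearMap.ext fun x ↦
      ZRhoGL_conj 1 g p x⟩ : Zsucc A 1 ⟶ Rep.res (conjPSL g) (Zsucc A 1)))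

/-- The matrix `diag(1, a)`, of determinant `a`. -/
def dmat : Aˣ →* GL (Fin 2) A where
  toFun a := ⟨!![1, 0; 0, (a : A)], !![1, 0; 0, ((a⁻¹ : Aˣ) : A)],
    by simp [Matrix.one_fin_two], by simp [Matrix.one_fin_two]⟩
  map_one' := Units.ext (by simp [Matrix.one_fin_two])
  map_mul' a b := Units.ext (by simp)

variable (A) in
/-- The action of the units of `A` on `RP(A)`: `a` acts through `diag(1, a) ∈ GL₂(A)`. -/
def unitsRP : Representation ZZ.{u} Aˣ (RP A) where
  toFun a := glRP (dmat a)
  map_one' := by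
    refine LinearMap.ext fun x ↦ ?_
    obtain ⟨x, rfl⟩ := RPmk_surjective x
    rw [map_one, glRP_mk, map_one]
    rfl
  map_mul' a b := by
    refine LinearMap.ext fun x ↦ ?_
    obtain ⟨x, rfl⟩ := RPmk_surjective x
    rw [map_mul, glRP_mk, map_mul, Module.End.mul_apply, Module.End.mul_apply, glRP_mk, glRP_mk]

/-- The matrix `diag(b⁻¹, b)`. -/
def dSL (b : Aˣ) : Matrix.SpecialLinearGroup (Fin 2) A :=
  ⟨!![((b⁻¹ : Aˣ) : A), 0; 0, (b : A)], by simp [Matrix.det_fin_two]⟩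

theorem dmat_sq_smul {n : ℕ} (b : Aˣ) (x : Tuple A n) :
    dmat (b ^ 2) • x = (QuotientGroup.mk (dSL b) : PSL A) • x := by
  rw [mk_smul]
  set g := Matrix.SpecialLinearGroup.toGL (dSL b) with hg
  have : (dmat (b ^ 2) * g⁻¹) • g • x = g • x := by
    refine smul_eq_of_scalar _ (b : A) ?_ _
    have h : ((dmat (b ^ 2) : GL (Fin 2) A) : Matrix (Fin 2) (Fin 2) A) =
        Matrix.scalar (Fin 2) (b : A) * (g : Matrix (Fin 2) (Fin 2) A) := by
      change !![1, 0; 0, ((b ^ 2 : Aˣ) : A)] =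
        Matrix.scalar (Fin 2) (b : A) * !![((b⁻¹ : Aˣ) : A), 0; 0, (b : A)]
      ext i j
      fin_cases i <;> fin_cases j <;> simp [sq]
    rw [Units.val_mul, h, mul_assoc, ← Units.val_mul, mul_inv_cancel, Units.val_one, mul_one]
  rwa [smul_smul, inv_mul_cancel_right] at this

theorem unitsRP_sq (b : Aˣ) : unitsRP A (b ^ 2) = 1 := by
  refine LinearMap.ext fun x ↦ ?_
  obtain ⟨x, rfl⟩ := RPmk_surjective x
  change glRP (dmat (b ^ 2)) _ = RPmk A x
  rw [glRP_mk, ← RPmk_smul (QuotientGroup.mk (dSL b) : PSL A) x]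
  congr 1
  refine Subtype.ext ?_
  change Finsupp.mapDomain _ x.1 = Finsupp.mapDomain _ x.1
  congr 1
  funext t
  exact dmat_sq_smul b t

variable (A) in
/-- The action of `G_A` on `RP(A)`: `⟨a⟩` acts through `diag(1, a) ∈ GL₂(A)`. -/
def sqRP : Representation ZZ.{u} (SqClass A) (RP A) :=
  QuotientGroup.lift _ (unitsRP A) (by
    rintro _ ⟨b, rfl⟩
    exact unitsRP_sq b)

/-! ### The elements `ψ_1(a)` -/

/-- A triple of lines with given spanning vectors. -/
def triple (u v w : Vec A) (h₁ : IsUnit (u 0 * v 1 - u 1 * v 0))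
    (h₂ : IsUnit (u 0 * w 1 - u 1 * w 0)) (h₃ : IsUnit (v 0 * w 1 - v 1 * w 0)) : Tuple A 2 where
  line := ![Submodule.span A {u}, Submodule.span A {v}, Submodule.span A {w}]
  exists_vec := by
    have key : ∀ {x y : Vec A}, IsUnit (x 0 * y 1 - x 1 * y 0) →
        IsUnimodular x ∧ IsUnimodular y ∧ IsBasisPair x y ∧ IsBasisPair y x := by
      intro x y h
      obtain ⟨c, hc⟩ := h.exists_left_inv
      refine ⟨(isUnimodular_iff _).2 ⟨c * y 1, -(c * y 0), by linear_combination hc⟩,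
        (isUnimodular_iff _).2 ⟨-(c * x 1), c * x 0, by linear_combination hc⟩,
        (isBasisPair_iff _ _).2 h, (isBasisPair_iff _ _).2 ?_⟩
      convert h.neg using 1
      ring
    obtain ⟨a₁, a₂, a₃, a₄⟩ := key h₁
    obtain ⟨b₁, b₂, b₃, b₄⟩ := key h₂
    obtain ⟨c₁, c₂, c₃, c₄⟩ := key h₃
    refine ⟨![u, v, w], fun i ↦ ?_, fun i ↦ ?_, fun i j hij ↦ ?_⟩
    · fin_cases i <;> rfl
    · fin_cases i <;> assumption
    · fin_cases i <;> fin_cases j <;> first | exact absurd rfl hij | assumption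

theorem triple_face {u v w u' v' w' : Vec A} {h₁ h₂ h₃ h₁' h₂' h₃'} (i j : Fin 3)
    (h : ∀ k : Fin 2, ![Submodule.span A {u}, Submodule.span A {v}, Submodule.span A {w}]
      (i.succAbove k) = ![Submodule.span A {u'}, Submodule.span A {v'}, Submodule.span A {w'}]
      (j.succAbove k)) :
    (triple u v w h₁ h₂ h₃).face i = (triple u' v' w' h₁' h₂' h₃').face j :=
  Tuple.ext h

/-- `(∞, 0, a)`, where `∞ = ⟨e₁⟩`, `0 = ⟨e₂⟩`, `a = ⟨e₁ + a e₂⟩`. -/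
def inftyZero (a : Aˣ) : Tuple A 2 :=
  triple ![1, 0] ![0, 1] ![1, (a : A)] (by simp) (by simp) (by simp)

/-- `(0, ∞, a)`, where `∞ = ⟨e₁⟩`, `0 = ⟨e₂⟩`, `a = ⟨e₁ + a e₂⟩`. -/
def zeroInfty (a : Aˣ) : Tuple A 2 :=
  triple ![0, 1] ![1, 0] ![1, (a : A)] (by simp) (by simp) (by simp)

/-- `(∞, 0, a) + (0, ∞, a) ∈ X_2(A²)`. -/
def psiChain (a : Aˣ) : XMod A 2 :=
  Finsupp.single (inftyZero a) 1 + Finsupp.single (zeroInfty a) 1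

theorem bdLin_psiChain (a : Aˣ) : bdLin A 1 (psiChain a) = bdLin A 1 (psiChain 1) := by
  have h₁ : ∀ a : Aˣ, (inftyZero a).face 0 = (zeroInfty a).face 1 := fun a ↦
    triple_face 0 1 fun k ↦ by fin_cases k <;> simp [Fin.succAbove]
  have h₂ : ∀ a : Aˣ, (inftyZero a).face 1 = (zeroInfty a).face 0 := fun a ↦
    triple_face 1 0 fun k ↦ by fin_cases k <;> simp [Fin.succAbove]
  have h₃ : (inftyZero a).face 2 = (inftyZero 1).face 2 :=
    triple_face 2 2 fun k ↦ by fin_cases k <;> simp [Fin.succAbove]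
  have h₄ : (zeroInfty a).face 2 = (zeroInfty 1).face 2 :=
    triple_face 2 2 fun k ↦ by fin_cases k <;> simp [Fin.succAbove]
  simp only [psiChain, map_add, bdLin_one_single, h₁, h₂, h₃, h₄]
  abel

/-- `ψ_1(a) = (∞, 0, a) + (0, ∞, a) - (∞, 0, 1) - (0, ∞, 1) ∈ RP(A)`. -/
def psi1 (a : Aˣ) : RP A :=
  RPmk A ⟨psiChain a - psiChain 1, by
    change bdLin A 1 _ = 0
    rw [map_sub, bdLin_psiChain a, sub_self]⟩

variable (A) in
/-- The `ℤ[G_A]`-submodule `ℤ[G_A] ψ_1(-1)` of `RP(A)`. -/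
def psiSubmodule : Submodule ZZ.{u} (RP A) :=
  Submodule.span ZZ.{u} (Set.range fun g : SqClass A ↦ sqRP A g (psi1 (-1)))

/-! ### The map `H_3(PSL₂(A), ℤ) → RB(A)` -/

/-- The composite of connecting homomorphisms
`H_3(PSL₂(A), ℤ) → H_2(PSL₂(A), B_0(A²)) → H_1(PSL₂(A), B_1(A²)) → H_0(PSL₂(A), Z_2(A²)) = RP(A)`
obtained by splitting the exact sequence
`0 → Z_2(A²) → X_2(A²) → X_1(A²) → X_0(A²) → ℤ → 0` into short exact sequences. -/
def edgeRP (h : ExactBelowTwo A) : H 3 (triv (PSL A)) →ₗ[ZZ.{u}] RP A :=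
  delta2 A ∘ₗ Hδ 1 (imSeq_shortExact (bd A 1) (bd A 0) h.exact_one) ∘ₗ
    Hδ 2 (cokerSeq_shortExact (bd A 0) (aug A) h.exact_zero h.surjective_aug)

theorem delta1_eq (h : ExactBelowTwo A) (y : H 2 (Bd A 0)) :
    incB1Z1 A (Hδ 1 (imSeq_shortExact (bd A 1) (bd A 0) h.exact_one) y) = delta1 A y := by
  let φ : imSeq (bd A 1) (bd A 0) h.exact_one ⟶ kerSeq (bd A 0) :=
    { τ₁ := imToKer (bd A 1) (bd A 0) (bd_comp_bd A)
      τ₂ := 𝟙 _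
      τ₃ := 𝟙 _
      comm₁₂ := rfl
      comm₂₃ := rfl }
  have key := HomologicalComplex.HomologySequence.δ_naturality
    ((groupHomology.chainsFunctor ZZ.{u} (PSL A)).mapShortComplex.map φ)
    (groupHomology.map_chainsFunctor_shortExact (imSeq_shortExact (bd A 1) (bd A 0) h.exact_one))
    (groupHomology.map_chainsFunctor_shortExact (kerSeq_shortExact (bd A 0))) 2 1 rfl
  have h₃ : HomologicalComplex.homologyMap
      ((groupHomology.chainsFunctor ZZ.{u} (PSL A)).mapShortComplex.map φ).τ₃ 2 = 𝟙 _ :=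
    groupHomology.map_id 2
  exact (congrArg (fun f ↦ f.hom y) key).trans
    (congrArg (delta1 A) (congrArg (fun f ↦ f.hom y) h₃))

theorem edgeRP_mem (h : ExactBelowTwo A) (x : H 3 (triv (PSL A))) : edgeRP h x ∈ RB A := by
  refine (mem_lam1 A _ _).2 ⟨_, _, rfl, (delta1_eq h _).symm, ?_⟩
  exact congrArg (fun f ↦ f.hom x) (groupHomology.mapShortComplex₁
    (cokerSeq_shortExact (bd A 0) (aug A) h.exact_zero h.surjective_aug) (i := 3) (j := 2) rfl).zero

/-- The map `H_3(PSL₂(A), ℤ) → RB(A)`. -/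
def edgeRB (h : ExactBelowTwo A) : H 3 (triv (PSL A)) →ₗ[ZZ.{u}] RB A :=
  (edgeRP h).codRestrict (RB A) (edgeRP_mem h)

/-- The map `H_3(PSL₂(A), ℤ) → RB(A)/ℤ[G_A] ψ_1(-1)`. -/
def edgeQuot (h : ExactBelowTwo A) :
    H 3 (triv (PSL A)) →ₗ[ZZ.{u}] RB A ⧸ (psiSubmodule A).submoduleOf (RB A) :=
  ((psiSubmodule A).submoduleOf (RB A)).mkQ ∘ₗ edgeRB h

end Bloch

end RefinedBloch

end

/-! The edge map `edgeRP` has image exactly `RB A`. If `x` lies in `RB A`, its witness in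
`H_2(PSL₂(A), B_0)` dies in `H_2(PSL₂(A), X_0)`, so it comes from `H_3(PSL₂(A), ℤ)`. Exactness at
`X_1` makes `B_1 → Z_1` an isomorphism, and therefore the edge map sends that lift to `x`
(`exists_edgeRP_eq`). This gives surjectivity. Exactness in the middle needs two facts: the edge map
carries the image of `H_3(PSM₂(A), ℤ)` onto `ℤ[G_A] ψ_1(-1)`, and its kernel is contained in that
image.

Both rest on the `PSM₂(A)`-subcomplex `ℤ[{(∞,0), (0,∞)}] → ℤ[{∞, 0}] → ℤ`. For `A ≠ 0` the kernel of
its differential is generated by `(∞,0) + (0,∞)`, the boundary of the chain `psiChain 1` in `X_2`.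
This lift is not equivariant: a monomial matrix with parameter `a` sends `psiChain 1` to `psiChain
(±a²)`. By naturality of connecting maps the edge image of `H_3(PSM₂(A), ℤ)` is generated by classes
`ψ_1(±a²)`, which lie in `ℤ[G_A] ψ_1(-1)` (`edgeRP_HmapZ_mem`). Conversely `⟨a⟩ ψ_1(-1) = ψ_1(-a²)`
(`sqRP_psi1_neg_one`), and `ψ_1(-a²)` is the edge image of the degree 3 class carried by the
involution `mSL a` (`psi1_neg_sq_mem_range`).

For the kernel (`exists_of_edgeRP_eq_zero`): `PSL₂(A)` acts freely on triples, so `H_1(PSL₂(A), X_2)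
= 0` and `delta2` is injective. A class killed by the edge map therefore has its image in
`H_2(PSL₂(A), B_0)` coming from `H_2(PSL₂(A), X_1) = H_2(PT(A), ℤ)`. That class can be moved to the
small complex. Injectivity of `H_2(PT) → H_2(PB)` lifts it to `H_3(PSM₂(A), ℤ)`, and surjectivity of
`H_3(PT) → H_3(PB)` absorbs the remaining difference. The identifications are Shapiro's lemma,
proved by an explicit prism homotopy on bar chains (`map_bijective_of_transitive`). -/

noncomputable section
namespace RefinedBloch

/-! ### Shapiro's lemma for transitive permutation modules -/

/-! ### Bar tuples and the recursion for the bar differential -/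

section Bar

variable (k G : Type u) [CommRing k] [Group G]

/-- The free module on the `n`-tuples of elements of `G`. -/
abbrev Bar (n : ℕ) : Type u := (Fin n → G) →₀ k

variable {G}

/-- Prepend `g` to a tuple. -/
def prepend (g : G) (n : ℕ) : Bar k G n →ₗ[k] Bar k G (n + 1) :=
  Finsupp.lmapDomain k k fun x ↦ Fin.cons g x

/-- Multiply the first entry of a tuple by `g`. -/
def mulFirst (g : G) (n : ℕ) : Bar k G (n + 1) →ₗ[k] Bar k G (n + 1) :=
  Finsupp.lmapDomain k k fun x ↦ Fin.cons (g * x 0) (Fin.tail x)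

variable (G) in
/-- The bar differential without its first term. -/
def barRest (n : ℕ) : Bar k G (n + 1) →ₗ[k] Bar k G n :=
  ∑ j : Fin (n + 1), (-1 : k) ^ ((j : ℕ) + 1) •
    Finsupp.lmapDomain k k (Fin.contractNth j (· * ·))

variable {k}

omit [Group G] in
theorem prepend_single (g : G) (n : ℕ) (x : Fin n → G) (c : k) :
    prepend k g n (Finsupp.single x c) = Finsupp.single (Fin.cons g x) c := by
  simp [prepend]

theorem mulFirst_prepend (g h : G) (n : ℕ) (z : Bar k G n) :
    mulFirst k g n (prepend k h n z) = prepend k (g * h) n z := by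
  induction z using Finsupp.induction_linear with
  | zero => simp
  | add f g hf hg => simp only [map_add, hf, hg]
  | single x c => simp [mulFirst, prepend, Fin.tail_cons]

-- This splits off the first entry of a tuple, so that identities between operators follow by
-- induction on length.
omit [Group G] in
theorem bar_ext {N : Type*} [AddCommMonoid N] [Module k N] {n : ℕ} {f g : Bar k G (n + 1) →ₗ[k] N}
    (h : ∀ a (z : Bar k G n), f (prepend k a n z) = g (prepend k a n z)) : f = g := by
  refine Finsupp.lhom_ext fun x c ↦ ?_
  rw [← Fin.cons_self_tail x, ← prepend_single, h]

theorem contractNth_zero_cons {n : ℕ} (g : G) (x : Fin (n + 1) → G) :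
    Fin.contractNth 0 (· * ·) (Fin.cons g x : Fin (n + 1 + 1) → G) =
      Fin.cons (g * x 0) (Fin.tail x) := by
  funext i
  refine Fin.cases ?_ (fun i ↦ ?_) i
  · rw [Fin.contractNth_apply_of_eq _ _ _ _ rfl]; simp
  · rw [Fin.contractNth_apply_of_gt _ _ _ _ (by simp)]; rfl

theorem contractNth_succ_cons {n : ℕ} (g : G) (x : Fin (n + 1) → G) (j : Fin (n + 1)) :
    Fin.contractNth j.succ (· * ·) (Fin.cons g x : Fin (n + 1 + 1) → G) =
      Fin.cons g (Fin.contractNth j (· * ·) x) := by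
  funext i
  refine Fin.cases ?_ (fun i ↦ ?_) i
  · rw [Fin.contractNth_apply_of_lt _ _ _ _ (by simp)]; rfl
  · simp only [Fin.cons_succ]
    rcases lt_trichotomy (i : ℕ) j with h | h | h
    · rw [Fin.contractNth_apply_of_lt _ _ _ _ (by simpa using h),
        Fin.contractNth_apply_of_lt _ _ _ _ h]; rfl
    · rw [Fin.contractNth_apply_of_eq _ _ _ _ (by simpa using h),
        Fin.contractNth_apply_of_eq _ _ _ _ h]; rfl
    · rw [Fin.contractNth_apply_of_gt _ _ _ _ (by simpa using h),
        Fin.contractNth_apply_of_gt _ _ _ _ h]; rfl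

theorem barRest_single (n : ℕ) (x : Fin (n + 1) → G) (c : k) :
    barRest k G n (Finsupp.single x c) = ∑ j : Fin (n + 1), (-1 : k) ^ ((j : ℕ) + 1) •
      Finsupp.single (Fin.contractNth j (· * ·) x) c := by
  simp only [barRest, LinearMap.sum_apply, LinearMap.smul_apply, Finsupp.lmapDomain_apply,
    Finsupp.mapDomain_single]

/-- The contraction at `0` multiplies `g` into the next entry. All later contractions leave `g`
alone and shift their index, hence their sign, by one. -/
theorem barRest_prepend (g : G) (n : ℕ) (z : Bar k G (n + 1)) :
    barRest k G (n + 1) (prepend k g (n + 1) z) =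
      -mulFirst k g n z - prepend k g n (barRest k G n z) := by
  induction z using Finsupp.induction_linear with
  | zero => simp
  | add f g hf hg => simp only [map_add, hf, hg]; abel
  | single x c =>
    rw [prepend_single, barRest_single, Fin.sum_univ_succ, barRest_single]
    simp only [contractNth_zero_cons, contractNth_succ_cons, mulFirst, map_sum, map_smul,
      Finsupp.lmapDomain_apply, Finsupp.mapDomain_single, prepend_single]
    simp only [Fin.val_zero, zero_add, pow_one, neg_smul, one_smul, Fin.val_succ, sub_eq_add_neg,
      pow_succ _ (_ + 1), mul_neg, mul_one, Finset.sum_neg_distrib]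

theorem barRest_prepend_zero (g : G) (z : Bar k G 0) :
    barRest k G 0 (prepend k g 0 z) = -z := by
  induction z using Finsupp.induction_linear with
  | zero => simp
  | add f g hf hg => simp only [map_add, hf, hg]; abel
  | single x c =>
    simp [barRest, prepend_single, Subsingleton.elim (Fin.contractNth _ _ _) x]

end Bar

/-! ### Retraction of the action groupoid onto a stabilizer, and the prism operator -/

section Prism

variable {k G S : Type u} [CommRing k] [Group G] [MulAction G S] (c : S → G)

/-- The `i`-th component of the retraction: transport an arrow along the chosen paths `c`. -/
def transport (s : S) (g : G) : G := (c s)⁻¹ * g * c (g⁻¹ • s)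

variable (k) in
/-- The retraction of tuples based at `s` onto tuples in a point stabilizer. -/
def retract : (n : ℕ) → S → Bar k G n →ₗ[k] Bar k G n
  | 0, _ => LinearMap.id
  | n + 1, s => Finsupp.lsum k fun x ↦
      prepend k (transport c s (x 0)) n ∘ₗ retract n ((x 0)⁻¹ • s) ∘ₗ Finsupp.lsingle (Fin.tail x)

variable (k) in
/-- The prism operator between the identity and the retraction. -/
def prism : (n : ℕ) → S → Bar k G n →ₗ[k] Bar k G (n + 1)
  | 0, s => prepend k (c s) 0
  | n + 1, s => prepend k (c s) (n + 1) ∘ₗ retract k c (n + 1) s - Finsupp.lsum k fun x ↦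
      prepend k (x 0) (n + 1) ∘ₗ prism n ((x 0)⁻¹ • s) ∘ₗ Finsupp.lsingle (Fin.tail x)

theorem retract_prepend (n : ℕ) (s : S) (g : G) (z : Bar k G n) :
    retract k c (n + 1) s (prepend k g n z) =
      prepend k (transport c s g) n (retract k c n (g⁻¹ • s) z) := by
  induction z using Finsupp.induction_linear with
  | zero => simp
  | add f g hf hg => simp only [map_add, hf, hg]
  | single x a => simp [prepend_single, retract]

theorem prism_prepend (n : ℕ) (s : S) (g : G) (z : Bar k G n) :
    prism k c (n + 1) s (prepend k g n z) =
      prepend k (c s) (n + 1) (retract k c (n + 1) s (prepend k g n z)) -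
        prepend k g (n + 1) (prism k c n (g⁻¹ • s) z) := by
  induction z using Finsupp.induction_linear with
  | zero => simp
  | add f g hf hg => simp only [map_add, hf, hg]; abel
  | single x a => simp [prepend_single, prism]

/-- The inner factors of `c` at `g⁻¹ • s` cancel. In the action groupoid, where a tuple based at `s`
is a path starting at `s`, this is functoriality of the retraction. -/
theorem transport_mul (s : S) (g h : G) :
    transport c s (g * h) = transport c s g * transport c (g⁻¹ • s) h := by
  simp [transport, mul_assoc, mul_smul]

theorem retract_mulFirst (n : ℕ) (s : S) (g : G) (z : Bar k G (n + 1)) :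
    retract k c (n + 1) s (mulFirst k g n z) =
      mulFirst k (transport c s g) n (retract k c (n + 1) (g⁻¹ • s) z) := by
  refine LinearMap.congr_fun (f := retract k c (n + 1) s ∘ₗ mulFirst k g n)
    (g := mulFirst k (transport c s g) n ∘ₗ retract k c (n + 1) (g⁻¹ • s))
    (bar_ext fun a z ↦ ?_) z
  simp [mulFirst_prepend, retract_prepend, transport_mul, mul_smul]

theorem barRest_retract (n : ℕ) (s : S) (z : Bar k G (n + 1)) :
    barRest k G n (retract k c (n + 1) s z) = retract k c n s (barRest k G n z) := by
  induction n generalizing s with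
  | zero =>
    refine LinearMap.congr_fun (f := barRest k G 0 ∘ₗ retract k c 1 s)
      (g := retract k c 0 s ∘ₗ barRest k G 0) (bar_ext fun a z ↦ ?_) z
    simp only [LinearMap.comp_apply, retract_prepend, barRest_prepend_zero, map_neg]
    rfl
  | succ n ih =>
    refine LinearMap.congr_fun (f := barRest k G (n + 1) ∘ₗ retract k c (n + 2) s)
      (g := retract k c (n + 1) s ∘ₗ barRest k G (n + 1)) (bar_ext fun a z ↦ ?_) z
    simp [retract_prepend, barRest_prepend, ih, retract_mulFirst]

theorem prism_mulFirst (n : ℕ) (s : S) (g : G) (z : Bar k G (n + 1)) :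
    prism k c (n + 1) s (mulFirst k g n z) =
      prepend k (c s) (n + 1) (retract k c (n + 1) s (mulFirst k g n z)) -
        mulFirst k g (n + 1) (prepend k (c (g⁻¹ • s)) (n + 1) (retract k c (n + 1) (g⁻¹ • s) z)) +
        mulFirst k g (n + 1) (prism k c (n + 1) (g⁻¹ • s) z) := by
  refine LinearMap.congr_fun (f := prism k c (n + 1) s ∘ₗ mulFirst k g n)
    (g := prepend k (c s) (n + 1) ∘ₗ retract k c (n + 1) s ∘ₗ mulFirst k g n -
        mulFirst k g (n + 1) ∘ₗ prepend k (c (g⁻¹ • s)) (n + 1) ∘ₗ retract k c (n + 1) (g⁻¹ • s) +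
        mulFirst k g (n + 1) ∘ₗ prism k c (n + 1) (g⁻¹ • s))
    (bar_ext fun a z ↦ ?_) z
  simp [mulFirst_prepend, prism_prepend, mul_smul]

theorem barRest_prism_zero (s : S) (z : Bar k G 0) :
    barRest k G 0 (prism k c 0 s z) = -z := barRest_prepend_zero _ _

/-- The inner faces of neighbouring prism terms cancel in pairs, because `c` is a natural
transformation, and only the face without `c` survives. The opposite end, the retracted tuple, does
not appear here: it arises from the omitted first face, which moves the base point. -/
theorem barRest_prism (n : ℕ) (s : S) (z : Bar k G (n + 1)) :
    barRest k G (n + 1) (prism k c (n + 1) s z) + prism k c n s (barRest k G n z) = -z := by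
  induction n generalizing s with
  | zero =>
    refine LinearMap.congr_fun (f := barRest k G 1 ∘ₗ prism k c 1 s +
      prism k c 0 s ∘ₗ barRest k G 0) (g := -LinearMap.id) (bar_ext fun a z ↦ ?_) z
    have h := barRest_prism_zero (k := k) c (a⁻¹ • s) z
    simp only [LinearMap.add_apply, LinearMap.comp_apply, prism_prepend, map_sub, barRest_prepend,
      barRest_retract, barRest_prepend_zero, h, map_neg, LinearMap.neg_apply, LinearMap.id_apply]
    simp only [retract_prepend, prism, mulFirst_prepend]
    simp only [retract, LinearMap.id_apply]
    -- The naturality square of `c`, which matches the two faces along the diagonal of the prism.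
    have : c s * transport c s a = a * c (a⁻¹ • s) := by simp [transport, mul_assoc]
    rw [this]
    abel
  | succ n ih =>
    refine LinearMap.congr_fun (f := barRest k G (n + 2) ∘ₗ prism k c (n + 2) s +
      prism k c (n + 1) s ∘ₗ barRest k G (n + 1)) (g := -LinearMap.id) (bar_ext fun a z ↦ ?_) z
    have h := ih (a⁻¹ • s) z
    rw [← eq_sub_iff_add_eq] at h
    simp only [LinearMap.add_apply, LinearMap.comp_apply, prism_prepend, map_sub, barRest_prepend,
      barRest_retract, h, map_neg, LinearMap.neg_apply, LinearMap.id_apply, prism_mulFirst]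
    have : c s * transport c s a = a * c (a⁻¹ • s) := by simp [transport, mul_assoc]
    simp only [retract_prepend, mulFirst_prepend, this]
    abel

end Prism


/-! ### Chains with coefficients in a permutation module -/

section Permutation

variable (k G S : Type u) [CommRing k] [Group G] [MulAction G S]

/-- The permutation representation on the free module on a `G`-set. -/
def permRho : Representation k G (S →₀ k) where
  toFun g := Finsupp.lmapDomain _ _ (g • ·)
  map_one' := by ext; simp
  map_mul' g h := by ext; simp [mul_smul]

variable {k G S}

theorem permRho_single (g : G) (s : S) (c : k) :
    permRho k G S g (Finsupp.single s c) = Finsupp.single (g • s) c := by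
  simp [permRho]

/-- The inclusion of the tuples based at `s`. -/
def base (s : S) (n : ℕ) : Bar k G n →ₗ[k] ((Fin n → G) →₀ (S →₀ k)) :=
  Finsupp.mapRange.linearMap (Finsupp.lsingle s)

omit [Group G] [MulAction G S] in
theorem base_single (s : S) (n : ℕ) (x : Fin n → G) (a : k) :
    base s n (Finsupp.single x a) = Finsupp.single x (Finsupp.single s a) := by
  simp [base]

/-- Only the first face acts on the coefficient. It moves the base point to `g⁻¹ • s`, and all other
faces are those of `barRest` at the same base point. -/
theorem d_base_prepend (s : S) (n : ℕ) (g : G) (z : Bar k G n) :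
    (groupHomology.inhomogeneousChains.d (Rep.of (permRho k G S)) n).hom
        (base s (n + 1) (prepend k g n z)) =
      base (g⁻¹ • s) n z + base s n (barRest k G n (prepend k g n z)) := by
  induction z using Finsupp.induction_linear with
  | zero => simp
  | add f g hf hg => simp only [map_add, hf, hg]; abel
  | single x c =>
    rw [prepend_single, base_single, base_single, barRest_single, map_sum]
    refine (groupHomology.inhomogeneousChains.d_single (A := Rep.of (permRho k G S)) n
      (Fin.cons g x) (Finsupp.single s c)).trans ?_
    simp only [map_smul, base_single]
    congr 1
    exact congrArg (Finsupp.single x) (permRho_single g⁻¹ s c)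

omit [Group G] [MulAction G S] in
theorem permChains_ext {N : Type*} [AddCommMonoid N] [Module k N] {n : ℕ}
    {f g : ((Fin n → G) →₀ (S →₀ k)) →ₗ[k] N}
    (h : ∀ s z, f (base s n z) = g (base s n z)) : f = g :=
  Finsupp.lhom_ext' fun x ↦ Finsupp.lhom_ext fun s c ↦ by
    simpa [base_single] using h s (Finsupp.single x c)

/-- A family of maps on the tuples based at the points of `S`, as a map on all chains. -/
def permDesc {N : Type u} [AddCommMonoid N] [Module k N] (n : ℕ)
    (F : S → Bar k G n →ₗ[k] N) : ((Fin n → G) →₀ (S →₀ k)) →ₗ[k] N :=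
  Finsupp.lsum k fun x ↦ Finsupp.lsum k fun s ↦ F s ∘ₗ Finsupp.lsingle x

omit [Group G] [MulAction G S] in
theorem permDesc_base {N : Type u} [AddCommMonoid N] [Module k N] (n : ℕ)
    (F : S → Bar k G n →ₗ[k] N) (s : S) (z : Bar k G n) :
    permDesc n F (base s n z) = F s z := by
  induction z using Finsupp.induction_linear with
  | zero => simp
  | add f g hf hg => simp only [map_add, hf, hg]
  | single x c =>
    simp only [base_single, permDesc, Finsupp.lsum_single, LinearMap.comp_apply,
      Finsupp.lsingle_apply]

variable {K : Type u} [Group K] (φ : K →* G) (s₀ : S)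

/-- The retraction of tuples based at `s` onto tuples in the stabilizer `K` of the base point. -/
def retractStab (κ : S → G → K) : (n : ℕ) → S → Bar k G n →ₗ[k] Bar k K n
  | 0, _ => Finsupp.lmapDomain k k fun _ ↦ Fin.elim0
  | n + 1, s => Finsupp.lsum k fun x ↦
      prepend k (κ s (x 0)) n ∘ₗ retractStab κ n ((x 0)⁻¹ • s) ∘ₗ Finsupp.lsingle (Fin.tail x)

omit [Group K] in
theorem retractStab_prepend (κ : S → G → K) (n : ℕ) (s : S) (g : G) (z : Bar k G n) :
    retractStab κ (n + 1) s (prepend k g n z) =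
      prepend k (κ s g) n (retractStab κ n (g⁻¹ • s) z) := by
  induction z using Finsupp.induction_linear with
  | zero => simp
  | add f g hf hg => simp only [map_add, hf, hg]
  | single x a => simp [prepend_single, retractStab]

theorem mapDomain_prepend (n : ℕ) (a : K) (z : Bar k K n) :
    Finsupp.lmapDomain k k (φ ∘ ·) (prepend k a n z) =
      prepend k (φ a) n (Finsupp.lmapDomain k k (φ ∘ ·) z) := by
  induction z using Finsupp.induction_linear with
  | zero => simp
  | add f g hf hg => simp only [map_add, hf, hg]
  | single x c =>
    have : φ ∘ (Fin.cons a x : Fin (n + 1) → K) = Fin.cons (φ a) (φ ∘ x) := by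
      funext i; refine Fin.cases ?_ (fun i ↦ ?_) i <;> rfl
    simp [prepend_single, this]

theorem mapDomain_retractStab (c : S → G) (κ : S → G → K)
    (hκ : ∀ s g, φ (κ s g) = transport c s g) (n : ℕ) (s : S) (z : Bar k G n) :
    Finsupp.lmapDomain k k (φ ∘ ·) (retractStab κ n s z) = retract k c n s z := by
  induction n generalizing s with
  | zero =>
    refine LinearMap.congr_fun (f := Finsupp.lmapDomain k k (φ ∘ ·) ∘ₗ retractStab κ 0 s)
      (g := retract k c 0 s) (Finsupp.lhom_ext fun x a ↦ ?_) z
    simp [retractStab, retract, Subsingleton.elim (_ : Fin 0 → G) x]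
  | succ n ih =>
    refine LinearMap.congr_fun (f := Finsupp.lmapDomain k k (φ ∘ ·) ∘ₗ retractStab κ (n + 1) s)
      (g := retract k c (n + 1) s) (bar_ext fun a z ↦ ?_) z
    rw [LinearMap.comp_apply, retractStab_prepend, mapDomain_prepend, ih, hκ, retract_prepend]

/-- A tuple of stabilizer elements never leaves the base point, where the chosen path is trivial, so
each transport leaves its entry unchanged. -/
theorem retract_mapDomain (c : S → G) (hc : c s₀ = 1) (hφ : ∀ a, φ a • s₀ = s₀) (n : ℕ)
    (z : Bar k K n) : retract k c n s₀ (Finsupp.lmapDomain k k (φ ∘ ·) z) =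
      Finsupp.lmapDomain k k (φ ∘ ·) z := by
  induction n with
  | zero => rfl
  | succ n ih =>
    refine LinearMap.congr_fun (f := retract k c (n + 1) s₀ ∘ₗ Finsupp.lmapDomain k k (φ ∘ ·))
      (g := Finsupp.lmapDomain k k (φ ∘ ·)) (bar_ext fun a z ↦ ?_) z
    have h : (φ a)⁻¹ • s₀ = s₀ := by rw [inv_smul_eq_iff, hφ]
    rw [LinearMap.comp_apply, mapDomain_prepend, retract_prepend, h, ih, transport, h, hc]
    simp

variable (f : Rep.trivial k K k ⟶ Rep.res φ (Rep.of (permRho k G S)))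

theorem chainsMap_base (hf : ∀ a : k, f.hom a = Finsupp.single s₀ a) (n : ℕ) (z : Bar k K n) :
    ((groupHomology.chainsMap φ f).f n).hom z =
      base s₀ n (Finsupp.lmapDomain k k (φ ∘ ·) z) := by
  refine LinearMap.congr_fun (f := ((groupHomology.chainsMap φ f).f n).hom)
    (g := base s₀ n ∘ₗ Finsupp.lmapDomain k k (φ ∘ ·)) (Finsupp.lhom_ext fun x c ↦ ?_) z
  refine (groupHomology.chainsMap_f_single φ f n x c).trans ?_
  rw [LinearMap.comp_apply, Finsupp.lmapDomain_apply, Finsupp.mapDomain_single, base_single]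
  exact congrArg _ (hf c)

/-- The prism operator on the chains with coefficients in a permutation module. -/
def permPrism (c : S → G) (n : ℕ) :
    ((Fin n → G) →₀ (S →₀ k)) →ₗ[k] ((Fin (n + 1) → G) →₀ (S →₀ k)) :=
  permDesc (N := (Fin (n + 1) → G) →₀ (S →₀ k)) n fun s ↦ base s (n + 1) ∘ₗ prism k c n s

theorem permPrism_base (c : S → G) (n : ℕ) (s : S) (z : Bar k G n) :
    permPrism c n (base s n z) = base s (n + 1) (prism k c n s z) :=
  permDesc_base _ _ _ _

/-- The retraction onto the chains of a point stabilizer. -/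
def permRetract (κ : S → G → K) (n : ℕ) : ((Fin n → G) →₀ (S →₀ k)) →ₗ[k] Bar k K n :=
  permDesc (N := Bar k K n) n (retractStab κ n)

omit [Group K] in
theorem permRetract_base (κ : S → G → K) (n : ℕ) (s : S) (z : Bar k G n) :
    permRetract κ n (base s n z) = retractStab κ n s z :=
  permDesc_base _ _ _ _

/-- Combines `barRest_prism` with the first face of the prism. The differential `D` and the
inclusion `I` enter only through their formulas on based tuples. -/
theorem permHomotopy_of (c : S → G) (hc : ∀ s, c s • s₀ = s) (κ : S → G → K)
    (hκ : ∀ s g, φ (κ s g) = transport c s g) (n : ℕ)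
    (D : (m : ℕ) → ((Fin (m + 1) → G) →₀ (S →₀ k)) →ₗ[k] ((Fin m → G) →₀ (S →₀ k)))
    (hD : ∀ m s g z, D m (base s (m + 1) (prepend k g m z)) =
      base (g⁻¹ • s) m z + base s m (barRest k G m (prepend k g m z)))
    (I : Bar k K (n + 1) →ₗ[k] ((Fin (n + 1) → G) →₀ (S →₀ k)))
    (hI : ∀ z, I z = base s₀ (n + 1) (Finsupp.lmapDomain k k (φ ∘ ·) z))
    (y : (Fin (n + 1) → G) →₀ (S →₀ k)) :
    D (n + 1) (permPrism c (n + 1) y) +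
      permPrism c n (D n y) + y =
    I (permRetract κ (n + 1) y) := by
  let L₁ : ((Fin (n + 1) → G) →₀ (S →₀ k)) →ₗ[k] ((Fin (n + 1) → G) →₀ (S →₀ k)) :=
    D (n + 1) ∘ₗ permPrism c (n + 1) + permPrism c n ∘ₗ D n + LinearMap.id
  let L₂ : ((Fin (n + 1) → G) →₀ (S →₀ k)) →ₗ[k] ((Fin (n + 1) → G) →₀ (S →₀ k)) :=
    I ∘ₗ permRetract (k := k) κ (n + 1)
  refine LinearMap.congr_fun (f := L₁) (g := L₂) ?_ y
  refine permChains_ext fun s z ↦ ?_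
  suffices h : L₁ ∘ₗ base s (n + 1) = L₂ ∘ₗ base s (n + 1) from LinearMap.congr_fun h z
  refine bar_ext fun a z ↦ ?_
  have e : ∀ s : S, (c s)⁻¹ • s = s₀ := fun s ↦ by rw [inv_smul_eq_iff, hc]
  have key : barRest k G (n + 1) (prism k c (n + 1) s (prepend k a n z)) +
      prism k c n s (barRest k G n (prepend k a n z)) + prepend k a n z = 0 := by
    rw [barRest_prism, neg_add_cancel]
  replace key := congrArg (base (k := k) s (n + 1)) key
  rw [map_add, map_add, map_zero] at key
  simp only [L₁, L₂, LinearMap.comp_apply, LinearMap.add_apply,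
    LinearMap.id_apply, permRetract_base, permPrism_base, hD, map_add, hI, mapDomain_retractStab φ c κ hκ]
  -- The leading term of the prism starts with `c s`, so its first face is based at `(c s)⁻¹ • s =
  -- s₀` and gives the retraction. The first face of the other term cancels against the prism of the
  -- first face of the tuple.
  have h2 : D (n + 1) (base s (n + 2) (prism k c (n + 1) s (prepend k a n z))) =
      base s₀ (n + 1) (retract k c (n + 1) s (prepend k a n z)) -
      base (a⁻¹ • s) (n + 1) (prism k c n (a⁻¹ • s) z) +
      base s (n + 1) (barRest k G (n + 1) (prism k c (n + 1) s (prepend k a n z))) := by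
    rw [prism_prepend, map_sub, map_sub, map_sub, map_sub, hD, hD, e]
    abel
  rw [h2]
  refine Eq.trans ?_ ((congrArg (base s₀ (n + 1) (retract k c (n + 1) s (prepend k a n z)) + ·)
    key).trans (add_zero _))
  abel

theorem d_permHomotopy (hf : ∀ a : k, f.hom a = Finsupp.single s₀ a) (c : S → G)
    (hc : ∀ s, c s • s₀ = s) (κ : S → G → K)
    (hκ : ∀ s g, φ (κ s g) = transport c s g) (n : ℕ) (y : (Fin (n + 1) → G) →₀ (S →₀ k)) :
    (groupHomology.inhomogeneousChains.d (Rep.of (permRho k G S)) (n + 1)).hom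
        (permPrism c (n + 1) y) +
      permPrism c n
        ((groupHomology.inhomogeneousChains.d (Rep.of (permRho k G S)) n).hom y) + y =
    ((groupHomology.chainsMap φ f).f (n + 1)).hom
      (permRetract κ (n + 1) y) :=
  permHomotopy_of φ s₀ c hc κ hκ n
    (fun m ↦ (groupHomology.inhomogeneousChains.d (Rep.of (permRho k G S)) m).hom)
    (fun m s g z ↦ d_base_prepend s m g z) ((groupHomology.chainsMap φ f).f (n + 1)).hom
    (chainsMap_base φ s₀ f hf (n + 1)) y

/-- The chain map induced by the inclusion of a point stabilizer is a split injection, up to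
homotopy an isomorphism: a left inverse `r` and the homotopy `h`. -/
theorem exists_homotopyInverse (hf : ∀ a : k, f.hom a = Finsupp.single s₀ a)
    (htrans : ∀ s : S, ∃ g : G, g • s₀ = s) (hφ : Function.Injective φ)
    (hstab : ∀ g : G, g • s₀ = s₀ ↔ g ∈ φ.range) :
    ∃ (r : ∀ n, ((groupHomology.inhomogeneousChains (Rep.of (permRho k G S))).X n) →ₗ[k]
        ((groupHomology.inhomogeneousChains (Rep.trivial k K k)).X n))
      (h : ∀ n, ((groupHomology.inhomogeneousChains (Rep.of (permRho k G S))).X n) →ₗ[k]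
        ((groupHomology.inhomogeneousChains (Rep.of (permRho k G S))).X (n + 1))),
      (∀ n y, ((groupHomology.inhomogeneousChains (Rep.of (permRho k G S))).d
          (n + 2) (n + 1)).hom (h (n + 1) y) +
          h n (((groupHomology.inhomogeneousChains (Rep.of (permRho k G S))).d
            (n + 1) n).hom y) + y =
        ((groupHomology.chainsMap φ f).f (n + 1)).hom (r (n + 1) y)) ∧
      ∀ n z, r n (((groupHomology.chainsMap φ f).f n).hom z) = z := by
  classical
  choose c₀ hc₀ using htrans
  -- Normalizing the path at the base point to `1` makes the retraction a strict left inverse, not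
  -- just one up to homotopy.
  let c : S → G := fun s ↦ if s = s₀ then 1 else c₀ s
  have hc : ∀ s, c s • s₀ = s := fun s ↦ by
    by_cases h : s = s₀
    · simp [c, h]
    · simp [c, h, hc₀]
  have hκ : ∀ s g, ∃ a, φ a = transport c s g := fun s g ↦ by
    refine (hstab _).1 ?_
    rw [transport, mul_smul, mul_smul, hc, smul_inv_smul, inv_smul_eq_iff, hc]
  choose κ hκ using hκ
  refine ⟨permRetract κ,
    fun n ↦ permPrism c n, fun n y ↦ ?_, fun n z ↦ ?_⟩
  · rw [groupHomology.inhomogeneousChains.d_def, groupHomology.inhomogeneousChains.d_def]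
    exact d_permHomotopy φ s₀ f hf c hc κ hκ n y
  · refine (congrArg _ (chainsMap_base φ s₀ f hf n z)).trans ?_
    refine (permRetract_base _ _ _ _).trans ?_
    refine Finsupp.mapDomain_injective (f := (φ ∘ · : (Fin n → K) → (Fin n → G)))
      hφ.comp_left ?_
    exact (mapDomain_retractStab φ c κ hκ _ _ _).trans
      (retract_mapDomain φ s₀ c (by simp [c]) (fun a ↦ (hstab _).2 ⟨a, rfl⟩) _ _)

end Permutation

/-! ### From the homotopy to Shapiro's lemma -/

section Shapiro

variable {k : Type u} [CommRing k]

/-- A chain map with a left inverse `r` in degree `n + 1` that is a right inverse up to homotopy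
is bijective on the homology in degree `n + 1`. -/
theorem homologyMap_bijective_of_homotopyInverse {C D : ChainComplex (ModuleCat.{u} k) ℕ}
    (F : C ⟶ D) (r : ∀ n, D.X n →ₗ[k] C.X n) (h : ∀ n, D.X n →ₗ[k] D.X (n + 1))
    (e : ∀ n y, (D.d (n + 2) (n + 1)).hom (h (n + 1) y) + h n ((D.d (n + 1) n).hom y) + y =
      (F.f (n + 1)).hom (r (n + 1) y))
    (hr : ∀ n z, r n ((F.f n).hom z) = z) (n : ℕ) :
    Function.Bijective (HomologicalComplex.homologyMap F (n + 1)).hom := by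
  have inj : ∀ n, Function.Injective (F.f n).hom := fun n ↦ Function.LeftInverse.injective (hr n)
  have cF : ∀ i j z, (D.d i j).hom ((F.f i).hom z) = (F.f j).hom ((C.d i j).hom z) := fun i j z ↦
    congrArg (fun g ↦ g.hom z) (F.comm i j)
  have dd : ∀ i j l z, (D.d j l).hom ((D.d i j).hom z) = 0 := fun i j l z ↦
    congrArg (fun g ↦ g.hom z) (D.d_comp_d i j l)
  have hπ : ∀ {E : ChainComplex (ModuleCat.{u} k) ℕ} (z : E.X (n + 2)),
      (E.homologyπ (n + 1)).hom ((E.toCycles (n + 2) (n + 1)).hom z) = 0 := fun {E} z ↦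
    congrArg (fun g ↦ g.hom z) (E.toCycles_comp_homologyπ (n + 2) (n + 1))
  have hi : ∀ (E : ChainComplex (ModuleCat.{u} k) ℕ),
      Function.Injective (E.iCycles (n + 1)).hom := fun E ↦
    (ModuleCat.mono_iff_injective _).1 inferInstance
  have ht : ∀ (E : ChainComplex (ModuleCat.{u} k) ℕ) (z : E.X (n + 2)),
      (E.iCycles (n + 1)).hom ((E.toCycles (n + 2) (n + 1)).hom z) =
        (E.d (n + 2) (n + 1)).hom z := fun E z ↦
    congrArg (fun g ↦ g.hom z) (E.toCycles_i (n + 2) (n + 1))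
  have hd : ∀ (E : ChainComplex (ModuleCat.{u} k) ℕ) z,
      (E.d (n + 1) n).hom ((E.iCycles (n + 1)).hom z) = 0 := fun E z ↦
    congrArg (fun g ↦ g.hom z) (E.iCycles_d (n + 1) n)
  have hFi : ∀ z, (D.iCycles (n + 1)).hom ((HomologicalComplex.cyclesMap F (n + 1)).hom z) =
      (F.f (n + 1)).hom ((C.iCycles (n + 1)).hom z) := fun z ↦
    congrArg (fun g ↦ g.hom z) (HomologicalComplex.cyclesMap_i F (n + 1))
  have hFπ : ∀ z, (HomologicalComplex.homologyMap F (n + 1)).hom ((C.homologyπ (n + 1)).hom z) =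
      (D.homologyπ (n + 1)).hom ((HomologicalComplex.cyclesMap F (n + 1)).hom z) := fun z ↦
    congrArg (fun g ↦ g.hom z) (HomologicalComplex.homologyπ_naturality F (n + 1))
  have hsurj : ∀ (E : ChainComplex (ModuleCat.{u} k) ℕ),
      Function.Surjective (E.homologyπ (n + 1)).hom := fun E ↦
    (ModuleCat.epi_iff_surjective _).1 inferInstance
  have hex : ∀ (E : ChainComplex (ModuleCat.{u} k) ℕ) z, (E.homologyπ (n + 1)).hom z = 0 →
      ∃ w, (E.toCycles (n + 2) (n + 1)).hom w = z := fun E z hz ↦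
    (ShortComplex.moduleCat_exact_iff
      (ShortComplex.mk _ _ (E.toCycles_comp_homologyπ (n + 2) (n + 1)))).1
      (ShortComplex.exact_of_g_is_cokernel _
        (E.homologyIsCokernel (n + 2) (n + 1) (by simp))) z hz
  have hmk : ∀ (E : ChainComplex (ModuleCat.{u} k) ℕ) z, (E.d (n + 1) n).hom z = 0 →
      ∃ w, (E.iCycles (n + 1)).hom w = z := fun E z hz ↦
    ⟨E.cyclesMk z n (by simp) hz, E.i_cyclesMk z n (by simp) hz⟩
  replace e := fun n y ↦ eq_sub_of_add_eq (e n y)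
  constructor
  · rw [injective_iff_map_eq_zero]
    intro x hx
    obtain ⟨z, rfl⟩ := hsurj C x
    rw [hFπ] at hx
    obtain ⟨w, hw⟩ := hex D _ hx
    have hw' := ht D w
    rw [hw, hFi] at hw'
    suffices hz : z = (C.toCycles (n + 2) (n + 1)).hom (r (n + 2) w) by rw [hz, hπ]
    refine hi C (inj (n + 1) ?_)
    -- The maps `r` are not assumed to commute with differentials. The homotopy relation is used at
    -- `dw` and at `w`, and injectivity of `F` then gives `z = d (r w)`.
    have e₁ := e n ((D.d (n + 2) (n + 1)).hom w)
    rw [dd, map_zero, add_zero, ← hw', hr, sub_self] at e₁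
    have e₂ := congrArg (D.d (n + 2) (n + 1)).hom (e (n + 1) w)
    rw [map_add, map_sub, dd, zero_add, cF, ← hw', e₁] at e₂
    rw [ht]
    exact (sub_eq_zero.1 e₂.symm).symm
  · intro x
    obtain ⟨z, rfl⟩ := hsurj D x
    have e₁ := e n ((D.iCycles (n + 1)).hom z)
    rw [hd, map_zero, add_zero] at e₁
    -- On a cycle `z`, `F (r z)` differs from `z` by a boundary and so is a cycle. Injectivity of
    -- `F` in degree `n` passes this to `r z`.
    have hz : (C.d (n + 1) n).hom (r (n + 1) ((D.iCycles (n + 1)).hom z)) = 0 := by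
      refine inj n ?_
      rw [← cF, ← sub_add_cancel ((F.f (n + 1)).hom _) ((D.iCycles (n + 1)).hom z), ← e₁, map_add,
        dd, hd, map_zero, add_zero]
    obtain ⟨y, hy⟩ := hmk C _ hz
    refine ⟨(C.homologyπ (n + 1)).hom y, ?_⟩
    rw [hFπ, ← sub_eq_zero, ← map_sub]
    suffices hz' : (HomologicalComplex.cyclesMap F (n + 1)).hom y - z =
        (D.toCycles (n + 2) (n + 1)).hom (h (n + 1) ((D.iCycles (n + 1)).hom z)) by rw [hz', hπ]
    refine hi D ?_
    rw [map_sub, hFi, hy, ht, e₁]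

/-- Shapiro's lemma: if `G` acts transitively on `S` and `φ : K → G` is an isomorphism onto the
stabilizer of `s₀ : S`, then `φ` and `1 ↦ s₀` induce isomorphisms `H_n(K, k) ≃ H_n(G, k[S])`. -/
theorem map_bijective_of_transitive {G S K : Type u} [Group G] [MulAction G S] [Group K]
    (φ : K →* G) (s₀ : S) (f : Rep.trivial k K k ⟶ Rep.res φ (Rep.of (permRho k G S)))
    (hf : ∀ a : k, f.hom a = Finsupp.single s₀ a)
    (htrans : ∀ s : S, ∃ g : G, g • s₀ = s) (hφ : Function.Injective φ)
    (hstab : ∀ g : G, g • s₀ = s₀ ↔ g ∈ φ.range) (n : ℕ) :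
    Function.Bijective (groupHomology.map φ f (n + 1)).hom := by
  obtain ⟨r, h, e, hr⟩ := exists_homotopyInverse φ s₀ f hf htrans hφ hstab
  exact homologyMap_bijective_of_homotopyInverse (groupHomology.chainsMap φ f) r h e hr n

end Shapiro


/-! ### Functoriality and long exact sequences under change of group -/

section Functoriality

variable {G G' G'' : Type u} [Group G] [Group G'] [Group G'']

theorem chainsMap_comp_eq {φ : G →* G'} {ψ : G' →* G''} {θ : G →* G''} {L : Rep.{u} ZZ.{u} G}
    {M : Rep.{u} ZZ.{u} G'} {N : Rep.{u} ZZ.{u} G''} (f : L ⟶ Rep.res φ M) (g : M ⟶ Rep.res ψ N)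
    (h : L ⟶ Rep.res θ N) (hθ : ∀ x, ψ (φ x) = θ x) (hh : ∀ x, g.hom (f.hom x) = h.hom x) :
    groupHomology.chainsMap φ f ≫ groupHomology.chainsMap ψ g = groupHomology.chainsMap θ h := by
  refine HomologicalComplex.hom_ext _ _ fun n ↦ ModuleCat.hom_ext (Finsupp.lhom_ext fun x c ↦ ?_)
  refine (congrArg ((groupHomology.chainsMap ψ g).f n).hom
    (groupHomology.chainsMap_f_single φ f n x c)).trans ?_
  refine (groupHomology.chainsMap_f_single ψ g n _ _).trans
    (Eq.trans ?_ (groupHomology.chainsMap_f_single θ h n x c).symm)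
  have : ψ ∘ φ ∘ x = θ ∘ x := funext fun i ↦ hθ (x i)
  rw [this]
  exact congrArg _ (hh c)

/-- Only pointwise agreement is required, so factorizations of one map through different
intermediate groups, such as `PB(A)` and `PSM₂(A)`, can be compared through a common composite. -/
theorem map_map_eq {φ : G →* G'} {ψ : G' →* G''} {θ : G →* G''} {L : Rep.{u} ZZ.{u} G}
    {M : Rep.{u} ZZ.{u} G'} {N : Rep.{u} ZZ.{u} G''} (f : L ⟶ Rep.res φ M) (g : M ⟶ Rep.res ψ N)
    (h : L ⟶ Rep.res θ N) (hθ : ∀ x, ψ (φ x) = θ x) (hh : ∀ x, g.hom (f.hom x) = h.hom x)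
    (n : ℕ) (x : H n L) :
    (groupHomology.map ψ g n).hom ((groupHomology.map φ f n).hom x) =
      (groupHomology.map θ h n).hom x := by
  have e := congrArg (fun F ↦ HomologicalComplex.homologyMap F n)
    (chainsMap_comp_eq f g h hθ hh)
  rw [HomologicalComplex.homologyMap_comp] at e
  exact congrArg (fun F ↦ F.hom x) e

/-- The three coefficient maps give a morphism of short exact sequences of chain complexes, even
over a change of group. Naturality of the homology sequence then applies. -/
theorem Hδ_naturality (φ : G →* G') {S : ShortComplex (Rep.{u} ZZ.{u} G)} (hS : S.ShortExact)
    {S' : ShortComplex (Rep.{u} ZZ.{u} G')} (hS' : S'.ShortExact)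
    (τ₁ : S.X₁ ⟶ Rep.res φ S'.X₁) (τ₂ : S.X₂ ⟶ Rep.res φ S'.X₂) (τ₃ : S.X₃ ⟶ Rep.res φ S'.X₃)
    (h₁₂ : ∀ x, τ₂.hom (S.f.hom x) = S'.f.hom (τ₁.hom x))
    (h₂₃ : ∀ x, τ₃.hom (S.g.hom x) = S'.g.hom (τ₂.hom x)) (n : ℕ) (x : H (n + 1) S.X₃) :
    Hδ n hS' ((groupHomology.map φ τ₃ (n + 1)).hom x) =
      (groupHomology.map φ τ₁ n).hom (Hδ n hS x) := by
  let Φ : S.map (groupHomology.chainsFunctor ZZ.{u} G) ⟶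
      S'.map (groupHomology.chainsFunctor ZZ.{u} G') :=
    { τ₁ := groupHomology.chainsMap φ τ₁
      τ₂ := groupHomology.chainsMap φ τ₂
      τ₃ := groupHomology.chainsMap φ τ₃
      comm₁₂ := (chainsMap_comp_eq (φ := φ) (ψ := MonoidHom.id G') τ₁ S'.f
        (Rep.ofHom (Rep.Hom.hom τ₂ |>.comp S.f.hom)) (fun _ ↦ rfl) (fun x ↦ (h₁₂ x).symm)).trans
        (chainsMap_comp_eq (φ := MonoidHom.id G) (ψ := φ) S.f τ₂ _ (fun _ ↦ rfl)
          (fun _ ↦ rfl)).symm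
      comm₂₃ := (chainsMap_comp_eq (φ := φ) (ψ := MonoidHom.id G') τ₂ S'.g
        (Rep.ofHom (Rep.Hom.hom τ₃ |>.comp S.g.hom)) (fun _ ↦ rfl) (fun x ↦ (h₂₃ x).symm)).trans
        (chainsMap_comp_eq (φ := MonoidHom.id G) (ψ := φ) S.g τ₃ _ (fun _ ↦ rfl)
          (fun _ ↦ rfl)).symm }
  exact (congrArg (fun f ↦ f.hom x) (HomologicalComplex.HomologySequence.δ_naturality Φ
    (groupHomology.map_chainsFunctor_shortExact hS)
    (groupHomology.map_chainsFunctor_shortExact hS') (n + 1) n rfl)).symm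

theorem exact_Hmap_Hδ {S : ShortComplex (Rep.{u} ZZ.{u} G)} (hS : S.ShortExact) (n : ℕ) :
    Function.Exact (Hmap (n + 1) S.g) (Hδ n hS) :=
  (ShortComplex.ShortExact.moduleCat_exact_iff_function_exact _).1
    (groupHomology.mapShortComplex₃_exact hS (i := n + 1) (j := n) rfl)

theorem exact_Hδ_Hmap {S : ShortComplex (Rep.{u} ZZ.{u} G)} (hS : S.ShortExact) (n : ℕ) :
    Function.Exact (Hδ n hS) (Hmap n S.f) :=
  (ShortComplex.ShortExact.moduleCat_exact_iff_function_exact _).1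
    (groupHomology.mapShortComplex₁_exact hS (i := n + 1) (j := n) rfl)

end Functoriality

/-! ### Vanishing of first homology for a free action -/

section Free

variable {G S : Type u} [Group G] [MulAction G S]

/-- The first homology of a group with coefficients in the permutation module of a free action
vanishes. -/
theorem H1_perm_eq_zero {k : Type u} [CommRing k]
    (hfree : ∀ (g : G) (s : S), g • s = s → g = 1)
    (x : groupHomology (Rep.of (permRho k G S)) 1) : x = 0 := by
  obtain ⟨z, rfl⟩ := (ModuleCat.epi_iff_surjective _).1
    (inferInstance : Epi (groupHomology.H1π (Rep.of (permRho k G S)))) x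
  let o : S → S := fun s ↦ (Quotient.mk (MulAction.orbitRel G S) s).out
  have ho : ∀ s, ∃ g : G, g • o s = s := fun s ↦
    (MulAction.orbitRel_apply.1 (Quotient.exact (Quotient.out_eq
      (Quotient.mk (MulAction.orbitRel G S) s)).symm) : _)
  choose τ hτ using ho
  -- Here freeness enters: the element carrying the orbit representative to a given point is unique.
  have hτ' : ∀ g s, (τ s)⁻¹ * g = (τ (g⁻¹ • s))⁻¹ := fun g s ↦ by
    have ho' : o (g⁻¹ • s) = o s := by
      refine congrArg Quotient.out (Quotient.sound (MulAction.orbitRel_apply.2 ⟨g⁻¹, rfl⟩))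
    have := hfree ((τ s)⁻¹ * g * τ (g⁻¹ • s)) (o s) (by
      rw [mul_smul, mul_smul, ← ho', hτ, smul_inv_smul, ho', inv_smul_eq_iff, hτ])
    exact eq_inv_of_mul_eq_one_left this
  -- A contracting homotopy: every path is coned off to the representative of its orbit.
  let h : (G →₀ (S →₀ k)) →ₗ[k] (G × G →₀ (S →₀ k)) :=
    Finsupp.lsum k fun g ↦ Finsupp.lsum k fun s ↦
      Finsupp.lsingle ((τ s)⁻¹, g) ∘ₗ Finsupp.lsingle (o s)
  let h₀ : (S →₀ k) →ₗ[k] (G →₀ (S →₀ k)) :=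
    Finsupp.lsum k fun s ↦ Finsupp.lsingle ((τ s)⁻¹) ∘ₗ Finsupp.lsingle (o s)
  have key : ∀ y, (groupHomology.d₂₁ (Rep.of (permRho k G S))).hom (h y) + 
      h₀ ((groupHomology.d₁₀ (Rep.of (permRho k G S))).hom y) = y := by
    intro y
    refine LinearMap.congr_fun (f := (groupHomology.d₂₁ (Rep.of (permRho k G S))).hom ∘ₗ h +
      h₀ ∘ₗ (groupHomology.d₁₀ (Rep.of (permRho k G S))).hom) (g := LinearMap.id)
      (Finsupp.lhom_ext' fun g ↦ Finsupp.lhom_ext fun s c ↦ ?_) y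
    have e₁ : h (Finsupp.single g (Finsupp.single s c)) =
        Finsupp.single ((τ s)⁻¹, g) (Finsupp.single (o s) c) := by
      simp only [h, Finsupp.lsum_single, LinearMap.comp_apply, Finsupp.lsingle_apply]
    have e₂ : ∀ s, h₀ (Finsupp.single s c) =
        Finsupp.single (τ s)⁻¹ (Finsupp.single (o s) c) := fun s ↦ by
      simp only [h₀, Finsupp.lsum_single, LinearMap.comp_apply, Finsupp.lsingle_apply]
    have e₃ := groupHomology.d₂₁_single (A := Rep.of (permRho k G S)) ((τ s)⁻¹, g)
      (Finsupp.single (o s) c)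
    have e₄ := groupHomology.d₁₀_single (A := Rep.of (permRho k G S)) g (Finsupp.single s c)
    have e₅ : ∀ g s, (Rep.of (permRho k G S)).ρ g (Finsupp.single s c) =
      Finsupp.single (g • s) c := fun g s ↦ permRho_single g s c
    rw [e₅, inv_inv, hτ, hτ'] at e₃
    rw [e₅] at e₄
    change (groupHomology.d₂₁ (Rep.of (permRho k G S))).hom
        (h (Finsupp.single g (Finsupp.single s c))) +
      h₀ ((groupHomology.d₁₀ (Rep.of (permRho k G S))).hom
        (Finsupp.single g (Finsupp.single s c))) = Finsupp.single g (Finsupp.single s c)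
    have ho' : o (g⁻¹ • s) = o s :=
      congrArg Quotient.out (Quotient.sound (MulAction.orbitRel_apply.2 ⟨g⁻¹, rfl⟩))
    rw [e₁]
    refine (congrArg₂ (· + ·) e₃ ((congrArg h₀ e₄).trans (map_sub h₀ _ _))).trans ?_
    rw [e₂, e₂, ho']
    abel
  rw [groupHomology.H1π_eq_zero_iff]
  refine ⟨h z.1, ?_⟩
  have hz := key z.1
  have hz' : (groupHomology.d₁₀ (Rep.of (permRho k G S))).hom z.1 = 0 := z.2
  rwa [hz', map_zero, add_zero] at hz

end Free


/-! ### Monomial matrices acting on lines, the elements `ψ_1`, and stabilizers -/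

section Geometry

variable {A : Type u} [CommRing A]

theorem line_eq_of_smul (g : GL (Fin 2) A) {n : ℕ} (x : Tuple A n) (i : Fin (n + 1))
    {v w : Vec A} {c : A} (hc : IsUnit c) (hx : x.line i = Submodule.span A {v})
    (h : (g : Matrix (Fin 2) (Fin 2) A).mulVec v = c • w) :
    (g • x).line i = Submodule.span A {w} := by
  rw [Tuple.smul_line, hx, Submodule.map_span, Set.image_singleton, Matrix.mulVecLin_apply, h]
  exact Submodule.span_singleton_smul_eq hc _

/-- The matrix `!![0, a⁻¹; -a, 0]`. -/
def mSL (a : Aˣ) : Matrix.SpecialLinearGroup (Fin 2) A :=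
  ⟨!![0, ((a⁻¹ : Aˣ) : A); -(a : A), 0], by simp [Matrix.det_fin_two]⟩

theorem mulVec_dmat (a : Aˣ) (v : Vec A) :
    ((dmat a : GL (Fin 2) A) : Matrix (Fin 2) (Fin 2) A).mulVec v = ![v 0, a * v 1] := by
  change Matrix.mulVec !![1, 0; 0, (a : A)] v = _
  ext i; fin_cases i <;> simp [Matrix.mulVec, dotProduct, Fin.sum_univ_two]

theorem mulVec_mSL (a : Aˣ) (v : Vec A) :
    ((Matrix.SpecialLinearGroup.toGL (mSL a) : GL (Fin 2) A) :
      Matrix (Fin 2) (Fin 2) A).mulVec v = ![((a⁻¹ : Aˣ) : A) * v 1, -a * v 0] := by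
  change Matrix.mulVec !![0, ((a⁻¹ : Aˣ) : A); -(a : A), 0] v = _
  ext i; fin_cases i <;> simp [Matrix.mulVec, dotProduct, Fin.sum_univ_two]

theorem dmat_smul_inftyZero (a b : Aˣ) : dmat a • inftyZero b = inftyZero (a * b) := by
  refine Tuple.ext fun i ↦ ?_
  fin_cases i
  · refine line_eq_of_smul _ _ _ (v := ![1, 0]) (c := 1) isUnit_one rfl ?_
    rw [mulVec_dmat]; ext i; fin_cases i <;> simp
  · refine line_eq_of_smul _ _ _ (v := ![0, 1]) (c := a) a.isUnit rfl ?_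
    rw [mulVec_dmat]; ext i; fin_cases i <;> simp
  · refine line_eq_of_smul _ _ _ (v := ![1, (b : A)]) (c := 1) isUnit_one rfl ?_
    rw [mulVec_dmat]; ext i; fin_cases i <;> simp

theorem dmat_smul_zeroInfty (a b : Aˣ) : dmat a • zeroInfty b = zeroInfty (a * b) := by
  refine Tuple.ext fun i ↦ ?_
  fin_cases i
  · refine line_eq_of_smul _ _ _ (v := ![0, 1]) (c := a) a.isUnit rfl ?_
    rw [mulVec_dmat]; ext i; fin_cases i <;> simp
  · refine line_eq_of_smul _ _ _ (v := ![1, 0]) (c := 1) isUnit_one rfl ?_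
    rw [mulVec_dmat]; ext i; fin_cases i <;> simp
  · refine line_eq_of_smul _ _ _ (v := ![1, (b : A)]) (c := 1) isUnit_one rfl ?_
    rw [mulVec_dmat]; ext i; fin_cases i <;> simp

theorem dSL_smul_inftyZero (a b : Aˣ) :
    (QuotientGroup.mk (dSL a) : PSL A) • inftyZero b = inftyZero (a ^ 2 * b) := by
  rw [← dmat_sq_smul, dmat_smul_inftyZero]

theorem dSL_smul_zeroInfty (a b : Aˣ) :
    (QuotientGroup.mk (dSL a) : PSL A) • zeroInfty b = zeroInfty (a ^ 2 * b) := by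
  rw [← dmat_sq_smul, dmat_smul_zeroInfty]

theorem mSL_smul_inftyZero (a b : Aˣ) :
    (QuotientGroup.mk (mSL a) : PSL A) • inftyZero b = zeroInfty (-(a ^ 2 * b⁻¹)) := by
  rw [mk_smul]
  refine Tuple.ext fun i ↦ ?_
  fin_cases i
  · refine line_eq_of_smul _ _ _ (v := ![1, 0]) (c := -a) a.isUnit.neg rfl ?_
    rw [mulVec_mSL]; ext i; fin_cases i <;> simp
  · refine line_eq_of_smul _ _ _ (v := ![0, 1]) (c := ((a⁻¹ : Aˣ) : A)) a⁻¹.isUnit rfl ?_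
    rw [mulVec_mSL]; ext i; fin_cases i <;> simp
  -- The image vector is `(a⁻¹b, -a)`. Dividing by `a⁻¹b` makes its first coordinate `1`, and the
  -- second becomes `-a²b⁻¹`.
  · refine line_eq_of_smul _ _ _ (v := ![1, (b : A)]) (c := ((a⁻¹ * b : Aˣ) : A))
      (Units.isUnit _) rfl ?_
    rw [mulVec_mSL]; ext i; fin_cases i
    · simp
    · simp only [Pi.smul_apply, smul_eq_mul]
      change -(a : A) * 1 = ((a⁻¹ * b : Aˣ) : A) * ((-(a ^ 2 * b⁻¹) : Aˣ) : A)
      rw [Units.val_neg, mul_neg, ← Units.val_mul]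
      have : a⁻¹ * b * (a ^ 2 * b⁻¹) = a := by
        rw [mul_comm (a ^ 2), ← mul_assoc, mul_inv_cancel_right, pow_two, inv_mul_cancel_left]
      rw [this, mul_one]

theorem mSL_smul_zeroInfty (a b : Aˣ) :
    (QuotientGroup.mk (mSL a) : PSL A) • zeroInfty b = inftyZero (-(a ^ 2 * b⁻¹)) := by
  rw [mk_smul]
  refine Tuple.ext fun i ↦ ?_
  fin_cases i
  · refine line_eq_of_smul _ _ _ (v := ![0, 1]) (c := ((a⁻¹ : Aˣ) : A)) a⁻¹.isUnit rfl ?_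
    rw [mulVec_mSL]; ext i; fin_cases i <;> simp
  · refine line_eq_of_smul _ _ _ (v := ![1, 0]) (c := -a) a.isUnit.neg rfl ?_
    rw [mulVec_mSL]; ext i; fin_cases i <;> simp
  · refine line_eq_of_smul _ _ _ (v := ![1, (b : A)]) (c := ((a⁻¹ * b : Aˣ) : A))
      (Units.isUnit _) rfl ?_
    rw [mulVec_mSL]; ext i; fin_cases i
    · simp
    · simp only [Pi.smul_apply, smul_eq_mul]
      change -(a : A) * 1 = ((a⁻¹ * b : Aˣ) : A) * ((-(a ^ 2 * b⁻¹) : Aˣ) : A)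
      rw [Units.val_neg, mul_neg, ← Units.val_mul]
      have : a⁻¹ * b * (a ^ 2 * b⁻¹) = a := by
        rw [mul_comm (a ^ 2), ← mul_assoc, mul_inv_cancel_right, pow_two, inv_mul_cancel_left]
      rw [this, mul_one]

theorem smul_psiChain_of {p : PSL A} {a b : Aˣ} (h₁ : p • inftyZero a = inftyZero b)
    (h₂ : p • zeroInfty a = zeroInfty b) : XRho A 2 p (psiChain a) = psiChain b := by
  simp [XRho, psiChain, Finsupp.mapDomain_add, h₁, h₂]

theorem dSL_smul_psiChain (a b : Aˣ) :
    XRho A 2 (QuotientGroup.mk (dSL a)) (psiChain b) = psiChain (a ^ 2 * b) :=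
  smul_psiChain_of (dSL_smul_inftyZero a b) (dSL_smul_zeroInfty a b)

theorem mSL_smul_psiChain (a b : Aˣ) :
    XRho A 2 (QuotientGroup.mk (mSL a)) (psiChain b) = psiChain (-(a ^ 2 * b⁻¹)) := by
  simp [XRho, psiChain, Finsupp.mapDomain_add, mSL_smul_inftyZero, mSL_smul_zeroInfty, add_comm]

/-- The class of `psiChain a - psiChain b`. -/
theorem psiChain_sub_mem (a b : Aˣ) : bdLin A 1 (psiChain a - psiChain b) = 0 := by
  rw [map_sub, bdLin_psiChain a, bdLin_psiChain b, sub_self]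

theorem psi1_sub_psi1 (a b : Aˣ) :
    psi1 a - psi1 b = RPmk A ⟨psiChain a - psiChain b, psiChain_sub_mem a b⟩ := by
  rw [psi1, psi1, ← map_sub]
  congr 1
  refine Subtype.ext ?_
  change psiChain a - psiChain 1 - (psiChain b - psiChain 1) = psiChain a - psiChain b
  abel

theorem psi1_one : psi1 (1 : Aˣ) = 0 := by
  have := psi1_sub_psi1 (1 : Aˣ) 1
  rw [sub_self] at this
  exact this.symm

/-- A difference of two `psiChain`s is a cycle, so moving it by `PSL₂(A)` does not change its class
in the coinvariants. This is the source of all relations among the `ψ_1`. -/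
theorem psi1_sub_psi1_of_smul {p : PSL A} {a b a' b' : Aˣ} (ha : XRho A 2 p (psiChain a) = psiChain a')
    (hb : XRho A 2 p (psiChain b) = psiChain b') : psi1 a' - psi1 b' = psi1 a - psi1 b := by
  rw [psi1_sub_psi1, psi1_sub_psi1]
  refine Eq.trans ?_ (RPmk_smul p ⟨psiChain a - psiChain b, psiChain_sub_mem a b⟩)
  congr 1
  refine Subtype.ext ?_
  change psiChain a' - psiChain b' = XRho A 2 p (psiChain a - psiChain b)
  rw [map_sub, ha, hb]

theorem sqRP_psi1 (a b : Aˣ) :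
    sqRP A (QuotientGroup.mk a) (psi1 b) = psi1 (a * b) - psi1 a := by
  change glRP (dmat a) (RPmk A _) = _
  rw [glRP_mk, psi1_sub_psi1]
  congr 1
  refine Subtype.ext ?_
  change XRhoGL A 2 (dmat a) (psiChain b - psiChain 1) = psiChain (a * b) - psiChain a
  have h : ∀ b, XRhoGL A 2 (dmat a) (psiChain b) = psiChain (a * b) := fun b ↦ by
    simp [XRhoGL, psiChain, Finsupp.mapDomain_add, dmat_smul_inftyZero, dmat_smul_zeroInfty]
  rw [map_sub, h, h, mul_one]

/-- The left side is `ψ_1(-a) - ψ_1(a)`. The matrix `mSL a` sends `psiChain a` to `psiChain (-a)`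
and `psiChain 1` to `psiChain (-a²)`, so `ψ_1(-a) - ψ_1(-a²) = ψ_1(a)`. -/
theorem sqRP_psi1_neg_one (a : Aˣ) :
    sqRP A (QuotientGroup.mk a) (psi1 (-1)) = psi1 (-a ^ 2) := by
  rw [sqRP_psi1]
  have h := psi1_sub_psi1_of_smul (mSL_smul_psiChain a a) (mSL_smul_psiChain a 1)
  rw [psi1_one, sub_zero] at h
  have e : a ^ 2 * a⁻¹ = a := by rw [pow_two, mul_inv_cancel_right]
  rw [e, inv_one, mul_one] at h
  rw [mul_neg, mul_one, ← h]
  abel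

theorem psi1_neg_sq_mem (a : Aˣ) : psi1 (-a ^ 2) ∈ psiSubmodule A :=
  Submodule.subset_span ⟨QuotientGroup.mk a, sqRP_psi1_neg_one a⟩

/-- Translating by `dSL a` gives `ψ_1(-a²) - ψ_1(a²) = ψ_1(-1)`. -/
theorem psi1_sq_mem (a : Aˣ) : psi1 (a ^ 2) ∈ psiSubmodule A := by
  have h := psi1_sub_psi1_of_smul (dSL_smul_psiChain a (-1)) (dSL_smul_psiChain a 1)
  rw [psi1_one, sub_zero, mul_neg, mul_one] at h
  have h1 : psi1 (-1 : Aˣ) ∈ psiSubmodule A := by simpa using psi1_neg_sq_mem (1 : Aˣ)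
  rw [← h] at h1
  have := (psiSubmodule A).sub_mem (psi1_neg_sq_mem a) h1
  rwa [sub_sub_cancel] at this

theorem PSM_cases {p : PSL A} (hp : p ∈ PSM A) :
    ∃ a : Aˣ, p = QuotientGroup.mk (dSL a) ∨ p = QuotientGroup.mk (mSL a) := by
  obtain ⟨g, hg, rfl⟩ := hp
  have hdet := g.2
  rw [Matrix.det_fin_two] at hdet
  rcases hg with ⟨h₁, h₂⟩ | ⟨h₁, h₂⟩
  · have h₁' : g.1 0 1 = 0 := h₁
    have h₂' : g.1 1 0 = 0 := h₂
    rw [h₁', zero_mul, sub_zero] at hdet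
    refine ⟨⟨g.1 1 1, g.1 0 0, by rw [mul_comm, hdet], hdet⟩, Or.inl ?_⟩
    refine congrArg QuotientGroup.mk (Subtype.ext ?_)
    ext i j
    fin_cases i <;> fin_cases j <;> simp [dSL, h₁', h₂']
  · have h₁' : g.1 0 0 = 0 := h₁
    have h₂' : g.1 1 1 = 0 := h₂
    rw [h₁', zero_mul, zero_sub] at hdet
    -- The lower left entry of `mSL a` is `-a`, which explains the sign.
    refine ⟨⟨-g.1 1 0, g.1 0 1, by linear_combination hdet, by linear_combination hdet⟩, Or.inr ?_⟩
    refine congrArg QuotientGroup.mk (Subtype.ext ?_)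
    ext i j
    fin_cases i <;> fin_cases j <;> simp [mSL, h₁', h₂']

theorem mSL_mem (a : Aˣ) : (QuotientGroup.mk (mSL a) : PSL A) ∈ PSM A :=
  ⟨mSL a, Or.inr ⟨rfl, rfl⟩, rfl⟩

theorem dSL_mem_PT (a : Aˣ) : (QuotientGroup.mk (dSL a) : PSL A) ∈ PT A :=
  ⟨dSL a, ⟨rfl, rfl⟩, rfl⟩

theorem mk_eq_one_of_scalar {g : Matrix.SpecialLinearGroup (Fin 2) A}
    (h₁ : g.1 0 1 = 0) (h₂ : g.1 1 0 = 0) (h : g.1 0 0 = g.1 1 1) :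
    (QuotientGroup.mk g : PSL A) = 1 := by
  rw [QuotientGroup.eq_one_iff, Matrix.SpecialLinearGroup.mem_center_iff]
  have hdet := g.2
  rw [Matrix.det_fin_two, h₁, zero_mul, sub_zero, h, ← pow_two] at hdet
  refine ⟨g.1 1 1, by simpa using hdet, ?_⟩
  ext i j
  fin_cases i <;> fin_cases j <;> simp [h₁, h₂, h]

/-- The square is `-I` in `SL₂(A)`, hence trivial in `PSL₂(A)`. These involutions produce the
classes `ψ_1(-a²)`. -/
theorem mSL_mul_self (a : Aˣ) :
    (QuotientGroup.mk (mSL a) : PSL A) * QuotientGroup.mk (mSL a) = 1 := by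
  rw [← QuotientGroup.mk_mul]
  have h : (mSL a * mSL a).1 = !![-1, 0; 0, -1] := by
    change !![0, ((a⁻¹ : Aˣ) : A); -(a : A), 0] * !![0, ((a⁻¹ : Aˣ) : A); -(a : A), 0] = _
    ext i j
    fin_cases i <;> fin_cases j <;> simp [Matrix.mul_apply, Fin.sum_univ_two]
  refine mk_eq_one_of_scalar ?_ ?_ ?_ <;> rw [h] <;> rfl

variable (A)

/-- The pair `(∞, 0)`. -/
def pairIZ : Tuple A 1 := (inftyZero 1).face 2

/-- The pair `(0, ∞)`. -/
def pairZI : Tuple A 1 := (zeroInfty 1).face 2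

/-- The point `∞`. -/
def ptInfty : Tuple A 0 := (pairIZ A).face 1

/-- The point `0`. -/
def ptZero : Tuple A 0 := (pairIZ A).face 0

variable {A}

theorem inftyZero_face_two (a : Aˣ) : (inftyZero a).face 2 = pairIZ A :=
  triple_face 2 2 fun k ↦ by fin_cases k <;> simp [Fin.succAbove]

theorem zeroInfty_face_two (a : Aˣ) : (zeroInfty a).face 2 = pairZI A :=
  triple_face 2 2 fun k ↦ by fin_cases k <;> simp [Fin.succAbove]

theorem face_zero_pairZI : (pairZI A).face 0 = ptInfty A :=
  Tuple.ext fun i ↦ by fin_cases i; rfl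

theorem face_one_pairZI : (pairZI A).face 1 = ptZero A :=
  Tuple.ext fun i ↦ by fin_cases i; rfl

theorem exists_smul_ptInfty (x : Tuple A 0) : ∃ p : PSL A, p • ptInfty A = x := by
  obtain ⟨v, hv, hu, -⟩ := x.exists_vec
  obtain ⟨a, b, hab⟩ := (isUnimodular_iff _).1 (hu 0)
  let g : Matrix.SpecialLinearGroup (Fin 2) A :=
    ⟨!![v 0 0, -b; v 0 1, a], by rw [Matrix.det_fin_two_of]; linear_combination hab⟩
  refine ⟨QuotientGroup.mk g, ?_⟩
  rw [mk_smul]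
  refine Tuple.ext fun i ↦ ?_
  fin_cases i
  refine (line_eq_of_smul _ _ _ (v := ![1, 0]) (c := 1) isUnit_one rfl ?_).trans (hv 0).symm
  change Matrix.mulVec !![v 0 0, -b; v 0 1, a] _ = _
  ext i; fin_cases i <;> simp [Matrix.mulVec, dotProduct, Fin.sum_univ_two]

theorem exists_smul_pairIZ (x : Tuple A 1) : ∃ p : PSL A, p • pairIZ A = x := by
  obtain ⟨v, hv, -, hb⟩ := x.exists_vec
  obtain ⟨c, hc⟩ := (isBasisPair_iff _ _).1 (hb 0 1 (by simp))
  -- The second column is divided by the determinant `c`. This gives determinant `1` and does not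
  -- change the line.
  let g : Matrix.SpecialLinearGroup (Fin 2) A :=
    ⟨!![v 0 0, ((c⁻¹ : Aˣ) : A) * v 1 0; v 0 1, ((c⁻¹ : Aˣ) : A) * v 1 1], by
      rw [Matrix.det_fin_two_of]
      have := c.inv_mul
      rw [hc] at this
      linear_combination this⟩
  refine ⟨QuotientGroup.mk g, ?_⟩
  rw [mk_smul]
  refine Tuple.ext fun i ↦ ?_
  fin_cases i
  · refine (line_eq_of_smul _ _ _ (v := ![1, 0]) (c := 1) isUnit_one rfl ?_).trans (hv 0).symm
    change Matrix.mulVec !![v 0 0, ((c⁻¹ : Aˣ) : A) * v 1 0; v 0 1, ((c⁻¹ : Aˣ) : A) * v 1 1] _ = _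
    ext i; fin_cases i <;> simp [Matrix.mulVec, dotProduct, Fin.sum_univ_two]
  · refine (line_eq_of_smul _ _ _ (v := ![0, 1]) (c := ((c⁻¹ : Aˣ) : A)) c⁻¹.isUnit rfl ?_).trans
      (hv 1).symm
    change Matrix.mulVec !![v 0 0, ((c⁻¹ : Aˣ) : A) * v 1 0; v 0 1, ((c⁻¹ : Aˣ) : A) * v 1 1] _ = _
    ext i; fin_cases i <;> simp [Matrix.mulVec, dotProduct, Fin.sum_univ_two]

/-- If `g ⟨v⟩ = ⟨v⟩` then `g v` is a multiple of `v`. -/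
theorem exists_mulVec_eq_smul (g : Matrix.SpecialLinearGroup (Fin 2) A) {n : ℕ} (x : Tuple A n)
    (h : (QuotientGroup.mk g : PSL A) • x = x) (i : Fin (n + 1)) {v : Vec A}
    (hv : x.line i = Submodule.span A {v}) : ∃ c : A, g.1.mulVec v = c • v := by
  have h' : (Matrix.SpecialLinearGroup.toGL g • x).line i = x.line i :=
    congrArg (fun t : Tuple A n ↦ t.line i) h
  rw [Tuple.smul_line, hv, Submodule.map_span, Set.image_singleton, Matrix.mulVecLin_apply] at h'
  have : g.1.mulVec v ∈ Submodule.span A {v} := by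
    rw [← h']; exact Submodule.mem_span_singleton_self _
  obtain ⟨c, hc⟩ := Submodule.mem_span_singleton.1 this
  exact ⟨c, hc.symm⟩

theorem smul_ptInfty_iff (p : PSL A) : p • ptInfty A = ptInfty A ↔ p ∈ PB A := by
  constructor
  · induction p using QuotientGroup.induction_on with
    | H g =>
      intro h
      obtain ⟨c, hc⟩ := exists_mulVec_eq_smul g _ h 0 (v := ![1, 0]) rfl
      refine ⟨g, (?_ : g.1 1 0 = 0), rfl⟩
      have := congrFun hc 1
      simpa [Matrix.mulVec, dotProduct, Fin.sum_univ_two] using this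
  · rintro ⟨g, hg, rfl⟩
    have hg' : g.1 1 0 = 0 := hg
    have hdet := g.2
    rw [Matrix.det_fin_two, hg', mul_zero, sub_zero] at hdet
    refine (mk_smul g _).trans (Tuple.ext fun i ↦ ?_)
    fin_cases i
    refine line_eq_of_smul _ _ _ (v := ![1, 0]) (c := g.1 0 0) (.of_mul_eq_one _ hdet) rfl ?_
    change Matrix.mulVec g.1 _ = _
    ext i; fin_cases i <;> simp [Matrix.mulVec, dotProduct, Fin.sum_univ_two, hg']

theorem smul_pairIZ_iff (p : PSL A) : p • pairIZ A = pairIZ A ↔ p ∈ PT A := by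
  constructor
  · induction p using QuotientGroup.induction_on with
    | H g =>
      intro h
      obtain ⟨c, hc⟩ := exists_mulVec_eq_smul g _ h 0 (v := ![1, 0]) rfl
      obtain ⟨d, hd⟩ := exists_mulVec_eq_smul g _ h 1 (v := ![0, 1]) rfl
      refine ⟨g, ⟨?_, ?_⟩, rfl⟩
      · have := congrFun hd 0
        simpa [Matrix.mulVec, dotProduct, Fin.sum_univ_two] using this
      · have := congrFun hc 1
        simpa [Matrix.mulVec, dotProduct, Fin.sum_univ_two] using this
  · rintro ⟨g, ⟨h₁, h₂⟩, rfl⟩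
    obtain ⟨a, rfl⟩ : ∃ a, g = dSL a := by
      have h₁' : g.1 0 1 = 0 := h₁
      have h₂' : g.1 1 0 = 0 := h₂
      have hdet := g.2
      rw [Matrix.det_fin_two, h₁', zero_mul, sub_zero] at hdet
      refine ⟨⟨g.1 1 1, g.1 0 0, by rw [mul_comm, hdet], hdet⟩, Subtype.ext ?_⟩
      ext i j
      fin_cases i <;> fin_cases j <;> simp [dSL, h₁', h₂']
    change (QuotientGroup.mk (dSL a) : PSL A) • pairIZ A = pairIZ A
    rw [← inftyZero_face_two 1, ← Tuple.face_smul, dSL_smul_inftyZero, inftyZero_face_two,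
      inftyZero_face_two]

theorem mSL_smul_pairIZ (a : Aˣ) :
    (QuotientGroup.mk (mSL a) : PSL A) • pairIZ A = pairZI A := by
  rw [← inftyZero_face_two 1, ← Tuple.face_smul, mSL_smul_inftyZero, zeroInfty_face_two]

theorem mSL_smul_pairZI (a : Aˣ) :
    (QuotientGroup.mk (mSL a) : PSL A) • pairZI A = pairIZ A := by
  rw [← zeroInfty_face_two 1, ← Tuple.face_smul, mSL_smul_zeroInfty, inftyZero_face_two]

theorem dSL_smul_pairIZ (a : Aˣ) :
    (QuotientGroup.mk (dSL a) : PSL A) • pairIZ A = pairIZ A :=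
  (smul_pairIZ_iff _).2 (dSL_mem_PT a)

theorem dSL_smul_pairZI (a : Aˣ) :
    (QuotientGroup.mk (dSL a) : PSL A) • pairZI A = pairZI A := by
  rw [← zeroInfty_face_two 1, ← Tuple.face_smul, dSL_smul_zeroInfty, zeroInfty_face_two,
    zeroInfty_face_two]

/-- `PSL₂(A)` acts freely on the triples of lines. -/
theorem eq_one_of_smul_eq (p : PSL A) (x : Tuple A 2) (h : p • x = x) : p = 1 := by
  -- By transitivity on pairs, the first two lines may be taken to be `∞` and `0`, which forces a
  -- diagonal matrix.
  obtain ⟨q, hq⟩ := exists_smul_pairIZ (x.face 2)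
  suffices h₁ : q⁻¹ * p * q = 1 by
    rw [mul_eq_one_iff_eq_inv, inv_mul_eq_iff_eq_mul, mul_inv_cancel] at h₁
    exact h₁
  set y := q⁻¹ • x with hy
  have hyf : y.face 2 = pairIZ A := by rw [hy, Tuple.face_smul, ← hq, inv_smul_smul]
  have hp : (q⁻¹ * p * q) • y = y := by rw [hy, mul_smul, smul_inv_smul, mul_smul, h]
  generalize q⁻¹ * p * q = r at hp
  induction r using QuotientGroup.induction_on with
  | H g =>
    have l₀ : y.line 0 = Submodule.span A {![1, 0]} :=
      congrArg (fun t : Tuple A 1 ↦ t.line 0) hyf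
    have l₁ : y.line 1 = Submodule.span A {![0, 1]} :=
      congrArg (fun t : Tuple A 1 ↦ t.line 1) hyf
    obtain ⟨v, hv, -, hb⟩ := y.exists_vec
    obtain ⟨c, hc⟩ := exists_mulVec_eq_smul g _ hp 0 l₀
    obtain ⟨d, hd⟩ := exists_mulVec_eq_smul g _ hp 1 l₁
    obtain ⟨e, he⟩ := exists_mulVec_eq_smul g _ hp 2 (hv 2)
    have hu : ∀ i : Fin 3, i ≠ 2 → IsUnit (v i 0 * v 2 1 - v i 1 * v 2 0) := fun i hi ↦
      (isBasisPair_iff _ _).1 (hb i 2 hi)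
    have hu₀ : IsUnit (v 2 1) := by
      have h₀ : v 0 ∈ Submodule.span A {![1, 0]} := by
        rw [← l₀, hv 0]; exact Submodule.mem_span_singleton_self _
      obtain ⟨s, hs⟩ := Submodule.mem_span_singleton.1 h₀
      have := hu 0 (by simp)
      rw [← hs] at this
      simp at this
      exact this.2
    have hu₁ : IsUnit (v 2 0) := by
      have h₀ : v 1 ∈ Submodule.span A {![0, 1]} := by
        rw [← l₁, hv 1]; exact Submodule.mem_span_singleton_self _
      obtain ⟨s, hs⟩ := Submodule.mem_span_singleton.1 h₀
      have := hu 1 (by simp)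
      rw [← hs] at this
      simp at this
      exact this.2
    have c₀ : g.1 1 0 = 0 := by
      simpa [Matrix.mulVec, dotProduct, Fin.sum_univ_two] using congrFun hc 1
    have d₀ : g.1 0 1 = 0 := by
      simpa [Matrix.mulVec, dotProduct, Fin.sum_univ_two] using congrFun hd 0
    -- The third line forms a basis with each of `∞` and `0`, so both its coordinates are units.
    -- Being an eigenline, it forces the diagonal entries to agree.
    refine mk_eq_one_of_scalar d₀ c₀ ?_
    have e₀ : g.1 0 0 * v 2 0 = e * v 2 0 := by
      simpa [Matrix.mulVec, dotProduct, Fin.sum_univ_two, d₀] using congrFun he 0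
    have e₁ : g.1 1 1 * v 2 1 = e * v 2 1 := by
      simpa [Matrix.mulVec, dotProduct, Fin.sum_univ_two, c₀] using congrFun he 1
    rw [hu₁.mul_left_injective e₀, hu₀.mul_left_injective e₁]

end Geometry


/-! ### Homology classes through explicit inhomogeneous cycles -/

section Chains

variable {G G' : Type u} [Group G] [Group G']

/-- `f` is a cycle representing the homology class `x`. -/
def Represents {M : Rep.{u} ZZ.{u} G} {n : ℕ} (f : (Fin n → G) →₀ M) (x : H n M) : Prop :=
  ∃ w : groupHomology.cycles M n,
    (groupHomology.iCycles M n).hom w = f ∧ (groupHomology.π M n).hom w = x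

theorem exists_represents {M : Rep.{u} ZZ.{u} G} {n : ℕ} (x : H n M) :
    ∃ f, Represents f x := by
  obtain ⟨w, rfl⟩ := (ModuleCat.epi_iff_surjective (groupHomology.π M n)).1
    (inferInstanceAs (Epi (HomologicalComplex.homologyπ _ _))) x
  exact ⟨_, w, rfl, rfl⟩

theorem Represents.unique {M : Rep.{u} ZZ.{u} G} {n : ℕ} {f : (Fin n → G) →₀ M} {x y : H n M}
    (hx : Represents f x) (hy : Represents f y) : x = y := by
  obtain ⟨w, hw, rfl⟩ := hx
  obtain ⟨w', hw', rfl⟩ := hy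
  rw [(ModuleCat.mono_iff_injective (groupHomology.iCycles M n)).1
    (inferInstanceAs (Mono (HomologicalComplex.iCycles _ _))) (hw.trans hw'.symm)]

theorem Represents.exists_of_d_eq_zero {M : Rep.{u} ZZ.{u} G} {n : ℕ}
    {f : (Fin (n + 1) → G) →₀ M}
    (hf : (groupHomology.inhomogeneousChains.d M n).hom f = 0) :
    ∃ x : H (n + 1) M, Represents f x := by
  have hf' : (groupHomology.inhomogeneousChains M).d (n + 1) n f = 0 := by
    rw [groupHomology.inhomogeneousChains.d_def]; exact hf
  exact ⟨_, groupHomology.cyclesMk (n + 1) n (by simp) f hf',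
    groupHomology.iCycles_mk (by simp) f hf', rfl⟩

theorem Represents.map {M : Rep.{u} ZZ.{u} G} {N : Rep.{u} ZZ.{u} G'} (φ : G →* G')
    (τ : M ⟶ Rep.res φ N) {n : ℕ} {f : (Fin n → G) →₀ M} {x : H n M} (h : Represents f x) :
    Represents (((groupHomology.chainsMap φ τ).f n).hom f) ((groupHomology.map φ τ n).hom x) := by
  obtain ⟨w, rfl, rfl⟩ := h
  exact ⟨(groupHomology.cyclesMap φ τ n).hom w,
    congrArg (fun F ↦ F.hom w) (HomologicalComplex.cyclesMap_i (groupHomology.chainsMap φ τ) n),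
    (congrArg (fun F ↦ F.hom w)
      (HomologicalComplex.homologyπ_naturality (groupHomology.chainsMap φ τ) n)).symm⟩

/-- The snake recipe on chains: lift to the middle term, differentiate, pull back to the sub. -/
theorem Represents.δ {S : ShortComplex (Rep.{u} ZZ.{u} G)} (hS : S.ShortExact) {n : ℕ}
    {z : (Fin (n + 1) → G) →₀ S.X₃} {c : H (n + 1) S.X₃} (hz : Represents z c)
    (y : (Fin (n + 1) → G) →₀ S.X₂)
    (hy : ((groupHomology.chainsMap (MonoidHom.id G) S.g).f (n + 1)).hom y = z)
    (x : (Fin n → G) →₀ S.X₁)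
    (hx : ((groupHomology.chainsMap (MonoidHom.id G) S.f).f n).hom x =
      (groupHomology.inhomogeneousChains.d S.X₂ n).hom y) :
    Represents x (Hδ n hS c) := by
  obtain ⟨w, hw, rfl⟩ := hz
  have hz' : (groupHomology.inhomogeneousChains S.X₃).d (n + 1) n z = 0 := by
    rw [← hw]
    exact congrArg (fun F ↦ F.hom w)
      ((groupHomology.inhomogeneousChains S.X₃).iCycles_d (n + 1) n)
  have e : w = groupHomology.cyclesMk (n + 1) n (by simp) z hz' := by
    refine (ModuleCat.mono_iff_injective (groupHomology.iCycles _ _)).1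
      (inferInstanceAs (Mono (HomologicalComplex.iCycles _ _))) (hw.trans ?_)
    exact (groupHomology.iCycles_mk (by simp) z hz').symm
  have hx' : Finsupp.mapRange.linearMap S.f.hom.toLinearMap x =
      (groupHomology.inhomogeneousChains S.X₂).d (n + 1) n y := by
    rw [← groupHomology.chainsMap_id_f_hom_eq_mapRange, groupHomology.inhomogeneousChains.d_def]
    exact hx
  refine ⟨groupHomology.cyclesMkOfCompEqD hS hx', groupHomology.iCycles_mk rfl x _, ?_⟩
  rw [e]
  exact (groupHomology.δ_apply hS (i := n + 1) (j := n) rfl z hz' y hy x hx').symm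

theorem represents_H0π (M : Rep.{u} ZZ.{u} G) (v : M) :
    Represents (Finsupp.single (![] : Fin 0 → G) v) ((groupHomology.H0π M).hom v) := by
  refine ⟨(groupHomology.cyclesIso₀ M).inv.hom v, ?_, rfl⟩
  have := congrArg (fun F ↦ F.hom v) (groupHomology.cyclesIso₀_inv_comp_iCycles M)
  refine this.trans ?_
  refine (LinearEquiv.symm_apply_eq
    (Finsupp.uniqueLinearEquiv ZZ.{u} M (default : Fin 0 → G))).2 ?_
  rw [Subsingleton.elim (![] : Fin 0 → G) default]
  exact (Finsupp.single_eq_same).symm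

variable (M : Rep.{u} ZZ.{u} G)

theorem d_single_one (a : G) (v : M) :
    (groupHomology.inhomogeneousChains.d M 0).hom (Finsupp.single ![a] v) =
      Finsupp.single ![] (M.ρ a⁻¹ v) - Finsupp.single ![] v := by
  refine (groupHomology.inhomogeneousChains.d_single 0 ![a] v).trans ?_
  rw [Fin.sum_univ_one]
  simp [Subsingleton.elim _ (![] : Fin 0 → G), sub_eq_add_neg]

theorem contractNth_two_zero (a b : G) : Fin.contractNth 0 (· * ·) ![a, b] = ![a * b] := by
  funext i; fin_cases i; rfl

theorem contractNth_two_one (a b : G) : Fin.contractNth 1 (· * ·) ![a, b] = ![a] := by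
  funext i; fin_cases i; rfl

theorem contractNth_three_zero (a b c : G) :
    Fin.contractNth 0 (· * ·) ![a, b, c] = ![a * b, c] := by
  funext i; fin_cases i <;> rfl

theorem contractNth_three_one (a b c : G) :
    Fin.contractNth 1 (· * ·) ![a, b, c] = ![a, b * c] := by
  funext i; fin_cases i <;> rfl

theorem contractNth_three_two (a b c : G) :
    Fin.contractNth 2 (· * ·) ![a, b, c] = ![a, b] := by
  funext i; fin_cases i <;> rfl

theorem d_single_two (a b : G) (v : M) :
    (groupHomology.inhomogeneousChains.d M 1).hom (Finsupp.single ![a, b] v) =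
      Finsupp.single ![b] (M.ρ a⁻¹ v) - Finsupp.single ![a * b] v + Finsupp.single ![a] v := by
  refine (groupHomology.inhomogeneousChains.d_single 1 ![a, b] v).trans ?_
  rw [Fin.sum_univ_two, contractNth_two_zero, contractNth_two_one]
  have : (fun i : Fin 1 ↦ ![a, b] i.succ) = ![b] := by funext i; fin_cases i; rfl
  rw [this]
  simp
  abel

theorem d_single_three (a b c : G) (v : M) :
    (groupHomology.inhomogeneousChains.d M 2).hom (Finsupp.single ![a, b, c] v) =
      Finsupp.single ![b, c] (M.ρ a⁻¹ v) - Finsupp.single ![a * b, c] v +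
        Finsupp.single ![a, b * c] v - Finsupp.single ![a, b] v := by
  refine (groupHomology.inhomogeneousChains.d_single 2 ![a, b, c] v).trans ?_
  rw [Fin.sum_univ_three, contractNth_three_zero, contractNth_three_one, contractNth_three_two]
  have : (fun i : Fin 2 ↦ ![a, b, c] i.succ) = ![b, c] := by funext i; fin_cases i <;> rfl
  rw [this]
  have h3 : (-1 : ZZ.{u}) ^ 3 = -1 := by ring
  have h2 : (-1 : ZZ.{u}) ^ 2 = 1 := by ring
  simp [h3]
  abel

end Chains


/-! ### Explicit chains attached to an involution -/

section Involution

variable {G G' : Type u} [Group G] [Group G']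

/-- A `3`-chain built on an involution `p`, with coefficient `v`. -/
def involThree (p : G) {V : Type u} [AddCommMonoid V] (v : V) : (Fin 3 → G) →₀ V :=
  Finsupp.single ![p, p, p] v + Finsupp.single ![1, 1, p] v + Finsupp.single ![p, 1, 1] v

/-- A `2`-chain built on an involution `p`, with coefficient `v`. -/
def involTwo (p : G) {V : Type u} [AddCommMonoid V] (v : V) : (Fin 2 → G) →₀ V :=
  Finsupp.single ![p, p] v + Finsupp.single ![1, 1] v

/-- The bar complex is not normalized: `[p, p, p]` leaves the terms `[1, p]` and `[p, 1]` because
`p² = 1`. The two degenerate summands of `involThree` remove them, at the cost of the `[1, 1]` term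
in `involTwo`. -/
theorem d_involThree (M : Rep.{u} ZZ.{u} G) {p : G} (hp : p * p = 1) (v : M) :
    (groupHomology.inhomogeneousChains.d M 2).hom (involThree p v) =
      involTwo p (M.ρ p v - v) := by
  have hp' : p⁻¹ = p := inv_eq_of_mul_eq_one_left hp
  refine (map_add _ _ _).trans ((congrArg (· + _) (map_add _ _ _)).trans ?_)
  rw [d_single_three, d_single_three, d_single_three, hp', hp]
  simp only [involTwo, inv_one, map_one, Module.End.one_apply, mul_one, one_mul,
    Finsupp.single_sub]
  abel

/-- With `d_involThree` this is the periodic resolution of the group of order two: `p - 1` and `p +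
1` alternate on coefficients. -/
theorem d_involTwo (M : Rep.{u} ZZ.{u} G) {p : G} (hp : p * p = 1) (v : M) :
    (groupHomology.inhomogeneousChains.d M 1).hom (involTwo p v) =
      Finsupp.single ![p] (M.ρ p v + v) := by
  have hp' : p⁻¹ = p := inv_eq_of_mul_eq_one_left hp
  refine (map_add _ _ _).trans ?_
  rw [d_single_two, d_single_two, hp', hp]
  simp only [inv_one, map_one, Module.End.one_apply, mul_one, Finsupp.single_add]
  abel

variable {M : Rep.{u} ZZ.{u} G} {N : Rep.{u} ZZ.{u} G'} (φ : G →* G') (τ : M ⟶ Rep.res φ N)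

theorem chainsMap_involThree (p : G) (v : M) :
    ((groupHomology.chainsMap φ τ).f 3).hom (involThree p v) =
      involThree (φ p) (τ.hom v : N) := by
  refine (map_add _ _ _).trans ((congrArg (· + _) (map_add _ _ _)).trans ?_)
  have h (x y z : G) : ((groupHomology.chainsMap φ τ).f 3).hom (Finsupp.single ![x, y, z] v) =
      Finsupp.single ![φ x, φ y, φ z] (τ.hom v : N) := by
    refine (groupHomology.chainsMap_f_single φ τ 3 _ v).trans (congrArg (Finsupp.single · _) ?_)
    funext i; fin_cases i <;> rfl
  rw [h, h, h, map_one]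
  rfl

theorem chainsMap_involTwo (p : G) (v : M) :
    ((groupHomology.chainsMap φ τ).f 2).hom (involTwo p v) =
      involTwo (φ p) (τ.hom v : N) := by
  refine (map_add _ _ _).trans ?_
  have h (x y : G) : ((groupHomology.chainsMap φ τ).f 2).hom (Finsupp.single ![x, y] v) =
      Finsupp.single ![φ x, φ y] (τ.hom v : N) := by
    refine (groupHomology.chainsMap_f_single φ τ 2 _ v).trans (congrArg (Finsupp.single · _) ?_)
    funext i; fin_cases i <;> rfl
  rw [h, h, map_one]
  rfl

theorem chainsMap_single_one (p : G) (v : M) :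
    ((groupHomology.chainsMap φ τ).f 1).hom (Finsupp.single ![p] v) =
      Finsupp.single ![φ p] (τ.hom v : N) := by
  refine (groupHomology.chainsMap_f_single φ τ 1 _ v).trans (congrArg (Finsupp.single · _) ?_)
  funext i; fin_cases i; rfl

theorem chainsMap_single_zero (v : M) :
    ((groupHomology.chainsMap φ τ).f 0).hom (Finsupp.single ![] v) =
      Finsupp.single ![] (τ.hom v : N) := by
  refine (groupHomology.chainsMap_f_single φ τ 0 _ v).trans (congrArg (Finsupp.single · _) ?_)
  funext i; exact i.elim0

end Involution

/-! ### The edge map on classes of involutions -/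

section Cycle

variable {A : Type u} [CommRing A]

theorem mSL_smul_ptInfty (a : Aˣ) :
    (QuotientGroup.mk (mSL a) : PSL A) • ptInfty A = ptZero A := by
  rw [← face_one_pairZI, ← mSL_smul_pairIZ a, Tuple.face_smul, ptInfty]

theorem mSL_smul_ptZero (a : Aˣ) :
    (QuotientGroup.mk (mSL a) : PSL A) • ptZero A = ptInfty A := by
  rw [← face_zero_pairZI, ← mSL_smul_pairIZ a, Tuple.face_smul, ptZero]

theorem bdLin_single_pairIZ (c : ZZ.{u}) : bdLin A 0 (Finsupp.single (pairIZ A) c) =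
    Finsupp.single (ptZero A) c - Finsupp.single (ptInfty A) c :=
  bdLin_zero_single A _ c

/-- The faces containing the third line occur in both triples with opposite signs. -/
theorem bdLin_psiChain_one : bdLin A 1 (psiChain (1 : Aˣ)) =
    Finsupp.single (pairIZ A) 1 + Finsupp.single (pairZI A) 1 := by
  have h₁ : (inftyZero (1 : Aˣ)).face 0 = (zeroInfty 1).face 1 :=
    triple_face 0 1 fun k ↦ by fin_cases k <;> simp [Fin.succAbove]
  have h₂ : (inftyZero (1 : Aˣ)).face 1 = (zeroInfty 1).face 0 :=
    triple_face 1 0 fun k ↦ by fin_cases k <;> simp [Fin.succAbove]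
  rw [psiChain, map_add, bdLin_one_single, bdLin_one_single, h₁, h₂, inftyZero_face_two,
    zeroInfty_face_two]
  abel

theorem XRho_single {n : ℕ} (p : PSL A) (x : Tuple A n) (c : ZZ.{u}) :
    XRho A n p (Finsupp.single x c) = Finsupp.single (p • x) c :=
  Finsupp.mapDomain_single

theorem aug_single (x : Tuple A 0) (c : ZZ.{u}) : (aug A).hom (Finsupp.single x c) = c :=
  Finsupp.lsum_single _ _ _ _

theorem Hδ_kerSeq_eq {G : Type u} [Group G] {M N : Rep.{u} ZZ.{u} G} (f : M ⟶ N)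
    {z : H 1 (imRep f)} {y : (Fin 1 → G) →₀ M}
    (hz : Represents (((groupHomology.chainsMap (MonoidHom.id G) (toIm f)).f 1).hom y) z)
    (v : kerRep f) (hv : Finsupp.single (![] : Fin 0 → G) ((kerIncl f).hom v) =
      (groupHomology.inhomogeneousChains.d M 0).hom y) :
    Hδ 0 (kerSeq_shortExact f) z = (groupHomology.H0π (kerRep f)).hom v := by
  have h := chainsMap_single_zero (N := M) (MonoidHom.id G) (kerIncl f) v
  have h₁ := hz.δ (kerSeq_shortExact f) y rfl (Finsupp.single ![] v) (h.trans hv)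
  exact h₁.unique (represents_H0π (kerRep f) v)

theorem delta2_eq {z : H 1 (Bd A 1)} {y : (Fin 1 → PSL A) →₀ X A 2}
    (hz : Represents (((groupHomology.chainsMap (MonoidHom.id (PSL A)) (toIm (bd A 1))).f 1).hom y) z)
    (v : Zsucc A 1)
    (hv : Finsupp.single (![] : Fin 0 → PSL A) ((kerIncl (bd A 1)).hom v) =
      (groupHomology.inhomogeneousChains.d (X A 2) 0).hom y) :
    delta2 A z = RPmk A v :=
  Hδ_kerSeq_eq (bd A 1) hz v hv

/-- For the involution `p` given by `mSL a`, the three connecting maps become a zigzag of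
coefficients: `p∞ - ∞ = ∂(∞,0)`, then `p(∞,0) + (∞,0) = ∂(psiChain 1)`, and finally `p(psiChain 1) -
psiChain 1 = psiChain (-a²) - psiChain 1`. -/
theorem psi1_neg_sq_mem_range (h : ExactBelowTwo A) (a : Aˣ) :
    ∃ x : H 3 (triv (PSM A)), edgeRP h (HmapZ (PSM A).subtype 3 x) = psi1 (-a ^ 2) := by
  set p : PSL A := QuotientGroup.mk (mSL a) with hpdef
  have hp : p * p = 1 := mSL_mul_self a
  have hp' : p⁻¹ = p := inv_eq_of_mul_eq_one_left hp
  let m : PSM A := ⟨p, mSL_mem a⟩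
  -- On trivial coefficients `p - 1` vanishes, so `involThree` is a cycle.
  obtain ⟨x, hx⟩ := Represents.exists_of_d_eq_zero (M := triv (PSM A)) (n := 2)
    (f := involThree m (1 : ZZ.{u})) (by
      refine (d_involThree (triv (PSM A)) (p := m) (Subtype.ext hp) (1 : ZZ.{u})).trans ?_
      change involTwo m ((1 : ZZ.{u}) - 1) = 0
      rw [sub_self]
      simp [involTwo])
  refine ⟨x, ?_⟩
  have hx₀ : Represents (M := triv (PSL A)) (involThree p (1 : ZZ.{u}))
      (HmapZ (PSM A).subtype 3 x) := by
    have := hx.map (N := triv (PSL A)) (PSM A).subtype (Rep.ofHom ⟨LinearMap.id, fun _ ↦ rfl⟩)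
    rw [chainsMap_involThree] at this
    exact this
  have hx₁ := hx₀.δ (cokerSeq_shortExact (bd A 0) (aug A) h.exact_zero h.surjective_aug)
    (involThree p (Finsupp.single (ptInfty A) 1)) (by
      refine (chainsMap_involThree _ _ _ _).trans ?_
      exact congrArg (involThree p) (aug_single _ _))
    (involTwo p ((toIm (bd A 0)).hom (Finsupp.single (pairIZ A) 1))) (by
      refine (chainsMap_involTwo _ _ _ _).trans
        (Eq.trans ?_ (d_involThree (X A 0) hp (Finsupp.single (ptInfty A) 1)).symm)
      refine congrArg (involTwo p) ((bdLin_single_pairIZ 1).trans ?_)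
      change _ = XRho A 0 p _ - _
      rw [XRho_single, mSL_smul_ptInfty])
  have hx₂ := hx₁.δ (imSeq_shortExact (bd A 1) (bd A 0) h.exact_one)
    (involTwo p (Finsupp.single (pairIZ A) 1)) (chainsMap_involTwo _ _ _ _)
    (Finsupp.single ![p] ((toIm (bd A 1)).hom (psiChain 1))) (by
      refine (chainsMap_single_one _ _ _ _).trans
        (Eq.trans ?_ (d_involTwo (X A 1) hp (Finsupp.single (pairIZ A) 1)).symm)
      refine congrArg (Finsupp.single ![p]) (bdLin_psiChain_one.trans ?_)
      change _ = XRho A 1 p _ + _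
      rw [XRho_single, mSL_smul_pairIZ, add_comm])
  refine delta2_eq (y := Finsupp.single ![p] (psiChain 1)) ?_
    ⟨psiChain (-a ^ 2) - psiChain 1, psiChain_sub_mem _ _⟩ ?_
  · rw [chainsMap_single_one]
    exact hx₂
  · rw [d_single_one, hp', ← Finsupp.single_sub]
    have e := mSL_smul_psiChain a (1 : Aˣ)
    rw [inv_one, mul_one] at e
    exact congrArg (fun c : XMod A 2 ↦ Finsupp.single (![] : Fin 0 → PSL A) (c - psiChain 1))
      e.symm

theorem psiSubmodule_le_range (h : ExactBelowTwo A) : psiSubmodule A ≤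
    LinearMap.range (edgeRP h ∘ₗ HmapZ (PSM A).subtype 3) := by
  refine Submodule.span_le.2 ?_
  rintro _ ⟨g, rfl⟩
  obtain ⟨a, rfl⟩ := QuotientGroup.mk_surjective g
  obtain ⟨x, hx⟩ := psi1_neg_sq_mem_range h a
  exact ⟨x, hx.trans (sqRP_psi1_neg_one a).symm⟩

/-- Every element is an edge image, and edge images lie in `RB A`. -/
theorem psiSubmodule_le_RB (h : ExactBelowTwo A) : psiSubmodule A ≤ RB A := fun x hx ↦ by
  obtain ⟨y, rfl⟩ := psiSubmodule_le_range h hx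
  exact edgeRP_mem h _

end Cycle


/-! ### Maps of permutation modules, images and kernels over a change of group -/

section PermutationModules

variable {G G' S S' : Type u} [Group G] [Group G'] [MulAction G S] [MulAction G' S']

/-- The permutation module `ℤ[S]`. -/
abbrev perm (G S : Type u) [Group G] [MulAction G S] : Rep.{u} ZZ.{u} G :=
  Rep.of (permRho ZZ.{u} G S)

/-- The map of permutation modules induced by an equivariant map. -/
def permMap (φ : G →* G') (f : S → S') (h : ∀ g s, f (g • s) = φ g • f s) :
    perm G S ⟶ Rep.res φ (perm G' S') :=
  Rep.ofHom ⟨Finsupp.lmapDomain _ _ f, fun g ↦ Finsupp.lhom_ext fun s c ↦ by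
    refine (congrArg (Finsupp.mapDomain f) (permRho_single g s c)).trans ?_
    refine Eq.trans ?_ (congrArg (permRho ZZ.{u} G' S' (φ g)) Finsupp.mapDomain_single).symm
    rw [Finsupp.mapDomain_single, permRho_single, h]⟩

/-- The map from the trivial module to a permutation module given by a fixed point. -/
def permPoint (φ : G →* G') (s₀ : S') (h : ∀ g, φ g • s₀ = s₀) :
    triv G ⟶ Rep.res φ (perm G' S') :=
  Rep.ofHom ⟨Finsupp.lsingle s₀, fun g ↦ LinearMap.ext fun c ↦ by
    refine Eq.trans ?_ (permRho_single (φ g) s₀ c).symm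
    rw [h]
    rfl⟩

/-- The map between the images of two maps of modules. -/
def imMap (φ : G →* G') {M N : Rep.{u} ZZ.{u} G} {M' N' : Rep.{u} ZZ.{u} G'} (f : M ⟶ N)
    (f' : M' ⟶ N') (a : M ⟶ Rep.res φ M') (b : N ⟶ Rep.res φ N')
    (h : ∀ x, b.hom (f.hom x) = f'.hom (a.hom x)) : imRep f ⟶ Rep.res φ (imRep f') :=
  Rep.ofHom ⟨b.hom.toLinearMap.restrict (p := LinearMap.range f.hom.toLinearMap)
      (q := LinearMap.range f'.hom.toLinearMap) (by
        rintro _ ⟨x, rfl⟩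
        exact ⟨a.hom x, (h x).symm⟩), fun g ↦ LinearMap.ext fun x ↦
    Subtype.ext (Rep.hom_comm_apply b g x.1)⟩

/-- The map from a kernel to an image. -/
def kerMap (φ : G →* G') {M N : Rep.{u} ZZ.{u} G} {L' M' N' : Rep.{u} ZZ.{u} G'} (f : M ⟶ N)
    (e' : L' ⟶ M') (f' : M' ⟶ N') (he : Function.Exact e'.hom f'.hom) (a : M ⟶ Rep.res φ M')
    (b : N ⟶ Rep.res φ N') (h : ∀ x, b.hom (f.hom x) = f'.hom (a.hom x)) :
    kerRep f ⟶ Rep.res φ (imRep e') :=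
  Rep.ofHom ⟨a.hom.toLinearMap.restrict (p := LinearMap.ker f.hom.toLinearMap)
      (q := LinearMap.range e'.hom.toLinearMap) (by
        intro x hx
        refine (he (a.hom x)).1 ((h x).symm.trans ?_)
        have hx' : f.hom x = 0 := hx
        rw [hx', map_zero]), fun g ↦ LinearMap.ext fun x ↦
    Subtype.ext (Rep.hom_comm_apply a g x.1)⟩

end PermutationModules

/-! ### The two-point subcomplex for `PSM₂(A)` -/

section Monomial

variable (A : Type u) [CommRing A]

/-- The points `∞` and `0`. -/
@[ext]
structure Y0 : Type u where
  /-- the underlying point -/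
  val : Tuple A 0
  property : val = ptInfty A ∨ val = ptZero A

/-- The pairs `(∞, 0)` and `(0, ∞)`. -/
@[ext]
structure Y1 : Type u where
  /-- the underlying pair -/
  val : Tuple A 1
  property : val = pairIZ A ∨ val = pairZI A

variable {A}

theorem dSL_smul_ptInfty (a : Aˣ) :
    (QuotientGroup.mk (dSL a) : PSL A) • ptInfty A = ptInfty A := by
  rw [ptInfty, ← Tuple.face_smul, dSL_smul_pairIZ]

theorem dSL_smul_ptZero (a : Aˣ) :
    (QuotientGroup.mk (dSL a) : PSL A) • ptZero A = ptZero A := by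
  rw [ptZero, ← Tuple.face_smul, dSL_smul_pairIZ]

theorem smul_mem_Y0 (p : PSM A) (x : Y0 A) :
    p.1 • x.val = ptInfty A ∨ p.1 • x.val = ptZero A := by
  obtain ⟨a, hp | hp⟩ := PSM_cases p.2 <;> rw [hp] <;> rcases x.property with hx | hx <;> rw [hx]
  exacts [Or.inl (dSL_smul_ptInfty a), Or.inr (dSL_smul_ptZero a), Or.inr (mSL_smul_ptInfty a),
    Or.inl (mSL_smul_ptZero a)]

theorem smul_mem_Y1 (p : PSM A) (x : Y1 A) :
    p.1 • x.val = pairIZ A ∨ p.1 • x.val = pairZI A := by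
  obtain ⟨a, hp | hp⟩ := PSM_cases p.2 <;> rw [hp] <;> rcases x.property with hx | hx <;> rw [hx]
  exacts [Or.inl (dSL_smul_pairIZ a), Or.inr (dSL_smul_pairZI a), Or.inr (mSL_smul_pairIZ a),
    Or.inl (mSL_smul_pairZI a)]

instance : MulAction (PSM A) (Y0 A) where
  smul p x := ⟨p.1 • x.val, smul_mem_Y0 p x⟩
  one_smul x := Y0.ext (one_smul (PSL A) x.val)
  mul_smul p q x := Y0.ext (mul_smul p.1 q.1 x.val)

instance : MulAction (PSM A) (Y1 A) where
  smul p x := ⟨p.1 • x.val, smul_mem_Y1 p x⟩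
  one_smul x := Y1.ext (one_smul (PSL A) x.val)
  mul_smul p q x := Y1.ext (mul_smul p.1 q.1 x.val)

variable (A)

/-- The point `∞`. -/
def Y0.infty : Y0 A := ⟨ptInfty A, Or.inl rfl⟩

/-- The point `0`. -/
def Y0.zero : Y0 A := ⟨ptZero A, Or.inr rfl⟩

/-- The pair `(∞, 0)`. -/
def Y1.iz : Y1 A := ⟨pairIZ A, Or.inl rfl⟩

/-- The pair `(0, ∞)`. -/
def Y1.zi : Y1 A := ⟨pairZI A, Or.inr rfl⟩

variable {A}

theorem Y0.eq_or (x : Y0 A) : x = Y0.infty A ∨ x = Y0.zero A :=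
  x.property.imp (fun h ↦ Y0.ext h) fun h ↦ Y0.ext h

theorem Y1.eq_or (x : Y1 A) : x = Y1.iz A ∨ x = Y1.zi A :=
  x.property.imp (fun h ↦ Y1.ext h) fun h ↦ Y1.ext h

/-- The first face of a pair. -/
def Y1.faceZero (x : Y1 A) : Y0 A := ⟨x.val.face 0, by
  rcases x.property with hx | hx <;> rw [hx]
  exacts [Or.inr rfl, Or.inl face_zero_pairZI]⟩

/-- The second face of a pair. -/
def Y1.faceOne (x : Y1 A) : Y0 A := ⟨x.val.face 1, by
  rcases x.property with hx | hx <;> rw [hx]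
  exacts [Or.inl rfl, Or.inr face_one_pairZI]⟩

theorem Y1.faceZero_smul (p : PSM A) (x : Y1 A) : (p • x).faceZero = p • x.faceZero :=
  Y0.ext (Tuple.face_smul 0 p.1 x.val)

theorem Y1.faceOne_smul (p : PSM A) (x : Y1 A) : (p • x).faceOne = p • x.faceOne :=
  Y0.ext (Tuple.face_smul 1 p.1 x.val)

variable (A)

/-- The differential `ℤ[{(∞, 0), (0, ∞)}] → ℤ[{∞, 0}]`. -/
def bdY : perm (PSM A) (Y1 A) ⟶ perm (PSM A) (Y0 A) :=
  Rep.ofHom ⟨Finsupp.lmapDomain _ _ Y1.faceZero -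
      Finsupp.lmapDomain _ _ Y1.faceOne,
    fun g ↦ Finsupp.lhom_ext fun x c ↦ by
      simp only [LinearMap.comp_apply, permRho_single, LinearMap.sub_apply, map_sub,
        Finsupp.lmapDomain_apply, Finsupp.mapDomain_single]
      rw [Y1.faceZero_smul, Y1.faceOne_smul]⟩

/-- The augmentation `ℤ[{∞, 0}] → ℤ`. -/
def augY : perm (PSM A) (Y0 A) ⟶ triv (PSM A) :=
  Rep.ofHom ⟨Finsupp.lsum ZZ.{u} fun _ ↦ LinearMap.id, fun g ↦ by
    refine Finsupp.lhom_ext fun x c ↦ ?_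
    simp [permRho_single]⟩

variable {A}

theorem augY_single (x : Y0 A) (c : ZZ.{u}) : (augY A).hom (Finsupp.single x c) = c :=
  Finsupp.lsum_single _ _ _ _

theorem bdY_single (x : Y1 A) (c : ZZ.{u}) : (bdY A).hom (Finsupp.single x c) =
    Finsupp.single x.faceZero c -
      Finsupp.single x.faceOne c := by
  refine (LinearMap.sub_apply _ _ _).trans ?_
  rw [Finsupp.lmapDomain_apply, Finsupp.lmapDomain_apply, Finsupp.mapDomain_single,
    Finsupp.mapDomain_single]

theorem bdY_single_iz (c : ZZ.{u}) : (bdY A).hom (Finsupp.single (Y1.iz A) c) =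
    Finsupp.single (Y0.zero A) c - Finsupp.single (Y0.infty A) c :=
  bdY_single _ c

theorem bdY_single_zi (c : ZZ.{u}) : (bdY A).hom (Finsupp.single (Y1.zi A) c) =
    Finsupp.single (Y0.infty A) c - Finsupp.single (Y0.zero A) c := by
  rw [bdY_single]
  have h₀ : (Y1.zi A).faceZero = Y0.infty A :=
    Y0.ext face_zero_pairZI
  have h₁ : (Y1.zi A).faceOne = Y0.zero A :=
    Y0.ext face_one_pairZI
  rw [h₀, h₁]

theorem augY_surjective : Function.Surjective (augY A).hom := fun c ↦
  ⟨Finsupp.single (Y0.infty A) c, augY_single _ c⟩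

theorem bdY_exact : Function.Exact (bdY A).hom (augY A).hom := by
  intro y
  constructor
  · intro hy
    -- Modulo boundaries every chain can be concentrated at `∞`, where the augmentation is its only
    -- coefficient.
    have h : ∀ y : Y0 A →₀ ZZ.{u}, ∃ x, (bdY A).hom x =
        y - Finsupp.single (Y0.infty A) ((augY A).hom y) := by
      intro y
      induction y using Finsupp.induction_linear with
      | zero => exact ⟨0, by
          refine (map_zero (bdY A).hom).trans ?_
          rw [map_zero, Finsupp.single_zero, sub_zero]⟩
      | add y y' h h' =>
        obtain ⟨x, hx⟩ := h
        obtain ⟨x', hx'⟩ := h'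
        refine ⟨x + x', (map_add (bdY A).hom x x').trans ?_⟩
        rw [hx, hx', map_add, Finsupp.single_add]
        abel
      | single s c =>
        rw [augY_single]
        rcases s.eq_or with rfl | rfl
        · exact ⟨0, (map_zero (bdY A).hom).trans (sub_self _).symm⟩
        · exact ⟨_, bdY_single_iz c⟩
    obtain ⟨x, hx⟩ := h y
    exact ⟨x, by rw [hx, hy, Finsupp.single_zero, sub_zero]⟩
  · rintro ⟨x, rfl⟩
    induction x using Finsupp.induction_linear with
    | zero => exact (congrArg (augY A).hom (map_zero (bdY A).hom)).trans (map_zero _)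
    | add x x' h h' =>
      refine (congrArg (augY A).hom (map_add (bdY A).hom x x')).trans ((map_add _ _ _).trans ?_)
      rw [h, h', add_zero]
    | single s c => rw [bdY_single, map_sub, augY_single, augY_single, sub_self]

/-- The inclusion `ℤ[{∞, 0}] → X_0(A²)`. -/
def inclY0 : perm (PSM A) (Y0 A) ⟶ Rep.res (PSM A).subtype (X A 0) :=
  permMap (G' := PSL A) (S' := Tuple A 0) (PSM A).subtype (fun x ↦ x.val) fun _ _ ↦ rfl

/-- The inclusion `ℤ[{(∞, 0), (0, ∞)}] → X_1(A²)`. -/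
def inclY1 : perm (PSM A) (Y1 A) ⟶ Rep.res (PSM A).subtype (X A 1) :=
  permMap (G' := PSL A) (S' := Tuple A 1) (PSM A).subtype (fun x ↦ x.val) fun _ _ ↦ rfl

theorem inclY0_single (x : Y0 A) (c : ZZ.{u}) :
    (inclY0 (A := A)).hom (Finsupp.single x c) = Finsupp.single x.val c :=
  Finsupp.mapDomain_single

theorem inclY1_single (x : Y1 A) (c : ZZ.{u}) :
    (inclY1 (A := A)).hom (Finsupp.single x c) = Finsupp.single x.val c :=
  Finsupp.mapDomain_single

theorem inclY0_bdY (x : Y1 A →₀ ZZ.{u}) :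
    (inclY0 (A := A)).hom ((bdY A).hom x) = bdLin A 0 ((inclY1 (A := A)).hom x) := by
  induction x using Finsupp.induction_linear with
  | zero => exact (congrArg (inclY0 (A := A)).hom (map_zero (bdY A).hom)).trans ((map_zero _).trans
      ((congrArg (bdLin A 0) (map_zero (inclY1 (A := A)).hom)).trans (map_zero _)).symm)
  | add x x' h h' =>
    refine (congrArg (inclY0 (A := A)).hom (map_add (bdY A).hom x x')).trans ((map_add _ _ _).trans ?_)
    rw [h, h']
    exact ((congrArg (bdLin A 0) (map_add (inclY1 (A := A)).hom x x')).trans (map_add _ _ _)).symm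
  | single s c =>
    refine ((congrArg _ (bdY_single s c)).trans ((map_sub _ _ _).trans ?_)).trans
      ((congrArg (bdLin A 0) (inclY1_single s c)).trans (bdLin_zero_single A s.val c)).symm
    rw [inclY0_single, inclY0_single]
    rfl

theorem aug_inclY0 (x : Y0 A →₀ ZZ.{u}) :
    (aug A).hom ((inclY0 (A := A)).hom x) = (augY A).hom x := by
  induction x using Finsupp.induction_linear with
  | zero => 
    exact (congrArg (aug A).hom (map_zero (inclY0 (A := A)).hom)).trans
      ((map_zero _).trans (map_zero (augY A).hom).symm)
  | add x x' h h' =>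
    refine (congrArg (aug A).hom (map_add (inclY0 (A := A)).hom x x')).trans ((map_add _ _ _).trans ?_)
    rw [h, h']
    exact (map_add (augY A).hom x x').symm
  | single s c =>
    exact (congrArg (aug A).hom (inclY0_single s c)).trans
      ((aug_single _ _).trans (augY_single s c).symm)

variable (A) in
/-- The map from the image of `bdY` to `B_0(A²)`. -/
def imInclY : imRep (bdY A) ⟶ Rep.res (PSM A).subtype (Bd A 0) :=
  imMap (PSM A).subtype (bdY A) (bd A 0) inclY1 inclY0 inclY0_bdY

/-- The map from the kernel of `bdY` to `B_1(A²)`. -/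
def kerInclY (h : ExactBelowTwo A) : kerRep (bdY A) ⟶ Rep.res (PSM A).subtype (Bd A 1) :=
  kerMap (PSM A).subtype (bdY A) (bd A 1) (bd A 0) h.exact_one inclY1 inclY0 inclY0_bdY

/-- Naturality lets the first two connecting maps be taken in the two-point complex, before passing
to `PSL₂(A)`. Only the last one, `delta2`, still has to be computed. -/
theorem edgeRP_HmapZ (h : ExactBelowTwo A) (x : H 3 (triv (PSM A))) :
    edgeRP h (HmapZ (PSM A).subtype 3 x) = delta2 A
      ((groupHomology.map (PSM A).subtype (kerInclY h) 1).hom (Hδ 1 (kerSeq_shortExact (bdY A))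
        (Hδ 2 (cokerSeq_shortExact (bdY A) (augY A) bdY_exact augY_surjective) x))) := by
  have h₀ := Hδ_naturality (PSM A).subtype
    (cokerSeq_shortExact (bdY A) (augY A) bdY_exact augY_surjective)
    (cokerSeq_shortExact (bd A 0) (aug A) h.exact_zero h.surjective_aug)
    (imInclY A) inclY0 (Rep.ofHom ⟨LinearMap.id, fun _ ↦ rfl⟩)
    (fun _ ↦ rfl) (fun x ↦ (aug_inclY0 x).symm) 2 x
  have h₁ := Hδ_naturality (PSM A).subtype (kerSeq_shortExact (bdY A))
    (imSeq_shortExact (bd A 1) (bd A 0) h.exact_one)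
    (kerInclY h) inclY1 (imInclY A) (fun _ ↦ rfl) (fun x ↦ Subtype.ext (inclY0_bdY x)) 1
    (Hδ 2 (cokerSeq_shortExact (bdY A) (augY A) bdY_exact augY_surjective) x)
  rw [← h₁, ← h₀]
  rfl

end Monomial


/-! ### The edge image of `H_3(PSM₂(A), ℤ)` -/

section Image

variable {A : Type u} [CommRing A]

theorem ptInfty_ne_ptZero [Nontrivial A] : ptInfty A ≠ ptZero A := by
  intro h
  have h' : Submodule.span A {(![1, 0] : Vec A)} = Submodule.span A {![0, 1]} :=
    congrFun (congrArg Tuple.line h) 0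
  have hm : (![1, 0] : Vec A) ∈ Submodule.span A {(![0, 1] : Vec A)} :=
    h' ▸ Submodule.mem_span_singleton_self _
  obtain ⟨c, hc⟩ := Submodule.mem_span_singleton.1 hm
  simpa using congrFun hc 0

theorem Y0.zero_ne_infty [Nontrivial A] : Y0.zero A ≠ Y0.infty A := fun h ↦
  ptInfty_ne_ptZero (congrArg Y0.val h).symm

theorem Y1.iz_ne_zi [Nontrivial A] : Y1.iz A ≠ Y1.zi A := fun h ↦
  ptInfty_ne_ptZero (face_zero_pairZI.symm.trans (congrArg (fun x : Y1 A ↦ x.val.face 0) h).symm)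

/-- The two pairs have opposite boundaries, which are nonzero because `0 ≠ ∞`, so their coefficients
in a cycle agree. -/
theorem eq_of_bdY_eq_zero [Nontrivial A] {y : Y1 A →₀ ZZ.{u}} (hy : (bdY A).hom y = 0) :
    y = Finsupp.single (Y1.iz A) (y (Y1.iz A)) + Finsupp.single (Y1.zi A) (y (Y1.iz A)) := by
  have h : y = Finsupp.single (Y1.iz A) (y (Y1.iz A)) +
      Finsupp.single (Y1.zi A) (y (Y1.zi A)) := by
    ext s
    rcases s.eq_or with rfl | rfl
    · rw [Finsupp.add_apply, Finsupp.single_eq_same, Finsupp.single_eq_of_ne Y1.iz_ne_zi,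
        add_zero]
    · rw [Finsupp.add_apply, Finsupp.single_eq_same, Finsupp.single_eq_of_ne Y1.iz_ne_zi.symm,
        zero_add]
  have h' : (bdY A).hom (Finsupp.single (Y1.iz A) (y (Y1.iz A)) +
      Finsupp.single (Y1.zi A) (y (Y1.zi A))) = 0 := by rw [← h]; exact hy
  have h'' := (map_add (bdY A).hom _ _).symm.trans h'
  rw [bdY_single_iz, bdY_single_zi] at h''
  have e := DFunLike.congr_fun (F := Y0 A →₀ ZZ.{u}) h'' (Y0.zero A)
  rw [Finsupp.add_apply, Finsupp.sub_apply, Finsupp.sub_apply, Finsupp.single_eq_same,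
    Finsupp.single_eq_of_ne Y0.zero_ne_infty, Finsupp.single_eq_of_ne Y0.zero_ne_infty,
    Finsupp.single_eq_same, sub_zero, zero_sub, Finsupp.zero_apply, ← sub_eq_add_neg,
    sub_eq_zero] at e
  rwa [← e] at h

variable (A) in
/-- A lift of the kernel of `bdY` to `X_2(A²)`. -/
def kerLift : kerRep (bdY A) →ₗ[ZZ.{u}] XMod A 2 :=
  LinearMap.toSpanSingleton ZZ.{u} (XMod A 2) (psiChain 1) ∘ₗ Finsupp.lapply (Y1.iz A) ∘ₗ
    (LinearMap.ker (bdY A).hom.toLinearMap).subtype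

theorem kerLift_apply (k : kerRep (bdY A)) : kerLift A k = k.1 (Y1.iz A) • psiChain 1 := rfl

theorem bdLin_kerLift [Nontrivial A] (k : kerRep (bdY A)) :
    bdLin A 1 (kerLift A k) = (inclY1 (A := A)).hom k.1 := by
  rw [kerLift_apply, map_smul, bdLin_psiChain_one]
  refine Eq.trans ?_ (congrArg (inclY1 (A := A)).hom (eq_of_bdY_eq_zero k.2)).symm
  refine Eq.trans ?_ (map_add (inclY1 (A := A)).hom _ _).symm
  rw [inclY1_single, inclY1_single, smul_add, Finsupp.smul_single, Finsupp.smul_single,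
    smul_eq_mul, mul_one]
  rfl

/-- Measures the failure of `kerLift` to be equivariant: diagonal elements contribute `ψ_1(a²)`,
antidiagonal ones `ψ_1(-a²)`. -/
theorem exists_smul_psiChain_sub (p : PSM A) (c : ZZ.{u}) :
    ∃ v : Zsucc A 1, RPmk A v ∈ psiSubmodule A ∧
      (kerIncl (bd A 1)).hom v = XRho A 2 p.1 (c • psiChain 1) - c • psiChain 1 := by
  obtain ⟨a, hp | hp⟩ := PSM_cases p.2
  · refine ⟨c • ⟨psiChain (a ^ 2) - psiChain 1, psiChain_sub_mem _ _⟩, ?_, ?_⟩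
    · rw [map_smul]
      exact Submodule.smul_mem _ c (psi1_sq_mem a)
    · refine Eq.trans (b := c • (psiChain (a ^ 2) - psiChain 1)) rfl ?_
      rw [hp, LinearMap.map_smul, dSL_smul_psiChain, mul_one, smul_sub]
  · refine ⟨c • ⟨psiChain (-a ^ 2) - psiChain 1, psiChain_sub_mem _ _⟩, ?_, ?_⟩
    · rw [map_smul]
      exact Submodule.smul_mem _ c (psi1_neg_sq_mem a)
    · refine Eq.trans (b := c • (psiChain (-a ^ 2) - psiChain 1)) rfl ?_
      rw [hp, LinearMap.map_smul, mSL_smul_psiChain, inv_one, mul_one, smul_sub]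

variable (A) in
/-- The lift of the chains with coefficients in the kernel of `bdY`. -/
def chainLift : ((Fin 1 → PSM A) →₀ kerRep (bdY A)) →ₗ[ZZ.{u}] ((Fin 1 → PSL A) →₀ X A 2) :=
  Finsupp.lsum ZZ.{u} fun x ↦ Finsupp.lsingle (fun i ↦ (x i).1) ∘ₗ kerLift A

theorem chainLift_single (x : Fin 1 → PSM A) (k : kerRep (bdY A)) :
    chainLift A (Finsupp.single x k) = Finsupp.single (fun i ↦ (x i).1) (kerLift A k) :=
  Finsupp.lsum_single _ _ _ _

theorem chainsMap_chainLift [Nontrivial A] (h : ExactBelowTwo A)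
    (f : (Fin 1 → PSM A) →₀ kerRep (bdY A)) :
    ((groupHomology.chainsMap (MonoidHom.id (PSL A)) (toIm (bd A 1))).f 1).hom (chainLift A f) =
      ((groupHomology.chainsMap (PSM A).subtype (kerInclY h)).f 1).hom f := by
  induction f using Finsupp.induction_linear with
  | zero => rw [map_zero, map_zero, map_zero]
  | add f g hf hg => rw [map_add, map_add, map_add, hf, hg]
  | single x k =>
    refine (congrArg _ (chainLift_single x k)).trans
      ((groupHomology.chainsMap_f_single _ _ 1 _ _).trans ?_)
    refine Eq.trans ?_ (groupHomology.chainsMap_f_single (PSM A).subtype (kerInclY h) 1 x k).symm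
    exact congrArg (Finsupp.single fun i ↦ (x i).1)
      (Subtype.ext (bdLin_kerLift k) : (toIm (bd A 1)).hom (kerLift A k) = (kerInclY h).hom k)

/-- No cycle condition on `f` is needed: each single chain already has a lift whose boundary is a
cycle with class in `psiSubmodule A`. -/
theorem exists_d_chainLift (f : (Fin 1 → PSM A) →₀ kerRep (bdY A)) :
    ∃ v : Zsucc A 1, RPmk A v ∈ psiSubmodule A ∧
      Finsupp.single (![] : Fin 0 → PSL A) ((kerIncl (bd A 1)).hom v) =
        (groupHomology.inhomogeneousChains.d (X A 2) 0).hom (chainLift A f) := by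
  induction f using Finsupp.induction_linear with
  | zero =>
    refine ⟨0, ?_, ?_⟩
    · rw [map_zero]
      exact zero_mem _
    · rw [map_zero, map_zero, map_zero, Finsupp.single_zero]
  | add f g hf hg =>
    obtain ⟨v, hv, hv'⟩ := hf
    obtain ⟨w, hw, hw'⟩ := hg
    refine ⟨v + w, ?_, ?_⟩
    · rw [map_add]
      exact add_mem hv hw
    · rw [map_add, map_add, map_add, Finsupp.single_add, hv', hw']
  | single x k =>
    -- The inverse appears because the differential of `[g] ⊗ v` is `g⁻¹v - v`.
    obtain ⟨v, hv, hv'⟩ := exists_smul_psiChain_sub (x 0)⁻¹ (k.1 (Y1.iz A))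
    refine ⟨v, hv, ?_⟩
    have hx : (fun i ↦ (x i).1) = ![(x 0).1] := by
      funext i; fin_cases i; rfl
    rw [chainLift_single, hx, d_single_one, ← Finsupp.single_sub]
    exact congrArg (Finsupp.single (![] : Fin 0 → PSL A)) hv'

theorem edgeRP_HmapZ_mem [Nontrivial A] (h : ExactBelowTwo A) (x : H 3 (triv (PSM A))) :
    edgeRP h (HmapZ (PSM A).subtype 3 x) ∈ psiSubmodule A := by
  rw [edgeRP_HmapZ]
  generalize Hδ 1 (kerSeq_shortExact (bdY A)) _ = z
  obtain ⟨f, hf⟩ := exists_represents z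
  obtain ⟨v, hv, hv'⟩ := exists_d_chainLift f
  have hz := hf.map (PSM A).subtype (kerInclY h)
  rw [← chainsMap_chainLift h f] at hz
  rw [delta2_eq hz v hv']
  exact hv

end Image


/-! ### The kernel of the edge map -/

section Chase

theorem map_Hmap_eq {G G' : Type u} [Group G] [Group G'] (φ : G →* G') {L M : Rep.{u} ZZ.{u} G}
    {M' N : Rep.{u} ZZ.{u} G'} (f : L ⟶ M) (g : M ⟶ Rep.res φ N) (f' : L ⟶ Rep.res φ M')
    (g' : M' ⟶ N) (h : ∀ x, g.hom (f.hom x) = g'.hom (f'.hom x)) (n : ℕ) (x : H n L) :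
    (groupHomology.map φ g n).hom (Hmap n f x) =
      Hmap n g' ((groupHomology.map φ f' n).hom x) := by
  refine (map_map_eq (φ := MonoidHom.id G) f g (f ≫ g) (fun _ ↦ rfl) (fun _ ↦ rfl) n x).trans ?_
  exact (map_map_eq (ψ := MonoidHom.id G') f' g' (f ≫ g) (fun _ ↦ rfl)
    (fun x ↦ (h x).symm) n x).symm

variable {A : Type u} [CommRing A]

/-- The preceding term of the long exact sequence is `H_1(PSL₂(A), X_2)`, which vanishes because the
action on triples is free. -/
theorem delta2_injective : Function.Injective (delta2 A) := by
  refine (injective_iff_map_eq_zero _).2 fun z hz ↦ ?_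
  obtain ⟨t, rfl⟩ := (exact_Hmap_Hδ (kerSeq_shortExact (bd A 1)) 0 z).1 hz
  have ht : t = 0 := H1_perm_eq_zero (G := PSL A) (S := Tuple A 2) eq_one_of_smul_eq t
  rw [ht, map_zero]

theorem PT_le_PSM : PT A ≤ PSM A := Subgroup.map_mono fun _ h ↦ Or.inl h

/-- The map `ℤ → X_0(A²)` over `PB(A) → PSL₂(A)` given by the point `∞`. -/
def pointB : triv (PB A) ⟶ Rep.res (PB A).subtype (X A 0) :=
  permPoint (G' := PSL A) (S' := Tuple A 0) (PB A).subtype (ptInfty A) fun g ↦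
    (smul_ptInfty_iff g.1).2 g.2

/-- The map `ℤ → X_0(A²)` over `PT(A) → PSL₂(A)` given by the point `∞`. -/
def pointT0 : triv (PT A) ⟶ Rep.res (PT A).subtype (X A 0) :=
  permPoint (G' := PSL A) (S' := Tuple A 0) (PT A).subtype (ptInfty A) fun g ↦
    (smul_ptInfty_iff g.1).2 (PT_le_PB A g.2)

/-- The map `ℤ → X_1(A²)` over `PT(A) → PSL₂(A)` given by the pair `(∞, 0)`. -/
def pointT : triv (PT A) ⟶ Rep.res (PT A).subtype (X A 1) :=
  permPoint (G' := PSL A) (S' := Tuple A 1) (PT A).subtype (pairIZ A) fun g ↦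
    (smul_pairIZ_iff g.1).2 g.2

/-- The map `ℤ → ℤ[{∞, 0}]` over `PT(A) → PSM₂(A)` given by the point `∞`. -/
def pointY0 : triv (PT A) ⟶ Rep.res (Subgroup.inclusion PT_le_PSM) (perm (PSM A) (Y0 A)) :=
  permPoint (Subgroup.inclusion PT_le_PSM) (Y0.infty A) fun g ↦
    Y0.ext ((smul_ptInfty_iff g.1).2 (PT_le_PB A g.2))

/-- The map `ℤ → ℤ[{(∞, 0), (0, ∞)}]` over `PT(A) → PSM₂(A)` given by the pair `(∞, 0)`. -/
def pointY1 : triv (PT A) ⟶ Rep.res (Subgroup.inclusion PT_le_PSM) (perm (PSM A) (Y1 A)) :=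
  permPoint (Subgroup.inclusion PT_le_PSM) (Y1.iz A) fun g ↦
    Y1.ext ((smul_pairIZ_iff g.1).2 g.2)

theorem map_pointB_bijective (n : ℕ) :
    Function.Bijective (groupHomology.map (PB A).subtype (pointB (A := A)) (n + 1)).hom :=
  map_bijective_of_transitive (G := PSL A) (S := Tuple A 0) (PB A).subtype (ptInfty A) pointB
    (fun _ ↦ rfl) exists_smul_ptInfty Subtype.val_injective
    (fun g ↦ by rw [Subgroup.range_subtype]; exact smul_ptInfty_iff g) n

theorem map_pointT_bijective (n : ℕ) :
    Function.Bijective (groupHomology.map (PT A).subtype (pointT (A := A)) (n + 1)).hom :=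
  map_bijective_of_transitive (G := PSL A) (S := Tuple A 1) (PT A).subtype (pairIZ A) pointT
    (fun _ ↦ rfl) exists_smul_pairIZ Subtype.val_injective
    (fun g ↦ by rw [Subgroup.range_subtype]; exact smul_pairIZ_iff g) n

/-- The antidiagonal elements exchange `∞` and `0`, which are distinct for `A ≠ 0`. Hence the action
is transitive and the stabilizer of `∞` is `PT(A)`. -/
theorem map_pointY0_bijective [Nontrivial A] (n : ℕ) : Function.Bijective
    (groupHomology.map (Subgroup.inclusion PT_le_PSM) (pointY0 (A := A)) (n + 1)).hom := by
  refine map_bijective_of_transitive (G := PSM A) (S := Y0 A) (Subgroup.inclusion PT_le_PSM)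
    (Y0.infty A) pointY0 (fun _ ↦ rfl) (fun s ↦ ?_) (Subgroup.inclusion_injective _)
    (fun g ↦ ⟨fun hg ↦ ?_, ?_⟩) n
  · rcases s.eq_or with rfl | rfl
    · exact ⟨1, one_smul _ _⟩
    · exact ⟨⟨_, mSL_mem 1⟩, Y0.ext (mSL_smul_ptInfty 1)⟩
  · obtain ⟨a, hp | hp⟩ := PSM_cases g.2
    · exact ⟨⟨g.1, hp ▸ dSL_mem_PT a⟩, rfl⟩
    · have e : g.1 • ptInfty A = ptInfty A := congrArg Y0.val hg
      rw [hp, mSL_smul_ptInfty] at e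
      exact absurd e.symm ptInfty_ne_ptZero
  · rintro ⟨t, rfl⟩
    exact Y0.ext ((smul_ptInfty_iff t.1).2 (PT_le_PB A t.2))

theorem exists_of_edgeRP_eq_zero [Nontrivial A] (h : ExactBelowTwo A)
    (h₂ : Function.Injective (HmapZ (Subgroup.inclusion (PT_le_PB A)) 2))
    (h₃ : Function.Surjective (HmapZ (Subgroup.inclusion (PT_le_PB A)) 3))
    {w : H 3 (triv (PSL A))} (hw : edgeRP h w = 0) :
    ∃ x, HmapZ (PSM A).subtype 3 x = w := by
  have hG := cokerSeq_shortExact (bd A 0) (aug A) h.exact_zero h.surjective_aug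
  have hY := cokerSeq_shortExact (bdY A) (augY A) bdY_exact augY_surjective
  have hw₁ : Hδ 1 (imSeq_shortExact (bd A 1) (bd A 0) h.exact_one) (Hδ 2 hG w) = 0 :=
    delta2_injective (hw.trans (map_zero _).symm)
  obtain ⟨t, ht⟩ := (exact_Hmap_Hδ (imSeq_shortExact (bd A 1) (bd A 0) h.exact_one) 1 _).1 hw₁
  -- Shapiro's lemma at index `1` concerns degree `2`. The class now lives on `PT(A)`, so it can be
  -- pushed into the small complex.
  obtain ⟨t', rfl⟩ := (map_pointT_bijective (A := A) 1).2 t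
  let s : H 2 (perm (PSM A) (Y1 A)) :=
    (groupHomology.map (Subgroup.inclusion PT_le_PSM) pointY1 2).hom t'
  have hs : (groupHomology.map (PSM A).subtype (inclY1 (A := A)) 2).hom s =
      (groupHomology.map (PT A).subtype pointT 2).hom t' :=
    map_map_eq pointY1 inclY1 pointT (fun _ ↦ rfl) (fun c ↦ inclY1_single _ c) 2 t'
  let v₁ : H 2 (imRep (bdY A)) := Hmap 2 (toIm (bdY A)) s
  have hv₁ : (groupHomology.map (PSM A).subtype (imInclY A) 2).hom v₁ = Hδ 2 hG w := by
    rw [← ht, ← hs]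
    exact map_Hmap_eq (PSM A).subtype (toIm (bdY A)) (imInclY A) inclY1 (toIm (bd A 0))
      (fun x ↦ Subtype.ext (inclY0_bdY x)) 2 s
  have hv₀ : (groupHomology.map (PSM A).subtype (inclY0 (A := A)) 2).hom
      (Hmap 2 (imIncl (bdY A)) v₁) = 0 := by
    refine (map_Hmap_eq (PSM A).subtype (imIncl (bdY A)) inclY0 (imInclY A) (imIncl (bd A 0))
      (fun _ ↦ rfl) 2 v₁).trans ?_
    rw [hv₁]
    exact (exact_Hδ_Hmap hG 2 _).2 ⟨w, rfl⟩
  -- After Shapiro on both sides, the map from `H_2(PSM₂(A), ℤ[{∞, 0}])` to `H_2(PSL₂(A), X_0)` is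
  -- `H_2(PT) → H_2(PB)`, which is injective by `h₂`.
  have hv : Hmap 2 (imIncl (bdY A)) v₁ = 0 := by
    obtain ⟨v', hv'⟩ := (map_pointY0_bijective (A := A) 1).2 (Hmap 2 (imIncl (bdY A)) v₁)
    rw [← hv'] at hv₀ ⊢
    have e₁ := map_map_eq pointY0 inclY0 pointT0 (fun _ ↦ rfl) (fun c ↦ inclY0_single _ c) 2 v'
    have e₂ := map_map_eq (Rep.ofHom ⟨LinearMap.id, fun _ ↦ rfl⟩ :
      triv (PT A) ⟶ Rep.res (Subgroup.inclusion (PT_le_PB A)) (triv (PB A))) pointB pointT0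
      (fun _ ↦ rfl) (fun _ ↦ rfl) 2 v'
    have e₃ : HmapZ (Subgroup.inclusion (PT_le_PB A)) 2 v' = 0 :=
      (map_pointB_bijective (A := A) 1).1 (e₂.trans (e₁.symm.trans (hv₀.trans (map_zero _).symm)))
    rw [h₂ (e₃.trans (map_zero _).symm), map_zero]
  obtain ⟨w', hw'⟩ := (exact_Hδ_Hmap hY 2 v₁).1 hv
  have hδ : Hδ 2 hG (HmapZ (PSM A).subtype 3 w') = Hδ 2 hG w := by
    rw [← hv₁, ← hw']
    exact Hδ_naturality (PSM A).subtype hY hG (imInclY A) inclY0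
      (Rep.ofHom ⟨LinearMap.id, fun _ ↦ rfl⟩) (fun _ ↦ rfl) (fun x ↦ (aug_inclY0 x).symm) 2 w'
  -- The difference has trivial connecting image, so it comes from `H_3(PSL₂(A), X_0) = H_3(PB)`. By
  -- `h₃` it then comes from `PT(A)`, which lies in `PSM₂(A)`.
  obtain ⟨x, hx⟩ := (exact_Hmap_Hδ hG 2 (w - HmapZ (PSM A).subtype 3 w')).1 (by
    rw [map_sub, hδ, sub_self])
  obtain ⟨x', rfl⟩ := (map_pointB_bijective (A := A) 2).2 x
  obtain ⟨x'', rfl⟩ := h₃ x'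
  refine ⟨w' + HmapZ (Subgroup.inclusion PT_le_PSM) 3 x'', ?_⟩
  rw [map_add, ← eq_sub_iff_add_eq', ← hx]
  have e₁ := map_map_eq (Rep.ofHom ⟨LinearMap.id, fun _ ↦ rfl⟩ :
      triv (PT A) ⟶ Rep.res (Subgroup.inclusion (PT_le_PB A)) (triv (PB A))) pointB pointT0
      (fun _ ↦ rfl) (fun _ ↦ rfl) 3 x''
  have e₂ := map_map_eq (ψ := MonoidHom.id (PSL A)) pointT0 (aug A)
    (Rep.ofHom ⟨LinearMap.id, fun _ ↦ rfl⟩ : triv (PT A) ⟶ Rep.res (PT A).subtype (triv (PSL A)))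
    (fun _ ↦ rfl) (fun c ↦ aug_single _ c) 3 x''
  have e₃ := map_map_eq (Rep.ofHom ⟨LinearMap.id, fun _ ↦ rfl⟩ :
      triv (PT A) ⟶ Rep.res (Subgroup.inclusion PT_le_PSM) (triv (PSM A)))
    (Rep.ofHom ⟨LinearMap.id, fun _ ↦ rfl⟩ : triv (PSM A) ⟶ Rep.res (PSM A).subtype (triv (PSL A)))
    (Rep.ofHom ⟨LinearMap.id, fun _ ↦ rfl⟩ : triv (PT A) ⟶ Rep.res (PT A).subtype (triv (PSL A)))
    (fun _ ↦ rfl) (fun _ ↦ rfl) 3 x''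
  exact (e₃.trans e₂.symm).trans (congrArg (Hmap 3 (aug A)) e₁.symm)

end Chase


/-! ### The image of the edge map, and exactness -/

section Edge

variable {A : Type u} [CommRing A]

/-- By exactness image and kernel coincide. The map `r` induced by the identity of `M` inverts the
inclusion. -/
theorem Hmap_imToKer_injective {G : Type u} [Group G] {L M N : Rep.{u} ZZ.{u} G} (f : L ⟶ M)
    (g : M ⟶ N) (h : Function.Exact f.hom g.hom) (h' : f ≫ g = 0) (n : ℕ) :
    Function.Injective (Hmap n (imToKer f g h')) := by
  let r : kerRep g ⟶ Rep.res (MonoidHom.id G) (imRep f) :=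
    kerMap (M' := M) (N' := N) (MonoidHom.id G) g f g h (𝟙 M) (𝟙 N) fun _ ↦ rfl
  refine Function.LeftInverse.injective
    (g := (groupHomology.map (MonoidHom.id G) r n).hom) fun z ↦ ?_
  refine (map_map_eq (M := kerRep g) (N := imRep f) (φ := MonoidHom.id G) (ψ := MonoidHom.id G)
    (θ := MonoidHom.id G) (imToKer f g h') r (𝟙 (imRep f)) (fun _ ↦ rfl) (fun _ ↦ rfl) n z).trans ?_
  exact congrArg (fun F ↦ F.hom z) (groupHomology.map_id n)

theorem incB1Z1_injective (h : ExactBelowTwo A) : Function.Injective (incB1Z1 A) :=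
  Hmap_imToKer_injective (bd A 1) (bd A 0) h.exact_one (bd_comp_bd A) 1

/-- The graph description of `RB A` supplies `z` and `y`, with `y` dying in `H_2(PSL₂(A), X_0)`. So
`y` is the connecting image of some `w`, and injectivity of `incB1Z1` identifies `z` with the next
connecting image. -/
theorem exists_edgeRP_eq (h : ExactBelowTwo A) {x : RP A} (hx : x ∈ RB A) :
    ∃ w, edgeRP h w = x := by
  obtain ⟨z, y, rfl, hy, hy'⟩ := (mem_lam1 A x 0).1 hx
  obtain ⟨w, rfl⟩ := (exact_Hδ_Hmap
    (cokerSeq_shortExact (bd A 0) (aug A) h.exact_zero h.surjective_aug) 2 y).1 hy'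
  rw [← delta1_eq h] at hy
  exact ⟨w, congrArg (delta2 A) (incB1Z1_injective h hy)⟩

theorem edgeQuot_surjective (h : ExactBelowTwo A) : Function.Surjective (edgeQuot h) := by
  intro q
  obtain ⟨x, rfl⟩ := Submodule.mkQ_surjective _ q
  obtain ⟨w, hw⟩ := exists_edgeRP_eq h x.2
  exact ⟨w, congrArg _ (Subtype.ext hw)⟩

theorem edgeQuot_eq_zero_iff (h : ExactBelowTwo A) (w : H 3 (triv (PSL A))) :
    edgeQuot h w = 0 ↔ edgeRP h w ∈ psiSubmodule A :=
  Submodule.Quotient.mk_eq_zero _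

theorem exact_HmapZ_edgeQuot [Nontrivial A] (h : ExactBelowTwo A)
    (h₂ : Function.Injective (HmapZ (Subgroup.inclusion (PT_le_PB A)) 2))
    (h₃ : Function.Surjective (HmapZ (Subgroup.inclusion (PT_le_PB A)) 3)) :
    Function.Exact (HmapZ (PSM A).subtype 3) (edgeQuot h) := by
  refine fun w ↦ (edgeQuot_eq_zero_iff h w).trans ⟨fun hw ↦ ?_, ?_⟩
  · obtain ⟨x, hx⟩ := psiSubmodule_le_range h hw
    have hx' : edgeRP h (HmapZ (PSM A).subtype 3 x) = edgeRP h w := hx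
    obtain ⟨y, hy⟩ := exists_of_edgeRP_eq_zero h h₂ h₃
      (w := w - HmapZ (PSM A).subtype 3 x) (by rw [map_sub, hx', sub_self])
    exact ⟨y + x, by rw [map_add, hy, sub_add_cancel]⟩
  · rintro ⟨x, rfl⟩
    exact edgeRP_HmapZ_mem h x

/-- For the zero ring `PSL₂(A)` is trivial and its third homology vanishes. -/
theorem exact_HmapZ_edgeQuot_of_subsingleton [Subsingleton A] (h : ExactBelowTwo A) :
    Function.Exact (HmapZ (PSM A).subtype 3) (edgeQuot h) := by
  have : Subsingleton (Matrix.SpecialLinearGroup (Fin 2) A) :=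
    ⟨fun _ _ ↦ Subtype.ext (Subsingleton.elim _ _)⟩
  have : Subsingleton (PSL A) :=
    (QuotientGroup.mk_surjective (s := Subgroup.center _)).subsingleton
  have h₃ : Subsingleton (H 3 (triv (PSL A))) := ModuleCat.subsingleton_of_isZero
    (isZero_groupHomology_succ_of_subsingleton _ 2)
  intro w
  rw [Subsingleton.elim w 0, map_zero]
  exact ⟨fun _ ↦ ⟨0, map_zero _⟩, fun _ ↦ rfl⟩

end Edge

end RefinedBloch
end

theorem theorem4p1 {A : Type u} [CommRing A]
    (hX : RefinedBloch.ExactBelowTwo A)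
    (hμ : {a : A | a ^ 2 = 1} = {1, -1})
    (h₂ : Function.Bijective
      (RefinedBloch.HmapZ (Subgroup.inclusion (RefinedBloch.PT_le_PB A)) 2))
    (h₃ : Function.Bijective
      (RefinedBloch.HmapZ (Subgroup.inclusion (RefinedBloch.PT_le_PB A)) 3)) :
    RefinedBloch.psiSubmodule A ≤ RefinedBloch.RB A ∧
      Function.Exact (RefinedBloch.HmapZ (RefinedBloch.PSM A).subtype 3)
        (RefinedBloch.edgeQuot hX) ∧
      Function.Surjective (RefinedBloch.edgeQuot hX) := by
  refine ⟨RefinedBloch.psiSubmodule_le_RB hX, ?_, RefinedBloch.edgeQuot_surjective hX⟩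
  -- Over the zero ring `0 = ∞`, so the two-point complex degenerates and this case is treated
  -- apart.
  rcases subsingleton_or_nontrivial A with hA | hA
  · exact RefinedBloch.exact_HmapZ_edgeQuot_of_subsingleton hX
  · exact RefinedBloch.exact_HmapZ_edgeQuot hX h₂.1 h₃.2
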